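/- **Setting.** Let $d\in\{1,2,3\}$ and let $D\subset\mathbb R^d$ be nonempty, open and bounded (for instance a bounded Lipschitz domain). Let $\mathcal H=H^1_0(D)^d$ with $\|u\|_{\mathcal H}=\big(\sum_{i,j}\|\partial u_i/\partial x_j\|_{L^2(D)}^2\big)^{1/2}$, let $\mathcal H^*$ be its dual with the dual norm, and let $\mathcal L=\{q\in L^2(D):\int_D q=0\}$ with the $L^2$-norm. Let $C_4>0$ satisfy $\|w\|_{L^4(D)}\le C_4\|\nabla w\|_{L^2(D)}$ for all $w\in H^1_0(D)$. For $A,B,M\in L^\infty(D)^{d\times d}$ (norm $\|N\|_\infty=\operatorname{ess\,sup}_x|N(x)|_F$, $|\cdot|_F$ the Frobenius norm) and $(\nabla u)_{ij}=\partial u_i/\partial x_j$ put $$a(u,v;A)=\int_D \operatorname{tr}(\nabla u^\top A^\top\nabla v),\quad b(v,p;B)=-\int_D\operatorname{tr}(\nabla v\,B\,p),\quad m(u,v,w;M)=\int_D(\nabla v\,M\,u)^\top w .$$ Let $U\subset\mathbb R^s$, $s<\infty$, be a set of unique differentiability (for instance an open set or a box $[-\frac12,\frac12]^s$); all derivatives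 in $y\in U$ are taken relative to $U$. Let $A,B,M:U\to L^\infty(D)^{d\times d}$, $f:U\to\mathcal H^*$, $g:U\to\mathcal L$ be $C^\infty$ on $U$. For $y\in U$, a pair $(u,p)\in\mathcal H\times\mathcal L$ is a *solution at $y$* if $$a(u,v;A(y))+m(u,u,v;M(y))-b(v,p;B(y))=\langle f(y),v\rangle\ \ \forall v\in\mathcal H,\qquad b(u,q;B(y))=\int_D g(y)\,q\ \ \forall q\in\mathcal L .$$ **Assumptions.** Let $\bar a,\bar b,\bar m,\alpha,\beta>0$, $\bar f,\bar g\in\mathbb R$, $\delta\ge1$ and $R\in(0,\infty)^s$ be such that for all $y\in U$: 1. for a.e. $x\in D$ the matrices $A(y)(x),B(y)(x),M(y)(x)$ are nonsingular and $A(y)(x)$ is symmetric; $\|A(y)\|_\infty\le\frac{\bar a}2$, $\|B(y)\|_\infty\le\frac{\bar b}2$, $\|M(y)\|_\infty\le C_4^{-2}\frac{\bar m}2$; 2. $\alpha\|u\|_{\mathcal H}^2\le a(u,u;A(y))$ for all $u\in\mathcal H$, and $\beta\le\inf_{0\ne p\in\mathcal L}\sup_{0\ne u\in\mathcal H}\frac{b(u,p;B(y))}{\|u\|_{\mathcal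 H}\|p\|_{\mathcal L}}$; 3. $\|f(y)\|_{\mathcal H^*}\le\frac{\bar f}2$, $\|g(y)\|_{\mathcal L}\le\frac{\bar g}2$, and $\frac{\bar f}\alpha+\frac{\bar g}\beta<\frac\alpha{\bar m}$; 4. for all multi-indices $\nu\in\mathbb N_0^s$, each of $\frac{\|\partial^\nu A(y)\|_\infty}{\bar a}$, $\frac{\|\partial^\nu B(y)\|_\infty}{\bar b}$, $\frac{\|\partial^\nu M(y)\|_\infty}{C_4^{-2}\bar m}$ is at most $\frac12\frac{(|\nu|!)^\delta}{(2R)^\nu}$, and $\|\partial^\nu f(y)\|_{\mathcal H^*}\le\frac{\bar f}2\frac{(|\nu|!)^\delta}{(2R)^\nu}$, $\|\partial^\nu g(y)\|_{\mathcal L}\le\frac{\bar g}2\frac{(|\nu|!)^\delta}{(2R)^\nu}$. Let $\gamma\in(0,\frac\alpha{\bar m})$ be such that $\frac{\bar f}{2\alpha}+\frac{\bar g}{2\beta}+\frac{\bar m}{2\alpha}\gamma^2=\gamma$. **Constants.** Put $\tilde\alpha=\alpha-\bar m\gamma$, $\bar p=\frac1\beta\big(\frac{\bar f}2+\frac{\bar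 a\gamma}2+\frac{\bar m\gamma^2}2\big)$, $C_u=\gamma\sigma_u$, $C_p=\bar p\,\sigma_p$, $\rho=\max\{1,\rho_u,\rho_p\}$, where $$\sigma_u=\frac1{\gamma\tilde\alpha}\Big(\bar f+\bar b\bar p+\gamma\big(\bar m\tfrac{\bar g+\bar b\gamma}{\beta}+\bar a+\bar m\gamma\big)\Big)+\frac{\bar g+\bar b\gamma}{\gamma\beta},$$ $$\sigma_p=\frac1{\beta\bar p}\Big(\bar f+\bar b\bar p+\bar a\gamma\big(1+\tfrac{\sigma_u}2\big)+\bar m\gamma^2(1+\sigma_u)\Big),$$ $$\rho_u=\frac{\big(1+\frac{\gamma\bar m}{\tilde\alpha}\big)(\bar g+\bar b\gamma+2C_u\bar b)}{\beta C_u}+\frac{\bar f+\bar b\bar p+\gamma(\bar a+\bar m\gamma)+2C_p\bar b}{\tilde\alpha C_u}+\frac{2\bar a+4\bar m\gamma+7\bar mC_u}{\tilde\alpha},$$ $$\rho_p=\frac{\bar f+\bar b\bar p+\gamma(\bar a+\bar m\gamma)+2C_u\bar a+4\bar m\gamma C_u+7\bar mC_u^2}{\beta C_p}+\frac{C_u\rho_u}{\beta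 C_p}\Big(\frac{\bar a}2+\gamma\bar m\Big).$$ Let $[\tfrac12]_n=\big|\prod_{k=0}^{n-1}(\tfrac12-k)\big|$, $R^\nu=\prod_jR_j^{\nu_j}$, $|\nu|=\sum_j\nu_j$. **Theorem.** (i) For every $y\in U$ there is at most one solution $(u,p)$ at $y$ with $\|u\|_{\mathcal H}\le\gamma$. (ii) Let $y\in U$ and $\mathcal V=\{v\in\mathcal H: b(v,q;B(y))=0\ \forall q\in\mathcal L\}$. If there is $w\in\mathcal H$ with $a(w,v;A(y))=0$ for all $v\in\mathcal V$, $b(w,q;B(y))=\int_Dg(y)q$ for all $q\in\mathcal L$ and $\|w\|_{\mathcal H}\le\frac{\bar g}{2\beta}$ (for instance if $g(y)=0$), then a solution at $y$ with $\|u\|_{\mathcal H}\le\gamma$ exists. (iii) Let $(u(y),p(y))$, $y\in U$, be the solutions with $\|u(y)\|_{\mathcal H}\le\gamma$, assumed to exist for every $y\in U$. Then $u:U\to\mathcal H$ and $p:U\to\mathcal L$ are $C^\infty$ on $U$, and for all $\nu\in\mathbb N_0^s\setminus\{0\}$ and all $y\in U$ $$\|\partial^\nu u(y)\|_{\mathcal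 H}\le\frac{C_u\,\rho^{|\nu|-1}[\frac12]_{|\nu|}}{R^\nu}(|\nu|!)^{\delta-1},\qquad \|\partial^\nu p(y)\|_{\mathcal L}\le\frac{C_p\,\rho^{|\nu|-1}[\frac12]_{|\nu|}}{R^\nu}(|\nu|!)^{\delta-1}.$$ -/

import Mathlib

open MeasureTheory Set Topology
open scoped ContDiff ENNReal Matrix Gradient

attribute [local instance] Matrix.frobeniusNormedAddCommGroup Matrix.frobeniusNormedSpace

noncomputable section

namespace ParamNS

/-! ### The spatial domain -/

/-- `ℝ^d` with the Euclidean norm. -/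
abbrev Space (d : ℕ) : Type := EuclideanSpace ℝ (Fin d)

/-- Real `d × d` matrices; their norm is the Frobenius norm. -/
abbrev Mat (d : ℕ) : Type := Matrix (Fin d) (Fin d) ℝ

/-- A nonempty bounded open subset of `ℝ^d`, `d ≥ 1`. No regularity of the boundary is required. -/
structure BoundedDomain (d : ℕ) where
  carrier : Set (Space d)
  dim_pos : 0 < d
  isOpen : IsOpen carrier
  nonempty : carrier.Nonempty
  isBounded : Bornology.IsBounded carrier

variable {d : ℕ}

/-- Lebesgue measure on the domain. -/
def BoundedDomain.vol (D : BoundedDomain d) : Measure (Space d) :=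
  volume.restrict D.carrier

instance (D : BoundedDomain d) : IsFiniteMeasure D.vol :=
  ⟨by
    rw [BoundedDomain.vol, Measure.restrict_apply_univ]
    exact D.isBounded.measure_lt_top⟩

/-! ### The scalar Sobolev space `H¹₀(D)` -/

/-- Test functions: `C^∞` with compact support contained in `D`. -/
structure IsTest (D : BoundedDomain d) (φ : Space d → ℝ) : Prop where
  smooth : ContDiff ℝ ∞ φ
  compact : HasCompactSupport φ
  support : tsupport φ ⊆ D.carrier

/-- The pairs `(φ, ∇φ) ∈ L²(D) × L²(D; ℝ^d)` with `φ` a test function. -/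
def testGraph (D : BoundedDomain d) :
    Submodule ℝ (Lp ℝ 2 D.vol × Lp (Space d) 2 D.vol) where
  carrier := {w | ∃ φ : Space d → ℝ, IsTest D φ ∧ w.1 =ᵐ[D.vol] φ ∧ w.2 =ᵐ[D.vol] ∇ φ}
  zero_mem' := by
    refine ⟨fun _ => 0, ⟨contDiff_const, HasCompactSupport.zero, by simp [tsupport]⟩, ?_, ?_⟩
    · exact Lp.coeFn_zero _ _ _
    · refine (Lp.coeFn_zero _ _ _).trans (Filter.Eventually.of_forall fun x => ?_)
      simp [gradient]
  add_mem' := by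
    rintro v w ⟨φ, hφ, h1, h2⟩ ⟨ψ, hψ, h3, h4⟩
    refine ⟨φ + ψ, ⟨hφ.smooth.add hψ.smooth, hφ.compact.add hψ.compact,
      (tsupport_add φ ψ).trans (union_subset hφ.support hψ.support)⟩, ?_, ?_⟩
    · exact (Lp.coeFn_add _ _).trans (h1.add h3)
    · refine (Lp.coeFn_add _ _).trans ((h2.add h4).trans (Filter.Eventually.of_forall fun x => ?_))
      have e1 : DifferentiableAt ℝ φ x := hφ.smooth.differentiable (by simp) x
      have e2 : DifferentiableAt ℝ ψ x := hψ.smooth.differentiable (by simp) x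
      simp [gradient, fderiv_add e1 e2]
  smul_mem' := by
    rintro c w ⟨φ, hφ, h1, h2⟩
    refine ⟨c • φ, ⟨hφ.smooth.const_smul c, hφ.compact.smul_left (f := fun _ => c),
      (closure_mono (Function.support_const_smul_subset c φ)).trans hφ.support⟩, ?_, ?_⟩
    · exact (Lp.coeFn_smul _ _).trans (h1.const_smul c)
    · refine (Lp.coeFn_smul _ _).trans ((h2.const_smul c).trans
        (Filter.Eventually.of_forall fun x => ?_))
      have e1 : DifferentiableAt ℝ φ x := hφ.smooth.differentiable (by simp) x
      simp [gradient, fderiv_const_smul e1 c]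

/-- The square of the `L²` norm as an integral. -/
theorem Lp_two_norm_sq {F : Type*} [NormedAddCommGroup F] {μ : Measure (Space d)} (w : Lp F 2 μ) :
    ‖w‖ ^ 2 = ∫ x, ‖w x‖ ^ 2 ∂μ := by
  have h := Lp.norm_def w
  have h2 := (Lp.memLp w).eLpNorm_eq_integral_rpow_norm (by norm_num) (by norm_num)
  rw [h, h2, ENNReal.toReal_ofReal (by positivity)]
  have hn : 0 ≤ ∫ x, ‖w x‖ ^ 2 ∂μ := integral_nonneg fun x => by positivity
  simp only [ENNReal.toReal_ofNat, Real.rpow_ofNat]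
  rw [← Real.rpow_natCast, ← Real.rpow_mul hn]
  norm_num

/-- Friedrichs' inequality on the pairs `(φ, ∇φ)`. -/
theorem testGraph_friedrichs (D : BoundedDomain d) :
    ∃ K : ℝ, ∀ w ∈ testGraph D, ‖w.1‖ ≤ K * ‖w.2‖ := by
  obtain ⟨r, hr⟩ := D.isBounded.subset_closedBall (0 : Space d)
  have hr0 : 0 ≤ r := by
    obtain ⟨x, hx⟩ := D.nonempty
    exact dist_nonneg.trans (hr hx)
  refine ⟨2 * r, fun w hw => ?_⟩
  obtain ⟨φ, hφ, h1, h2⟩ := hw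
  let i : Fin d := ⟨0, D.dim_pos⟩
  let e : Space d := EuclideanSpace.single i 1
  let X : Space d →L[ℝ] ℝ := EuclideanSpace.proj i
  have hX : ∀ x, X x = x i := fun x => rfl
  have hXe : X e = 1 := by simp [hX, e]
  have hφc : Continuous φ := hφ.smooth.continuous
  have hφd : Differentiable ℝ φ := hφ.smooth.differentiable (by simp)
  have hdc : Continuous (fderiv ℝ φ) := hφ.smooth.continuous_fderiv (by simp)
  have hsq : ∀ x, HasFDerivAt (fun x => φ x ^ 2) ((2 * φ x) • fderiv ℝ φ x) x := fun x => by
    have := (hφd x).hasFDerivAt.pow 2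
    simpa using this
  have hsqd : ∀ x, fderiv ℝ (fun x => φ x ^ 2) x e = 2 * φ x * fderiv ℝ φ x e := fun x => by
    rw [(hsq x).fderiv]; simp
  have hgc : Continuous (fun x => gradient φ x) :=
    (InnerProductSpace.toDual ℝ (Space d)).symm.continuous.comp hdc
  have cs2 : HasCompactSupport (fun x => φ x ^ 2) :=
    hφ.compact.comp_left (g := fun t : ℝ => t ^ 2) (by norm_num)
  have csg : HasCompactSupport (fun x => gradient φ x) :=
    (hφ.compact.fderiv ℝ).comp_left (g := (InnerProductSpace.toDual ℝ (Space d)).symm) (by simp)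
  have csg2 : HasCompactSupport (fun x => ‖gradient φ x‖ ^ 2) :=
    csg.comp_left (g := fun v : Space d => ‖v‖ ^ 2) (by simp)
  have I1 : Integrable (fun x => φ x ^ 2) := (hφc.pow 2).integrable_of_hasCompactSupport cs2
  have I2 : Integrable (fun x => ‖gradient φ x‖ ^ 2) :=
    (hgc.norm.pow 2).integrable_of_hasCompactSupport csg2
  have key : ∫ x, φ x ^ 2 = -∫ x, 2 * φ x * fderiv ℝ φ x e * X x := by
    have h := integral_mul_fderiv_eq_neg_fderiv_mul_of_integrable (μ := (volume : Measure (Space d)))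
      (f := fun x => φ x ^ 2) (g := fun x => X x) (v := e) ?_ ?_ ?_
      (fun x _ => (hsq x).differentiableAt) (fun x _ => X.differentiableAt)
    · simp only [hsqd, ContinuousLinearMap.fderiv, hXe, mul_one] at h
      exact h
    · simp only [hsqd]
      refine Continuous.integrable_of_hasCompactSupport (by fun_prop) ?_
      exact ((hφ.compact.mul_left (f := fun _ => (2 : ℝ))).mul_right).mul_right
    · simp only [ContinuousLinearMap.fderiv, hXe, mul_one]
      exact I1
    · exact Continuous.integrable_of_hasCompactSupport (by fun_prop) cs2.mul_right
  have hz : ∀ x, x ∉ D.carrier → φ x = 0 := fun x hx =>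
    image_eq_zero_of_notMem_tsupport fun h => hx (hφ.support h)
  have hfd : ∀ x, |fderiv ℝ φ x e| ≤ ‖gradient φ x‖ := fun x => by
    have hn : ‖gradient φ x‖ = ‖fderiv ℝ φ x‖ := by simp [gradient]
    have he : ‖e‖ = 1 := by simp [e]
    have := (fderiv ℝ φ x).le_opNorm e
    rw [he, mul_one, Real.norm_eq_abs] at this
    rw [hn]; exact this
  have hpt : ∀ x, -(2 * φ x * fderiv ℝ φ x e * X x) ≤
      1 / 2 * φ x ^ 2 + 2 * r ^ 2 * ‖gradient φ x‖ ^ 2 := fun x => by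
    by_cases hx : x ∈ D.carrier
    · have hxr : |X x| ≤ r := by
        have := hr hx
        rw [mem_closedBall_zero_iff] at this
        exact (PiLp.norm_apply_le x i).trans this
      have hp : |fderiv ℝ φ x e * X x| ≤ ‖gradient φ x‖ * r := by
        rw [abs_mul]
        exact mul_le_mul (hfd x) hxr (abs_nonneg _) (norm_nonneg _)
      have hs : (fderiv ℝ φ x e * X x) ^ 2 ≤ (‖gradient φ x‖ * r) ^ 2 := by
        rw [← sq_abs]
        exact pow_le_pow_left₀ (abs_nonneg _) hp 2
      nlinarith [sq_nonneg (φ x + 2 * (fderiv ℝ φ x e * X x))]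
    · rw [hz x hx]
      simp only [mul_zero, zero_mul, neg_zero]
      positivity
  have hmain : ∫ x, φ x ^ 2 ≤ (2 * r) ^ 2 * ∫ x, ‖gradient φ x‖ ^ 2 := by
    have hle : ∫ x, φ x ^ 2 ≤ ∫ x, (1 / 2 * φ x ^ 2 + 2 * r ^ 2 * ‖gradient φ x‖ ^ 2) := by
      rw [key, ← integral_neg]
      refine integral_mono ?_ ((I1.const_mul _).add (I2.const_mul _)) hpt
      refine Integrable.neg (Continuous.integrable_of_hasCompactSupport (by fun_prop) ?_)
      exact ((hφ.compact.mul_left (f := fun _ => (2 : ℝ))).mul_right).mul_right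
    rw [integral_add (I1.const_mul _) (I2.const_mul _), integral_const_mul,
      integral_const_mul] at hle
    linarith
  have n1 : ‖w.1‖ ^ 2 = ∫ x, φ x ^ 2 := by
    rw [Lp_two_norm_sq, integral_congr_ae (h1.mono fun x hx => by rw [hx]), BoundedDomain.vol,
      setIntegral_eq_integral_of_forall_compl_eq_zero (fun x hx => by rw [hz x hx]; simp)]
    simp
  have n2 : ‖w.2‖ ^ 2 = ∫ x, ‖gradient φ x‖ ^ 2 := by
    rw [Lp_two_norm_sq, integral_congr_ae (h2.mono fun x hx => by rw [hx]), BoundedDomain.vol,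
      setIntegral_eq_integral_of_forall_compl_eq_zero (fun x hx => ?_)]
    have hx' : x ∉ tsupport φ := fun h => hx (hφ.support h)
    have : fderiv ℝ φ x = 0 := image_eq_zero_of_notMem_tsupport
      fun h => hx' (tsupport_fderiv_subset ℝ h)
    simp [gradient, this]
  rw [← n1, ← n2, ← mul_pow] at hmain
  exact le_of_sq_le_sq hmain (by positivity)

/-- Friedrichs' inequality on the closure, that is, on `H¹₀(D)`. -/
theorem h10_friedrichs (D : BoundedDomain d) :
    ∃ K : ℝ, ∀ w ∈ (testGraph D).topologicalClosure, ‖w.1‖ ≤ K * ‖w.2‖ := by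
  obtain ⟨K, hK⟩ := testGraph_friedrichs D
  refine ⟨K, fun w hw => ?_⟩
  have hc : IsClosed {w : Lp ℝ 2 D.vol × Lp (Space d) 2 D.vol | ‖w.1‖ ≤ K * ‖w.2‖} :=
    isClosed_le (by fun_prop) (by fun_prop)
  exact closure_minimal (fun v hv => hK v hv) hc hw

/-- `H¹₀(D)`: the closure in `H¹(D)` of the test functions. An element is a pair consisting of a
function and its weak gradient. -/
def H10 (D : BoundedDomain d) : Type := ↥(testGraph D).topologicalClosure

namespace H10

variable {D : BoundedDomain d}

instance : AddCommGroup (H10 D) :=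
  inferInstanceAs (AddCommGroup ↥(testGraph D).topologicalClosure)

instance : Module ℝ (H10 D) :=
  inferInstanceAs (Module ℝ ↥(testGraph D).topologicalClosure)

/-- The function itself, as an element of `L²(D)`. -/
def val : H10 D →ₗ[ℝ] Lp ℝ 2 D.vol :=
  (LinearMap.fst ℝ _ _).comp (testGraph D).topologicalClosure.subtype

/-- The weak gradient, as an element of `L²(D; ℝ^d)`. -/
def grad : H10 D →ₗ[ℝ] Lp (Space d) 2 D.vol :=
  (LinearMap.snd ℝ _ _).comp (testGraph D).topologicalClosure.subtype

theorem grad_injective : Function.Injective (grad : H10 D →ₗ[ℝ] Lp (Space d) 2 D.vol) := by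
  rw [injective_iff_map_eq_zero]
  intro u hu
  obtain ⟨K, hK⟩ := h10_friedrichs D
  have h2 : u.1.2 = 0 := hu
  have h1 : u.1.1 = 0 := by
    have := hK u.1 u.2
    rw [h2, norm_zero, mul_zero] at this
    exact norm_le_zero_iff.1 this
  exact Subtype.ext (Prod.ext h1 h2)

/-- The norm `‖u‖ = ‖∇u‖_{L²(D)}`. -/
instance : NormedAddCommGroup (H10 D) :=
  NormedAddCommGroup.induced (H10 D) (Lp (Space d) 2 D.vol) grad grad_injective

instance : InnerProductSpace ℝ (H10 D) where
  toNormedSpace := NormedSpace.induced ℝ (H10 D) (Lp (Space d) 2 D.vol) grad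
  inner u v := inner ℝ (grad u) (grad v)
  norm_sq_eq_re_inner u := norm_sq_eq_re_inner (𝕜 := ℝ) (grad u)
  conj_inner_symm u v := inner_conj_symm (𝕜 := ℝ) (grad u) (grad v)
  add_left u v w := by simp [inner_add_left]
  smul_left u v c := by simp [inner_smul_left]

end H10

/-! ### The spaces of velocities, pressures and coefficients -/

/-- `H = H¹₀(D)^d` with the norm `‖u‖ = (∑ᵢⱼ ‖∂uᵢ/∂xⱼ‖²_{L²(D)})^{1/2}`. -/
abbrev Vel (D : BoundedDomain d) : Type := PiLp 2 (fun _ : Fin d => H10 D)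

/-- The dual `H* = H^{-1}(D)^d` with the dual norm. -/
abbrev VelDual (D : BoundedDomain d) : Type := Vel D →L[ℝ] ℝ

/-- The functions of mean zero in `L²(D)`. -/
def meanZero (D : BoundedDomain d) : Submodule ℝ (Lp ℝ 2 D.vol) where
  carrier := {q | ∫ x, q x ∂D.vol = 0}
  zero_mem' := by
    change ∫ x, (0 : Lp ℝ 2 D.vol) x ∂D.vol = 0
    rw [integral_congr_ae (Lp.coeFn_zero _ _ _)]
    simp
  add_mem' := by
    intro p q hp hq
    change ∫ x, (p + q : Lp ℝ 2 D.vol) x ∂D.vol = 0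
    have ip := (Lp.memLp p).integrable one_le_two
    have iq := (Lp.memLp q).integrable one_le_two
    rw [integral_congr_ae (Lp.coeFn_add _ _)]
    simp only [Pi.add_apply]
    rw [integral_add ip iq, hp, hq, add_zero]
  smul_mem' := by
    intro c q hq
    change ∫ x, (c • q : Lp ℝ 2 D.vol) x ∂D.vol = 0
    rw [integral_congr_ae (Lp.coeFn_smul _ _)]
    simp only [Pi.smul_apply]
    rw [integral_smul, hq, smul_zero]

/-- The pressure space `L = {q ∈ L²(D) : ∫ q = 0}` with the `L²` norm (on functions of mean zero
this is the quotient norm `min_c ‖q - c‖_{L²(D)}`). -/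
abbrev Pres (D : BoundedDomain d) : Type := ↥(meanZero D)

/-- Matrix coefficients `L^∞(D)^{d×d}` with the norm `ess sup |N(x)|_F`. -/
abbrev Coeff (D : BoundedDomain d) : Type := Lp (Mat d) ∞ D.vol

/-- The value `u(x) ∈ ℝ^d`. -/
def Vel.value {D : BoundedDomain d} (u : Vel D) (x : Space d) : Fin d → ℝ :=
  fun i => H10.val (u i) x

/-- The weak Jacobian `∇u(x) = (∂uᵢ/∂xⱼ)ᵢⱼ`. -/
def Vel.jac {D : BoundedDomain d} (u : Vel D) (x : Space d) : Mat d :=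
  Matrix.of fun i j => H10.grad (u i) x j

/-- `C₄` is a constant of the Sobolev embedding `H¹₀(D) ↪ L⁴(D)`. -/
def IsSobolevConst (D : BoundedDomain d) (C₄ : ℝ) : Prop :=
  0 < C₄ ∧ ∀ w : H10 D, eLpNorm (H10.val w) 4 D.vol ≤ ENNReal.ofReal (C₄ * ‖w‖)

/-! ### The multilinear forms and the variational problem -/

section forms

variable {D : BoundedDomain d}

/-- `a(u, v; A) = ∫_D tr(∇uᵀ Aᵀ ∇v)`. -/
def formA (u v : Vel D) (A : Coeff D) : ℝ :=
  ∫ x, ((u.jac x)ᵀ * (A x)ᵀ * v.jac x).trace ∂D.vol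

/-- `b(v, p; B) = -∫_D tr(∇v B p)`. -/
def formB (v : Vel D) (p : Pres D) (B : Coeff D) : ℝ :=
  -∫ x, ((p : Lp ℝ 2 D.vol) x • (v.jac x * B x)).trace ∂D.vol

/-- `m(u, v, w; M) = ∫_D (∇v M u)ᵀ w`. -/
def formM (u v w : Vel D) (M : Coeff D) : ℝ :=
  ∫ x, ((v.jac x * M x) *ᵥ u.value x) ⬝ᵥ w.value x ∂D.vol

/-- The duality pairing `⟨⟨g, q⟩⟩ = ∫_D g q` on the pressure space. -/
def pairing (g q : Pres D) : ℝ :=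
  ∫ x, (g : Lp ℝ 2 D.vol) x * (q : Lp ℝ 2 D.vol) x ∂D.vol

/-- `(u, p)` solves the stationary Navier-Stokes problem in variational form. -/
def IsSolution (A B M : Coeff D) (f : VelDual D) (g : Pres D) (u : Vel D) (p : Pres D) : Prop :=
  (∀ v : Vel D, formA u v A + formM u u v M - formB v p B = f v) ∧
  (∀ q : Pres D, formB u q B = pairing g q)

/-- `V = {v ∈ H : b(v, q; B) = 0 for all q ∈ L}`. -/
def kerSpace (B : Coeff D) : Set (Vel D) :=
  {v | ∀ q : Pres D, formB v q B = 0}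

/-- `V^⊥ = {w ∈ H : a(w, v; A) = 0 for all v ∈ V}`. -/
def perpSpace (A B : Coeff D) : Set (Vel D) :=
  {w | ∀ v ∈ kerSpace B, formA w v A = 0}

end forms

/-! ### Multi-indices and partial derivatives in the parameter -/

section parameters

variable {s : ℕ}

/-- `∂F/∂yᵢ` on the parameter set `U`. -/
def partialDeriv {X : Type*} [NormedAddCommGroup X] [NormedSpace ℝ X]
    (U : Set (Fin s → ℝ)) (i : Fin s) (F : (Fin s → ℝ) → X) : (Fin s → ℝ) → X :=
  fun y => fderivWithin ℝ F U y (Pi.single i 1)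

/-- `∂^ν F = ∂^{|ν|} F / (∂y₁^{ν₁} ⋯ ∂y_s^{ν_s})` on the parameter set `U`. -/
def multiDeriv {X : Type*} [NormedAddCommGroup X] [NormedSpace ℝ X]
    (U : Set (Fin s → ℝ)) (ν : Fin s → ℕ) (F : (Fin s → ℝ) → X) : (Fin s → ℝ) → X :=
  (List.finRange s).foldr (fun i G => (partialDeriv U i)^[ν i] G) F

/-- `|ν| = ∑ⱼ νⱼ`. -/
def order (ν : Fin s → ℕ) : ℕ := ∑ j, ν j

/-- `R^ν = ∏ⱼ Rⱼ^{νⱼ}`. -/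
def multiPow (R : Fin s → ℝ) (ν : Fin s → ℕ) : ℝ := ∏ j, R j ^ ν j

end parameters

/-- The absolute value `[1/2]_n` of the falling factorial `(1/2)(1/2 - 1)⋯(1/2 - n + 1)`. -/
def fallingHalf (n : ℕ) : ℝ := |∏ k ∈ Finset.range n, ((1 : ℝ) / 2 - k)|

/-! ### Constants -/

/-- The numbers `ā, b̄, m̄, f̄, ḡ, α, β, γ`. -/
structure Consts where
  a : ℝ
  b : ℝ
  m : ℝ
  f : ℝ
  g : ℝ
  α : ℝ
  β : ℝ
  γ : ℝ

namespace Consts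

variable (c : Consts)

/-- `γ ∈ (0, α/m̄)` is the root of `f̄/(2α) + ḡ/(2β) + (m̄/(2α)) γ² = γ`. -/
def IsRadius : Prop :=
  0 < c.γ ∧ c.γ < c.α / c.m ∧
    c.f / (2 * c.α) + c.g / (2 * c.β) + c.m / (2 * c.α) * c.γ ^ 2 = c.γ

/-- `α̃ = α - m̄ γ`. -/
def αt : ℝ := c.α - c.m * c.γ

/-- `p̄ = (1/β) (f̄/2 + ā γ/2 + m̄ γ²/2)`. -/
def pbar : ℝ := 1 / c.β * (c.f / 2 + c.a * c.γ / 2 + c.m * c.γ ^ 2 / 2)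

def σu : ℝ :=
  1 / (c.γ * c.αt) *
      (c.f + c.b * c.pbar +
        c.γ * (c.m * ((c.g + c.b * c.γ) / c.β) + c.a + c.m * c.γ)) +
    (c.g + c.b * c.γ) / (c.γ * c.β)

def Cu : ℝ := c.γ * c.σu

def σp : ℝ :=
  1 / (c.β * c.pbar) *
    (c.f + c.b * c.pbar + c.a * c.γ * (1 + c.σu / 2) + c.m * c.γ ^ 2 * (1 + c.σu))

def Cp : ℝ := c.pbar * c.σp

def ρu : ℝ :=
  (1 + c.γ * c.m / c.αt) * (c.g + c.b * c.γ + 2 * c.Cu * c.b) / (c.β * c.Cu) +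
    (c.f + c.b * c.pbar + c.γ * (c.a + c.m * c.γ) + 2 * c.Cp * c.b) / (c.αt * c.Cu) +
    (2 * c.a + 4 * c.m * c.γ + 7 * c.m * c.Cu) / c.αt

def ρp : ℝ :=
  (c.f + c.b * c.pbar + c.γ * (c.a + c.m * c.γ) + 2 * c.Cu * c.a + 4 * c.m * c.γ * c.Cu +
      7 * c.m * c.Cu ^ 2) / (c.β * c.Cp) +
    c.Cu * c.ρu / (c.β * c.Cp) * (c.a / 2 + c.γ * c.m)

/-- `ρ = max {1, ρ_u, ρ_p}`. -/
def ρ : ℝ := max 1 (max c.ρu c.ρp)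

end Consts

/-! ### Assumptions on the data -/

section assumptions

variable {D : BoundedDomain d} {s : ℕ}

/-- Nonsingular bounded coefficients, `A` symmetric. -/
structure CoeffAssumption (U : Set (Fin s → ℝ)) (C₄ : ℝ) (c : Consts)
    (A B M : (Fin s → ℝ) → Coeff D) : Prop where
  a_pos : 0 < c.a
  b_pos : 0 < c.b
  m_pos : 0 < c.m
  A_det : ∀ y ∈ U, ∀ᵐ x ∂D.vol, (A y x).det ≠ 0
  B_det : ∀ y ∈ U, ∀ᵐ x ∂D.vol, (B y x).det ≠ 0
  M_det : ∀ y ∈ U, ∀ᵐ x ∂D.vol, (M y x).det ≠ 0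
  A_symm : ∀ y ∈ U, ∀ᵐ x ∂D.vol, (A y x).IsSymm
  A_le : ∀ y ∈ U, ‖A y‖ ≤ c.a / 2
  B_le : ∀ y ∈ U, ‖B y‖ ≤ c.b / 2
  M_le : ∀ y ∈ U, ‖M y‖ ≤ (C₄ ^ 2)⁻¹ * (c.m / 2)

/-- Uniform coercivity and the uniform inf-sup condition. -/
structure StabilityAssumption (U : Set (Fin s → ℝ)) (c : Consts)
    (A B : (Fin s → ℝ) → Coeff D) : Prop where
  α_pos : 0 < c.α
  β_pos : 0 < c.β
  coercive : ∀ y ∈ U, ∀ u : Vel D, c.α * ‖u‖ ^ 2 ≤ formA u u (A y)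
  inf_sup : ∀ y ∈ U, ∀ p : Pres D, p ≠ 0 →
    c.β ≤ ⨆ u : {u : Vel D // u ≠ 0}, formB u.1 p (B y) / (‖u.1‖ * ‖p‖)

/-- Smallness of the data. -/
structure SmallDataAssumption (U : Set (Fin s → ℝ)) (c : Consts)
    (f : (Fin s → ℝ) → VelDual D) (g : (Fin s → ℝ) → Pres D) : Prop where
  f_le : ∀ y ∈ U, ‖f y‖ ≤ c.f / 2
  g_le : ∀ y ∈ U, ‖g y‖ ≤ c.g / 2
  small : c.f / c.α + c.g / c.β < c.α / c.m

/-- The common Gevrey factor `(1/2) (|ν|!)^δ / (2R)^ν`. -/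
def gevreyFactor (δ : ℝ) (R : Fin s → ℝ) (ν : Fin s → ℕ) : ℝ :=
  1 / 2 * (((order ν).factorial : ℝ) ^ δ / multiPow (fun j => 2 * R j) ν)

/-- The data are smooth in the parameter, with derivatives of Gevrey class `δ`. -/
structure GevreyAssumption (U : Set (Fin s → ℝ)) (C₄ : ℝ) (c : Consts) (δ : ℝ) (R : Fin s → ℝ)
    (A B M : (Fin s → ℝ) → Coeff D) (f : (Fin s → ℝ) → VelDual D)
    (g : (Fin s → ℝ) → Pres D) : Prop where
  R_pos : ∀ j, 0 < R j
  A_smooth : ContDiffOn ℝ ∞ A U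
  B_smooth : ContDiffOn ℝ ∞ B U
  M_smooth : ContDiffOn ℝ ∞ M U
  f_smooth : ContDiffOn ℝ ∞ f U
  g_smooth : ContDiffOn ℝ ∞ g U
  A_le : ∀ ν, ∀ y ∈ U, ‖multiDeriv U ν A y‖ ≤ c.a * gevreyFactor δ R ν
  B_le : ∀ ν, ∀ y ∈ U, ‖multiDeriv U ν B y‖ ≤ c.b * gevreyFactor δ R ν
  M_le : ∀ ν, ∀ y ∈ U, ‖multiDeriv U ν M y‖ ≤ (C₄ ^ 2)⁻¹ * c.m * gevreyFactor δ R ν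
  f_le : ∀ ν, ∀ y ∈ U, ‖multiDeriv U ν f y‖ ≤ c.f * gevreyFactor δ R ν
  g_le : ∀ ν, ∀ y ∈ U, ‖multiDeriv U ν g y‖ ≤ c.g * gevreyFactor δ R ν

end assumptions

end ParamNS

end

/-!
Written with bounded multilinear maps, the problem reads `a(u, ·) + m(u, u, ·) - b(·, p) = f`,
`b(u, ·) = G` in the Hilbert spaces `H`, `L` (`SaddleForms`, `nsForms`). Hölder's inequality bounds
the forms by the coefficients; the embedding `H¹₀ ↪ L⁴` enters through `u ⊗ w ∈ L²`.

*Uniqueness and existence.* For `‖u₁‖, ‖u₂‖ ≤ γ < α / m̄` the linearization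
`a(h, ·) + m(u₁, h, ·) + m(h, u₂, ·)` is still coercive (`coercive_linearization`), so two small
solutions have the same velocity, and the inf-sup condition gives the same pressure
(`IsSol.unique`). If `G` has a lifting `w` that is `a`-orthogonal to the kernel of `b`, then
`u = w + z`, where `z` solves the problem in the kernel with `m(u, u, ·)` on the right-hand
side; this is a contraction of the ball of radius `γ` (`exists_isSol`). The pressure is recovered by Riesz
representation (`exists_pressure`).

*Smoothness.* The linearized problem is an isomorphism (`bijective_linearization`), so the implicit
function theorem gives a smooth local solution branch in terms of the data, and uniqueness of small
solutions identifies it with the given family (`contDiffOn_of_isSol`).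

*Gevrey bounds.* Derivatives are taken along lists of directions scaled by `R`, so that the bound no
longer contains `R^ν`. The Leibniz rule for a bilinear map then becomes a binomial convolution of
majorizing sequences (`norm_iterDir_bilin_le`); the weight `(n!)^(δ-1)` factors out of the
convolution because `j! (n-j)! ≤ n!`. Differentiating the equation gives a linear saddle point
problem for the highest derivative, whose right-hand side contains only lower ones. The sequence
`[1/2]_n ρ^(n-1)` reproduces itself: its convolutions with itself and with `n! / 2^n`, `n ≥ 1`, are
at most `2 ρ^(n-2) [1/2]_n`, which gains a factor `1 / ρ`. The resulting system of inequalities closes by the choice of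
`σ_u`, `σ_p` at order one (`velocity_first`, `pressure_first`) and by `ρ ≥ ρ_u` at higher orders
(`velocity_higher`, `pressure_higher`). These inequalities use
`2 α ≤ ā`, which holds because `H¹₀(D) ≠ 0`.
-/

noncomputable section

set_option maxSynthPendingDepth 3

namespace ParamNS

/-! ### Iterated directional derivatives on a set -/

section calculus

variable {E ι X Y Z : Type*} [NormedAddCommGroup E] [NormedSpace ℝ E]
  [NormedAddCommGroup X] [NormedSpace ℝ X] [NormedAddCommGroup Y] [NormedSpace ℝ Y]
  [NormedAddCommGroup Z] [NormedSpace ℝ Z]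

/-- The derivative of `F` relative to `U` in the direction `v`. -/
def dirDeriv (U : Set E) (v : E) (F : E → X) : E → X := fun y => fderivWithin ℝ F U y v

/-- The iterated directional derivative along the directions `e i`, `i ∈ l`; the last entry of
`l` is differentiated first. -/
def iterDir (U : Set E) (e : ι → E) (l : List ι) (F : E → X) : E → X :=
  l.foldr (fun i G => dirDeriv U (e i) G) F

variable {U : Set E} {e : ι → E} {F F' : E → X} {G : E → Y}

@[simp] theorem iterDir_nil : iterDir U e [] F = F := rfl

theorem iterDir_cons (i : ι) (l : List ι) :
    iterDir U e (i :: l) F = dirDeriv U (e i) (iterDir U e l F) := rfl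

theorem iterDir_append (l l' : List ι) :
    iterDir U e (l ++ l') F = iterDir U e l (iterDir U e l' F) :=
  List.foldr_append

theorem iterDir_concat (l : List ι) (i : ι) :
    iterDir U e (l ++ [i]) F = iterDir U e l (dirDeriv U (e i) F) :=
  iterDir_append l [i]

theorem dirDeriv_congr (h : EqOn F F' U) (v : E) : EqOn (dirDeriv U v F) (dirDeriv U v F') U :=
  fun y hy => by rw [dirDeriv, dirDeriv, fderivWithin_congr h (h hy)]

theorem iterDir_congr (h : EqOn F F' U) (l : List ι) :
    EqOn (iterDir U e l F) (iterDir U e l F') U := by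
  induction l with
  | nil => exact h
  | cons i l ih => exact dirDeriv_congr ih _

theorem contDiffOn_dirDeriv (hU : UniqueDiffOn ℝ U) (hF : ContDiffOn ℝ ∞ F U) (v : E) :
    ContDiffOn ℝ ∞ (dirDeriv U v F) U :=
  (hF.fderivWithin hU (by simp)).clm_apply contDiffOn_const

theorem contDiffOn_iterDir (hU : UniqueDiffOn ℝ U) (hF : ContDiffOn ℝ ∞ F U) (l : List ι) :
    ContDiffOn ℝ ∞ (iterDir U e l F) U := by
  induction l with
  | nil => exact hF
  | cons i l ih => exact contDiffOn_dirDeriv hU ih _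

theorem _root_.ContDiffOn.diffWithinAt (hF : ContDiffOn ℝ ∞ F U) {y : E} (hy : y ∈ U) :
    DifferentiableWithinAt ℝ F U y :=
  hF.differentiableOn (by simp) y hy

theorem dirDeriv_clm (hU : UniqueDiffOn ℝ U) (hF : ContDiffOn ℝ ∞ F U) (T : X →L[ℝ] Y) (v : E) :
    EqOn (dirDeriv U v fun y => T (F y)) (fun y => T (dirDeriv U v F y)) U := fun y hy => by
  have h := (T.hasFDerivAt.comp_hasFDerivWithinAt y
    (hF.diffWithinAt hy).hasFDerivWithinAt).fderivWithin (hU y hy)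
  simp only [dirDeriv]
  exact congrArg (· v) h

theorem iterDir_clm (hU : UniqueDiffOn ℝ U) (hF : ContDiffOn ℝ ∞ F U) (T : X →L[ℝ] Y)
    (l : List ι) :
    EqOn (iterDir U e l fun y => T (F y)) (fun y => T (iterDir U e l F y)) U := by
  induction l with
  | nil => exact fun y _ => rfl
  | cons i l ih =>
    exact (dirDeriv_congr ih _).trans (dirDeriv_clm hU (contDiffOn_iterDir hU hF l) T _)

theorem iterDir_add (hU : UniqueDiffOn ℝ U) (hF : ContDiffOn ℝ ∞ F U)
    (hF' : ContDiffOn ℝ ∞ F' U) (l : List ι) :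
    EqOn (iterDir U e l fun y => F y + F' y)
      (fun y => iterDir U e l F y + iterDir U e l F' y) U := by
  induction l with
  | nil => exact fun y _ => rfl
  | cons i l ih =>
    refine (dirDeriv_congr ih _).trans fun y hy => ?_
    simp only [dirDeriv, iterDir_cons]
    rw [fderivWithin_fun_add (hU y hy) ((contDiffOn_iterDir hU hF l).diffWithinAt hy)
      ((contDiffOn_iterDir hU hF' l).diffWithinAt hy)]
    rfl

theorem iterDir_neg (hU : UniqueDiffOn ℝ U) (hF : ContDiffOn ℝ ∞ F U) (l : List ι) :
    EqOn (iterDir U e l fun y => -F y) (fun y => -iterDir U e l F y) U :=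
  iterDir_clm hU hF (-ContinuousLinearMap.id ℝ X) l

theorem iterDir_sub (hU : UniqueDiffOn ℝ U) (hF : ContDiffOn ℝ ∞ F U)
    (hF' : ContDiffOn ℝ ∞ F' U) (l : List ι) :
    EqOn (iterDir U e l fun y => F y - F' y)
      (fun y => iterDir U e l F y - iterDir U e l F' y) U := by
  intro y hy
  simp only [sub_eq_add_neg]
  have h1 := iterDir_add (e := e) hU hF hF'.neg l hy
  have h2 := iterDir_neg (e := e) hU hF' l hy
  simp only at h1 h2
  rw [h1, h2]

theorem iterDir_const (x : X) {l : List ι} (hl : l ≠ []) (y : E) :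
    iterDir U e l (fun _ => x) y = 0 := by
  have h0 : ∀ l : List ι, iterDir U e l (fun _ : E => (0 : X)) = fun _ => 0 := by
    intro l
    induction l with
    | nil => rfl
    | cons i l ih => rw [iterDir_cons, ih]; funext z; simp [dirDeriv]
  rw [← List.dropLast_append_getLast hl, iterDir_concat]
  have : dirDeriv U (e (l.getLast hl)) (fun _ : E => x) = fun _ => 0 := by
    funext z; simp [dirDeriv]
  rw [this, h0]

theorem dirDeriv_bilin (hU : UniqueDiffOn ℝ U) (hF : ContDiffOn ℝ ∞ F U)
    (hG : ContDiffOn ℝ ∞ G U) (B : X →L[ℝ] Y →L[ℝ] Z) (v : E) :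
    EqOn (dirDeriv U v fun y => B (F y) (G y))
      (fun y => B (F y) (dirDeriv U v G y) + B (dirDeriv U v F y) (G y)) U := fun y hy => by
  simp only [dirDeriv]
  rw [B.fderivWithin_of_bilinear (hF.diffWithinAt hy) (hG.diffWithinAt hy) (hU y hy)]
  rfl

theorem contDiffOn_bilin (hF : ContDiffOn ℝ ∞ F U) (hG : ContDiffOn ℝ ∞ G U)
    (B : X →L[ℝ] Y →L[ℝ] Z) : ContDiffOn ℝ ∞ (fun y => B (F y) (G y)) U :=
  (B.contDiff.comp_contDiffOn hF).clm_apply hG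

/-- Binomial convolution of sequences, `(φ ⋆ ψ)_n = ∑ C(n, k) φ_k ψ_{n-k}`. -/
def binConv (φ ψ : ℕ → ℝ) (n : ℕ) : ℝ :=
  ∑ ij ∈ Finset.HasAntidiagonal.antidiagonal n, (n.choose ij.1 : ℝ) * (φ ij.1 * ψ ij.2)

theorem binConv_succ (φ ψ : ℕ → ℝ) (n : ℕ) :
    binConv φ ψ (n + 1) =
      binConv φ (fun k => ψ (k + 1)) n + binConv (fun k => φ (k + 1)) ψ n := by
  rw [binConv, Finset.sum_antidiagonal_choose_succ_mul (fun i j => φ i * ψ j)]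
  congr 1
  refine Finset.sum_congr rfl fun ij hij => ?_
  rw [← Finset.HasAntidiagonal.mem_antidiagonal.1 hij, Nat.choose_symm_add]

/-- Leibniz' rule as an estimate: the derivatives of a bilinear expression are majorized by the
binomial convolution of majorants of the factors. -/
theorem norm_iterDir_bilin_le (hU : UniqueDiffOn ℝ U) {y : E} (hy : y ∈ U)
    (B : X →L[ℝ] Y →L[ℝ] Z) {K : ℝ} (hK : 0 ≤ K) (hB : ∀ x x', ‖B x x'‖ ≤ K * (‖x‖ * ‖x'‖))
    (l : List ι) :
    ∀ {F : E → X} {G : E → Y} {φ ψ : ℕ → ℝ}, ContDiffOn ℝ ∞ F U → ContDiffOn ℝ ∞ G U →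
      (∀ l' : List ι, l'.Sublist l → ‖iterDir U e l' F y‖ ≤ φ l'.length) →
      (∀ l' : List ι, l'.Sublist l → ‖iterDir U e l' G y‖ ≤ ψ l'.length) →
      ‖iterDir U e l (fun z => B (F z) (G z)) y‖ ≤ K * binConv φ ψ l.length := by
  induction l using List.reverseRecOn with
  | nil =>
    intro F G φ ψ _ _ hφ hψ
    have h1 := hφ [] (List.Sublist.refl _)
    have h2 := hψ [] (List.Sublist.refl _)
    simp only [iterDir_nil, List.length_nil] at h1 h2 ⊢
    simp only [binConv, Finset.Nat.antidiagonal_zero, Finset.sum_singleton, Nat.choose_self,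
      Nat.cast_one, one_mul]
    exact (hB _ _).trans (mul_le_mul_of_nonneg_left
      (mul_le_mul h1 h2 (norm_nonneg _) ((norm_nonneg _).trans h1)) hK)
  | append_singleton l i ih =>
    intro F G φ ψ hF hG hφ hψ
    have hF' := contDiffOn_dirDeriv hU hF (e i)
    have hG' := contDiffOn_dirDeriv hU hG (e i)
    have hs : ∀ l' : List ι, l'.Sublist l → l'.Sublist (l ++ [i]) := fun l' h =>
      h.trans (List.sublist_append_left l [i])
    have hs' : ∀ l' : List ι, l'.Sublist l → (l' ++ [i]).Sublist (l ++ [i]) := fun l' h =>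
      h.append (List.Sublist.refl _)
    rw [iterDir_concat, iterDir_congr (dirDeriv_bilin hU hF hG B (e i)) l hy,
      iterDir_add hU (contDiffOn_bilin hF hG' B) (contDiffOn_bilin hF' hG B) l hy,
      List.length_append, List.length_singleton, binConv_succ, mul_add]
    refine (norm_add_le _ _).trans (add_le_add ?_ ?_)
    · refine ih hF hG' (fun l' h => hφ l' (hs l' h)) fun l' h => ?_
      have := hψ _ (hs' l' h)
      rwa [iterDir_concat, List.length_append] at this
    · refine ih hF' hG (fun l' h => ?_) (fun l' h => hψ l' (hs l' h))
      have := hφ _ (hs' l' h)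
      rwa [iterDir_concat, List.length_append] at this

/-- The sequence `φ` majorizes the derivatives of `F` at `y` along the sublists of `l` of length
less than `N`, up to the Gevrey weight `(k!)^t`. -/
def Majorizes (U : Set E) (e : ι → E) (y : E) (l : List ι) (N : ℕ) (t : ℝ) (F : E → X)
    (φ : ℕ → ℝ) : Prop :=
  ∀ l' : List ι, l'.Sublist l → l'.length < N →
    ‖iterDir U e l' F y‖ ≤ (l'.length.factorial : ℝ) ^ t * φ l'.length

theorem Majorizes.mono {y : E} {l l' : List ι} {N N' : ℕ} {t : ℝ} {φ : ℕ → ℝ}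
    (h : Majorizes U e y l N t F φ) (hl : l'.Sublist l) (hN : N' ≤ N) :
    Majorizes U e y l' N' t F φ :=
  fun k hk hkN => h k (hk.trans hl) (hkN.trans_le hN)

/-- The Gevrey weights are compatible with binomial convolution. -/
theorem binConv_weight_le {t : ℝ} (ht : 0 ≤ t) {φ ψ : ℕ → ℝ} (hφ : ∀ k, 0 ≤ φ k)
    (hψ : ∀ k, 0 ≤ ψ k) (n : ℕ) :
    binConv (fun k => (k.factorial : ℝ) ^ t * φ k) (fun k => (k.factorial : ℝ) ^ t * ψ k) n ≤
      (n.factorial : ℝ) ^ t * binConv φ ψ n := by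
  rw [binConv, binConv, Finset.mul_sum]
  refine Finset.sum_le_sum fun ij hij => ?_
  have hn := Finset.HasAntidiagonal.mem_antidiagonal.1 hij
  have h1 : (ij.1.factorial : ℝ) ^ t * (ij.2.factorial : ℝ) ^ t ≤ (n.factorial : ℝ) ^ t := by
    rw [← Real.mul_rpow (by positivity) (by positivity)]
    refine Real.rpow_le_rpow (by positivity) ?_ ht
    rw [← hn]
    exact_mod_cast Nat.le_of_dvd (Nat.factorial_pos _)
      (Nat.factorial_mul_factorial_dvd_factorial_add _ _)
  have h2 : 0 ≤ (n.choose ij.1 : ℝ) * (φ ij.1 * ψ ij.2) :=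
    mul_nonneg (Nat.cast_nonneg _) (mul_nonneg (hφ _) (hψ _))
  calc _ = (ij.1.factorial : ℝ) ^ t * (ij.2.factorial : ℝ) ^ t *
        ((n.choose ij.1 : ℝ) * (φ ij.1 * ψ ij.2)) := by ring
    _ ≤ _ := mul_le_mul_of_nonneg_right h1 h2

theorem Majorizes.bilin (hU : UniqueDiffOn ℝ U) {y : E} (hy : y ∈ U)
    (B : X →L[ℝ] Y →L[ℝ] Z) {K : ℝ} (hK : 0 ≤ K) (hB : ∀ x x', ‖B x x'‖ ≤ K * (‖x‖ * ‖x'‖))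
    {l : List ι} {N : ℕ} {t : ℝ} (ht : 0 ≤ t) {φ ψ : ℕ → ℝ} (hφ0 : ∀ k, 0 ≤ φ k)
    (hψ0 : ∀ k, 0 ≤ ψ k) (hF : ContDiffOn ℝ ∞ F U) (hG : ContDiffOn ℝ ∞ G U)
    (hφ : Majorizes U e y l N t F φ) (hψ : Majorizes U e y l N t G ψ) :
    Majorizes U e y l N t (fun z => B (F z) (G z)) (fun n => K * binConv φ ψ n) := by
  intro l' hl' hN
  have := norm_iterDir_bilin_le hU hy B hK hB l' (e := e) hF hG
    (φ := fun k => (k.factorial : ℝ) ^ t * φ k) (ψ := fun k => (k.factorial : ℝ) ^ t * ψ k)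
    (fun k hk => hφ k (hk.trans hl') (hk.length_le.trans_lt hN))
    (fun k hk => hψ k (hk.trans hl') (hk.length_le.trans_lt hN))
  refine this.trans ?_
  rw [mul_left_comm]
  exact mul_le_mul_of_nonneg_left (binConv_weight_le ht hφ0 hψ0 _) hK

/-- A majorant can be raised at the order `l.length` so as to cover `l` itself. -/
theorem Majorizes.exists_extend {y : E} {l : List ι} {t : ℝ} (ht : 0 ≤ t) {φ : ℕ → ℝ}
    (h0 : ∀ k, 0 ≤ φ k) (h : Majorizes U e y l l.length t F φ) :
    ∃ φ' : ℕ → ℝ, (∀ k, 0 ≤ φ' k) ∧ (∀ k, k ≠ l.length → φ' k = φ k) ∧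
      Majorizes U e y l (l.length + 1) t F φ' := by
  refine ⟨Function.update φ l.length ‖iterDir U e l F y‖, fun k => ?_,
    fun k hk => Function.update_of_ne hk _ _, fun l' hl' hN => ?_⟩
  · by_cases hk : k = l.length
    · simp [hk]
    · rw [Function.update_of_ne hk]; exact h0 k
  · by_cases hk : l'.length = l.length
    · have := hl'.eq_of_length hk
      subst this
      rw [Function.update_self]
      refine le_mul_of_one_le_left (norm_nonneg _) (Real.one_le_rpow ?_ ht)
      exact_mod_cast Nat.factorial_pos _
    · rw [Function.update_of_ne hk]
      exact h l' hl' (by omega)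

/-- If the first factor vanishes at `y`, the derivative of top order of the second factor does not
enter Leibniz' rule. -/
theorem norm_iterDir_bilin_le_of_vanish (hU : UniqueDiffOn ℝ U) {y : E} (hy : y ∈ U)
    (B : X →L[ℝ] Y →L[ℝ] Z) {K : ℝ} (hK : 0 ≤ K) (hB : ∀ x x', ‖B x x'‖ ≤ K * (‖x‖ * ‖x'‖))
    {l : List ι} {t : ℝ} (ht : 0 ≤ t) {φ ψ : ℕ → ℝ} (hφ0 : ∀ k, 0 ≤ φ k)
    (hψ0 : ∀ k, 0 ≤ ψ k) (hF : ContDiffOn ℝ ∞ F U) (hG : ContDiffOn ℝ ∞ G U)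
    (hφz : φ 0 = 0)
    (hφ : Majorizes U e y l (l.length + 1) t F φ) (hψ : Majorizes U e y l l.length t G ψ) :
    ‖iterDir U e l (fun z => B (F z) (G z)) y‖ ≤
      (l.length.factorial : ℝ) ^ t * (K * binConv φ ψ l.length) := by
  obtain ⟨ψ', h0, hne, hG'⟩ := hψ.exists_extend ht hψ0
  have := Majorizes.bilin hU hy B hK hB ht hφ0 h0 hF hG hφ hG' l (List.Sublist.refl _)
    (Nat.lt_succ_self _)
  have heq : binConv φ ψ' l.length = binConv φ ψ l.length := by
    refine Finset.sum_congr rfl fun ij hij => ?_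
    by_cases hk : ij.2 = l.length
    · have : ij.1 = 0 := by have := Finset.HasAntidiagonal.mem_antidiagonal.1 hij; omega
      rw [this, hφz, zero_mul, zero_mul]
    · rw [hne _ hk]
  exact this.trans (by simp only [heq, le_refl])

/-- If both factors vanish at `y`, no derivative of top order enters Leibniz' rule. -/
theorem norm_iterDir_bilin_le_of_vanish_both (hU : UniqueDiffOn ℝ U) {y : E} (hy : y ∈ U)
    (B : X →L[ℝ] Y →L[ℝ] Z) {K : ℝ} (hK : 0 ≤ K) (hB : ∀ x x', ‖B x x'‖ ≤ K * (‖x‖ * ‖x'‖))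
    {l : List ι} (hl : l ≠ []) {t : ℝ} (ht : 0 ≤ t) {φ ψ : ℕ → ℝ} (hφ0 : ∀ k, 0 ≤ φ k)
    (hψ0 : ∀ k, 0 ≤ ψ k) (hF : ContDiffOn ℝ ∞ F U) (hG : ContDiffOn ℝ ∞ G U)
    (hφz : φ 0 = 0) (hψz : ψ 0 = 0)
    (hφ : Majorizes U e y l l.length t F φ) (hψ : Majorizes U e y l l.length t G ψ) :
    ‖iterDir U e l (fun z => B (F z) (G z)) y‖ ≤
      (l.length.factorial : ℝ) ^ t * (K * binConv φ ψ l.length) := by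
  have hn : 0 ≠ l.length := fun h => hl (List.length_eq_zero_iff.1 h.symm)
  obtain ⟨φ', h0, hne, hF'⟩ := hφ.exists_extend ht hφ0
  have := norm_iterDir_bilin_le_of_vanish hU hy B hK hB ht h0 hψ0 hF hG
    ((hne 0 hn).trans hφz) hF' hψ
  have heq : binConv φ' ψ l.length = binConv φ ψ l.length := by
    refine Finset.sum_congr rfl fun ij hij => ?_
    by_cases hk : ij.1 = l.length
    · have : ij.2 = 0 := by have := Finset.HasAntidiagonal.mem_antidiagonal.1 hij; omega
      simp only [this, hψz, mul_zero]
    · rw [hne _ hk]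
  rwa [heq] at this

theorem Majorizes.bilin_of_vanish (hU : UniqueDiffOn ℝ U) {y : E} (hy : y ∈ U)
    (B : X →L[ℝ] Y →L[ℝ] Z) {K : ℝ} (hK : 0 ≤ K) (hB : ∀ x x', ‖B x x'‖ ≤ K * (‖x‖ * ‖x'‖))
    {l : List ι} {t : ℝ} (ht : 0 ≤ t) {φ ψ : ℕ → ℝ} (hφ0 : ∀ k, 0 ≤ φ k)
    (hψ0 : ∀ k, 0 ≤ ψ k) (hF : ContDiffOn ℝ ∞ F U) (hG : ContDiffOn ℝ ∞ G U)
    (hφz : φ 0 = 0)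
    (hφ : Majorizes U e y l (l.length + 1) t F φ) (hψ : Majorizes U e y l l.length t G ψ) :
    Majorizes U e y l (l.length + 1) t (fun z => B (F z) (G z)) (fun n => K * binConv φ ψ n) :=
  fun _ hl' _ => norm_iterDir_bilin_le_of_vanish hU hy B hK hB ht hφ0 hψ0 hF hG hφz
    (hφ.mono hl' (Nat.succ_le_succ hl'.length_le)) (hψ.mono hl' hl'.length_le)

/-- Subtracting the value at `y` removes the term of order zero from a majorant. -/
theorem Majorizes.sub_self (hU : UniqueDiffOn ℝ U) {y : E} (hy : y ∈ U) {l : List ι} {N : ℕ}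
    {t : ℝ} {φ : ℕ → ℝ} (hF : ContDiffOn ℝ ∞ F U) (hφ : Majorizes U e y l N t F φ) :
    Majorizes U e y l N t (fun z => F z - F y) (fun k => if k = 0 then 0 else φ k) := by
  intro l' hl' hN
  by_cases h : l' = []
  · subst h; simp
  · have : l'.length ≠ 0 := by simpa using h
    have h1 := iterDir_sub (e := e) hU hF (contDiffOn_const (c := F y)) l' hy
    simp only [iterDir_const _ h, sub_zero] at h1
    rw [h1]
    simpa only [this, if_false] using hφ l' hl' hN

end calculus

/-! ### Multi-indices and lists of directions -/

section multiindex

variable {s : ℕ} {X : Type*} [NormedAddCommGroup X] [NormedSpace ℝ X]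

/-- The list in which the index `i` occurs `ν i` times, in increasing order. -/
def indexList (ν : Fin s → ℕ) : List (Fin s) :=
  (List.finRange s).flatMap fun i => List.replicate (ν i) i

/-- The coordinate directions scaled by the radii `R`. -/
def scaledDir (R : Fin s → ℝ) (i : Fin s) : Fin s → ℝ := R i • Pi.single i 1

theorem length_indexList (ν : Fin s → ℕ) : (indexList ν).length = order ν := by
  simp [indexList, order, List.length_flatMap, List.sum_ofFn, ← List.ofFn_eq_map]

theorem prod_indexList (R : Fin s → ℝ) (ν : Fin s → ℕ) :
    ((indexList ν).map R).prod = multiPow R ν := by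
  have : ∀ L : List (Fin s), ((L.flatMap fun i => List.replicate (ν i) i).map R).prod =
      (L.map fun i => R i ^ ν i).prod := by
    intro L
    induction L with
    | nil => rfl
    | cons i L ih => simp [List.flatMap_cons, ih]
  rw [indexList, this, multiPow, ← List.ofFn_eq_map, List.prod_ofFn]

/-- Sublists of a sorted list of indices are sorted, so they come from multi-indices. -/
theorem exists_of_sublist_flatMap (ν : Fin s → ℕ) : ∀ {L : List (Fin s)}, L.Nodup →
    ∀ {l' : List (Fin s)}, l'.Sublist (L.flatMap fun i => List.replicate (ν i) i) →
    ∃ μ : Fin s → ℕ, l' = L.flatMap fun i => List.replicate (μ i) i := by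
  intro L
  induction L with
  | nil => intro _ l' h; exact ⟨ν, by simpa using h⟩
  | cons i L ih =>
    intro hL l' h
    rw [List.flatMap_cons, List.sublist_append_iff] at h
    obtain ⟨l₁, l₂, rfl, h1, h2⟩ := h
    obtain ⟨n, -, rfl⟩ := List.sublist_replicate_iff.1 h1
    obtain ⟨μ, rfl⟩ := ih (List.nodup_cons.1 hL).2 h2
    refine ⟨Function.update μ i n, ?_⟩
    rw [List.flatMap_cons, Function.update_self]
    congr 1
    refine List.flatMap_congr fun j hj => ?_
    rw [Function.update_of_ne]
    rintro rfl
    exact (List.nodup_cons.1 hL).1 hj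

theorem exists_indexList_of_sublist {ν : Fin s → ℕ} {l' : List (Fin s)}
    (h : l'.Sublist (indexList ν)) : ∃ μ : Fin s → ℕ, l' = indexList μ :=
  exists_of_sublist_flatMap ν (List.nodup_finRange s) h

theorem multiDeriv_eq_iterDir (U : Set (Fin s → ℝ)) (ν : Fin s → ℕ) (F : (Fin s → ℝ) → X) :
    multiDeriv U ν F = iterDir U (fun i => Pi.single i 1) (indexList ν) F := by
  have hrep : ∀ (i : Fin s) (n : ℕ) (G : (Fin s → ℝ) → X),
      iterDir U (fun i => Pi.single i 1) (List.replicate n i) G = (partialDeriv U i)^[n] G := by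
    intro i n G
    induction n with
    | zero => rfl
    | succ n ih => rw [List.replicate_succ, iterDir_cons, ih, Function.iterate_succ_apply']; rfl
  have : ∀ L : List (Fin s), L.foldr (fun i G => (partialDeriv U i)^[ν i] G) F =
      iterDir U (fun i => Pi.single i 1) (L.flatMap fun i => List.replicate (ν i) i) F := by
    intro L
    induction L with
    | nil => rfl
    | cons i L ih => rw [List.foldr_cons, ih, List.flatMap_cons, iterDir_append, hrep]
  exact this _

theorem iterDir_scaledDir {U : Set (Fin s → ℝ)} (hU : UniqueDiffOn ℝ U) (R : Fin s → ℝ)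
    (F : (Fin s → ℝ) → X) (l : List (Fin s)) :
    EqOn (iterDir U (scaledDir R) l F)
      (fun y => (l.map R).prod • iterDir U (fun i => Pi.single i 1) l F y) U := by
  induction l with
  | nil => intro y _; simp
  | cons i l ih =>
    refine (dirDeriv_congr ih _).trans fun y hy => ?_
    have h := fderivWithin_const_smul_field (𝕜 := ℝ)
      (f := iterDir U (fun i => Pi.single i 1) l F) ((l.map R).prod) (hU y hy)
    simp only [dirDeriv, iterDir_cons, List.map_cons, List.prod_cons, scaledDir]
    change fderivWithin ℝ ((l.map R).prod • iterDir U (fun i => Pi.single i 1) l F) U y _ = _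
    rw [h, map_smul, mul_smul]
    rfl

theorem norm_iterDir_indexList {U : Set (Fin s → ℝ)} (hU : UniqueDiffOn ℝ U) {R : Fin s → ℝ}
    (hR : ∀ j, 0 < R j) (F : (Fin s → ℝ) → X) (ν : Fin s → ℕ) {y : Fin s → ℝ} (hy : y ∈ U) :
    ‖iterDir U (scaledDir R) (indexList ν) F y‖ = multiPow R ν * ‖multiDeriv U ν F y‖ := by
  have h0 : 0 ≤ multiPow R ν := Finset.prod_nonneg fun j _ => pow_nonneg (hR j).le _
  rw [iterDir_scaledDir hU R F _ hy, prod_indexList, norm_smul, multiDeriv_eq_iterDir,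
    Real.norm_of_nonneg h0]

end multiindex

/-! ### Majorant sequences -/

section sequences

theorem binConv_zero (φ ψ : ℕ → ℝ) : binConv φ ψ 0 = φ 0 * ψ 0 := by simp [binConv]

theorem binConv_comm (φ ψ : ℕ → ℝ) (n : ℕ) : binConv φ ψ n = binConv ψ φ n := by
  rw [binConv, ← Finset.Nat.sum_antidiagonal_swap, binConv]
  refine Finset.sum_congr rfl fun ij hij => ?_
  rw [← Finset.HasAntidiagonal.mem_antidiagonal.1 hij, Prod.fst_swap, Prod.snd_swap,
    Nat.choose_symm_add, mul_comm (φ ij.2)]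

theorem binConv_nonneg {φ ψ : ℕ → ℝ} (hφ : ∀ k, 0 ≤ φ k) (hψ : ∀ k, 0 ≤ ψ k) (n : ℕ) :
    0 ≤ binConv φ ψ n :=
  Finset.sum_nonneg fun _ _ => mul_nonneg (Nat.cast_nonneg _) (mul_nonneg (hφ _) (hψ _))

theorem binConv_mono_right {φ ψ ψ' : ℕ → ℝ} (hφ : ∀ k, 0 ≤ φ k) (h : ∀ k, ψ k ≤ ψ' k) (n : ℕ) :
    binConv φ ψ n ≤ binConv φ ψ' n :=
  Finset.sum_le_sum fun _ _ => mul_le_mul_of_nonneg_left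
    (mul_le_mul_of_nonneg_left (h _) (hφ _)) (Nat.cast_nonneg _)

/-- The unit of binomial convolution. -/
def unitSeq (k : ℕ) : ℝ := if k = 0 then 1 else 0

theorem binConv_unitSeq (φ : ℕ → ℝ) (n : ℕ) : binConv φ unitSeq n = φ n := by
  rw [binConv, Finset.sum_eq_single (n, 0)]
  · simp [unitSeq]
  · rintro ⟨i, j⟩ hij hne
    have hj : j ≠ 0 := by
      rintro rfl
      exact hne (by simpa using Finset.HasAntidiagonal.mem_antidiagonal.1 hij)
    simp [unitSeq, hj]
  · intro h; exact absurd (by simp) h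

theorem binConv_add_right (φ ψ ψ' : ℕ → ℝ) (x y : ℝ) (n : ℕ) :
    binConv φ (fun k => x * ψ k + y * ψ' k) n = x * binConv φ ψ n + y * binConv φ ψ' n := by
  simp only [binConv, Finset.mul_sum, ← Finset.sum_add_distrib]
  exact Finset.sum_congr rfl fun _ _ => by ring

theorem binConv_add_left (φ φ' ψ : ℕ → ℝ) (x y : ℝ) (n : ℕ) :
    binConv (fun k => x * φ k + y * φ' k) ψ n = x * binConv φ ψ n + y * binConv φ' ψ n := by
  rw [binConv_comm, binConv_add_right, binConv_comm, binConv_comm ψ]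

theorem binConv_smul_right (φ ψ : ℕ → ℝ) (y : ℝ) (n : ℕ) :
    binConv φ (fun k => y * ψ k) n = y * binConv φ ψ n := by
  simp only [binConv, Finset.mul_sum]
  exact Finset.sum_congr rfl fun _ _ => by ring

theorem binConv_smul_left (φ ψ : ℕ → ℝ) (y : ℝ) (n : ℕ) :
    binConv (fun k => y * φ k) ψ n = y * binConv φ ψ n := by
  rw [binConv_comm, binConv_smul_right, binConv_comm]

theorem fallingHalf_zero : fallingHalf 0 = 1 := by simp [fallingHalf]

theorem fallingHalf_one : fallingHalf 1 = 1 / 2 := by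
  simp [fallingHalf]

theorem fallingHalf_succ {n : ℕ} (hn : 1 ≤ n) :
    fallingHalf (n + 1) = (n - 1 / 2) * fallingHalf n := by
  have h : (1 : ℝ) ≤ n := by exact_mod_cast hn
  rw [fallingHalf, Finset.prod_range_succ, abs_mul, fallingHalf, mul_comm,
    abs_of_nonpos (by linarith : (1 : ℝ) / 2 - n ≤ 0)]
  ring

theorem fallingHalf_pos (n : ℕ) : 0 < fallingHalf n := by
  rcases Nat.eq_zero_or_pos n with rfl | hn
  · rw [fallingHalf_zero]; norm_num
  · induction n, hn using Nat.le_induction with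
    | base => exact fallingHalf_one.symm ▸ one_half_pos
    | succ n hn ih =>
      rw [fallingHalf_succ hn]
      have h : (1 : ℝ) ≤ n := by exact_mod_cast hn
      exact mul_pos (by linarith) ih

theorem fallingHalf_two : fallingHalf 2 = 1 / 4 := by
  rw [fallingHalf_succ le_rfl, fallingHalf_one]; norm_num

/-- The majorant `k! / 2^k` (for `k ≥ 1`) of the derivatives of the data. -/
def dataSeq (k : ℕ) : ℝ := if k = 0 then 0 else (k.factorial : ℝ) / 2 ^ k

/-- The majorant `ρ^{k-1} [1/2]_k` (for `k ≥ 1`) of the derivatives of the solution. -/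
def solSeq (ρ : ℝ) (k : ℕ) : ℝ := if k = 0 then 0 else ρ ^ (k - 1) * fallingHalf k

variable {ρ : ℝ}

theorem dataSeq_nonneg (k : ℕ) : 0 ≤ dataSeq k := by
  unfold dataSeq; split_ifs <;> positivity

theorem solSeq_nonneg (hρ : 0 ≤ ρ) (k : ℕ) : 0 ≤ solSeq ρ k := by
  unfold solSeq; split_ifs
  · rfl
  · exact mul_nonneg (pow_nonneg hρ _) (fallingHalf_pos k).le

/-- The recursion of `[1/2]_k`, extended to `k = 0` by a unit source term. -/
theorem solSeq_succ (k : ℕ) :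
    solSeq ρ (k + 1) = ρ * (k - 1 / 2) * solSeq ρ k + 1 / 2 * unitSeq k := by
  rcases Nat.eq_zero_or_pos k with rfl | hk
  · simp [solSeq, unitSeq, fallingHalf_one]
  · obtain ⟨m, rfl⟩ : ∃ m, k = m + 1 := ⟨k - 1, by omega⟩
    simp only [solSeq, unitSeq, Nat.succ_ne_zero, if_false, Nat.add_sub_cancel]
    rw [fallingHalf_succ hk]
    push_cast
    ring

theorem dataSeq_succ (k : ℕ) :
    dataSeq (k + 1) = (k + 1) / 2 * (dataSeq k + unitSeq k) := by
  rcases Nat.eq_zero_or_pos k with rfl | hk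
  · simp [dataSeq, unitSeq]
  · have : k ≠ 0 := by omega
    simp only [dataSeq, unitSeq, Nat.succ_ne_zero, this, if_false]
    rw [Nat.factorial_succ, pow_succ]
    push_cast
    field_simp
    ring

theorem dataSeq_le {n : ℕ} (hn : 1 ≤ n) : dataSeq n ≤ 2 * fallingHalf n := by
  induction n, hn using Nat.le_induction with
  | base => rw [fallingHalf_one]; norm_num [dataSeq]
  | succ n hn ih =>
    rcases hn.eq_or_lt with rfl | h2
    · rw [fallingHalf_succ le_rfl, fallingHalf_one]; norm_num [dataSeq]
    · have h : (2 : ℝ) ≤ n := by exact_mod_cast h2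
      have hz : n ≠ 0 := by omega
      rw [fallingHalf_succ hn, dataSeq_succ, unitSeq, if_neg hz, add_zero]
      nlinarith [mul_le_mul_of_nonneg_left ih (by linarith : (0 : ℝ) ≤ (n + 1) / 2),
        fallingHalf_pos n, mul_nonneg (by linarith : (0 : ℝ) ≤ n - 2) (fallingHalf_pos n).le]

theorem dataSeq_le_pow (hρ : 1 ≤ ρ) {n : ℕ} (hn : 2 ≤ n) :
    dataSeq n ≤ 2 * (ρ ^ (n - 2) * fallingHalf n) :=
  (dataSeq_le (by omega)).trans (mul_le_mul_of_nonneg_left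
    (le_mul_of_one_le_left (fallingHalf_pos n).le (one_le_pow₀ hρ)) zero_le_two)

theorem binConv_solSeq_solSeq_succ (n : ℕ) :
    binConv (solSeq ρ) (solSeq ρ) (n + 1) =
      ρ * (n - 1) * binConv (solSeq ρ) (solSeq ρ) n + solSeq ρ n := by
  have h1 : binConv (solSeq ρ) (fun k => solSeq ρ (k + 1)) n +
      binConv (fun k => solSeq ρ (k + 1)) (solSeq ρ) n =
      ρ * (n - 1) * binConv (solSeq ρ) (solSeq ρ) n +
        (1 / 2 * binConv (solSeq ρ) unitSeq n + 1 / 2 * binConv unitSeq (solSeq ρ) n) := by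
    simp only [binConv, Finset.mul_sum, ← Finset.sum_add_distrib]
    refine Finset.sum_congr rfl fun ij hij => ?_
    have : (n : ℝ) = ij.1 + ij.2 := by
      rw [← Finset.HasAntidiagonal.mem_antidiagonal.1 hij]; push_cast; rfl
    rw [solSeq_succ, solSeq_succ, this]
    ring
  rw [binConv_succ, h1, binConv_comm unitSeq, binConv_unitSeq]
  ring

/-- `∑_{0<k<n} C(n, k) [1/2]_k [1/2]_{n-k} = 2 [1/2]_n`, with powers of `ρ` attached. -/
theorem binConv_solSeq_solSeq {n : ℕ} (hn : 2 ≤ n) :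
    binConv (solSeq ρ) (solSeq ρ) n = 2 * (ρ ^ (n - 2) * fallingHalf n) := by
  induction n, hn using Nat.le_induction with
  | base =>
    rw [binConv_solSeq_solSeq_succ, fallingHalf_succ le_rfl, fallingHalf_one]
    simp [solSeq, fallingHalf_one]
    norm_num
  | succ n hn ih =>
    obtain ⟨m, rfl⟩ : ∃ m, n = m + 2 := ⟨n - 2, by omega⟩
    rw [binConv_solSeq_solSeq_succ, ih, fallingHalf_succ (n := m + 2) (by omega)]
    simp only [solSeq, Nat.add_sub_cancel, Nat.succ_ne_zero, if_false,
      show m + 2 - 1 = m + 1 by omega, show m + 2 + 1 - 2 = m + 1 by omega]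
    push_cast
    ring

theorem binConv_dataSeq_solSeq_succ (n : ℕ) :
    binConv dataSeq (solSeq ρ) (n + 1) =
      (n + 1) / 2 * (solSeq ρ n + binConv dataSeq (solSeq ρ) n) := by
  have h2 : solSeq ρ n = binConv unitSeq (solSeq ρ) n := by rw [binConv_comm, binConv_unitSeq]
  rw [h2]
  simp only [binConv, Finset.mul_sum, ← Finset.sum_add_distrib]
  rw [Finset.Nat.sum_antidiagonal_succ]
  simp only [dataSeq_succ]
  rw [show dataSeq 0 = 0 by simp [dataSeq], zero_mul, mul_zero, zero_add]
  refine Finset.sum_congr rfl fun ij _ => ?_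
  have : ((n + 1).choose (ij.1 + 1) : ℝ) * (ij.1 + 1) = (n + 1) * n.choose ij.1 := by
    exact_mod_cast (Nat.add_one_mul_choose_eq n ij.1).symm
  linear_combination (1 / 2 * (dataSeq ij.1 + unitSeq ij.1) * solSeq ρ ij.2) * this

/-- For `ρ ≥ 4` the mixed convolution is dominated by its term of top order in the solution. -/
theorem binConv_dataSeq_solSeq_le (hρ : 4 ≤ ρ) {n : ℕ} (hn : 2 ≤ n) :
    binConv dataSeq (solSeq ρ) n ≤ 2 * (ρ ^ (n - 2) * fallingHalf n) := by
  induction n, hn using Nat.le_induction with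
  | base =>
    rw [binConv_dataSeq_solSeq_succ, binConv_dataSeq_solSeq_succ, fallingHalf_two, binConv_zero]
    simp [solSeq, fallingHalf_one, dataSeq]
    norm_num
  | succ n hn ih =>
    obtain ⟨m, rfl⟩ : ∃ m, n = m + 2 := ⟨n - 2, by omega⟩
    rw [binConv_dataSeq_solSeq_succ, fallingHalf_succ (by omega)]
    have hs : solSeq ρ (m + 2) = ρ * (ρ ^ m * fallingHalf (m + 2)) := by
      simp only [solSeq, Nat.succ_ne_zero, if_false, show m + 2 - 1 = m + 1 by omega]
      ring
    rw [hs, show m + 2 + 1 - 2 = m + 1 by omega, pow_succ]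
    simp only [Nat.add_sub_cancel] at ih
    set P := ρ ^ m * fallingHalf (m + 2) with hP
    have hP0 : 0 ≤ P := mul_nonneg (pow_nonneg (by linarith) _) (fallingHalf_pos _).le
    have hm : (0 : ℝ) ≤ m := Nat.cast_nonneg m
    have h1 : ρ * P + binConv dataSeq (solSeq ρ) (m + 2) ≤ 3 / 2 * (ρ * P) := by nlinarith
    have h2 : (((m + 2 : ℕ) : ℝ) + 1) / 2 * (ρ * P + binConv dataSeq (solSeq ρ) (m + 2)) ≤
        (((m + 2 : ℕ) : ℝ) + 1) / 2 * (3 / 2 * (ρ * P)) :=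
      mul_le_mul_of_nonneg_left h1 (by positivity)
    refine h2.trans ?_
    have h3 : 2 * (ρ ^ m * ρ * ((((m + 2 : ℕ) : ℝ) - 1 / 2) * fallingHalf (m + 2))) =
        2 * (((m + 2 : ℕ) : ℝ) - 1 / 2) * (ρ * P) := by rw [hP]; ring
    rw [h3]
    have h4 : 0 ≤ ρ * P := mul_nonneg (by linarith) hP0
    push_cast
    nlinarith [mul_nonneg hm h4]

theorem binConv_dataSeq_solSeq_le' (hρ : 4 ≤ ρ) (n : ℕ) :
    binConv dataSeq (solSeq ρ) n ≤ 2 / ρ * solSeq ρ n := by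
  have hρ0 : 0 < ρ := by linarith
  rcases lt_or_ge n 2 with h | h
  · have h0 : binConv dataSeq (solSeq ρ) n = 0 := by
      interval_cases n
      · rw [binConv_zero]; simp [solSeq]
      · rw [binConv_dataSeq_solSeq_succ, binConv_zero]; simp [solSeq]
    rw [h0]
    exact mul_nonneg (by positivity) (solSeq_nonneg hρ0.le n)
  · obtain ⟨m, rfl⟩ : ∃ m, n = m + 2 := ⟨n - 2, by omega⟩
    refine (binConv_dataSeq_solSeq_le hρ h).trans (le_of_eq ?_)
    simp only [solSeq, Nat.add_sub_cancel, Nat.succ_ne_zero, if_false,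
      show m + 2 - 1 = m + 1 by omega, pow_succ]
    field_simp

/-- The convolution arising from the trilinear term `m`. -/
theorem binConv_dataSeq_solSeq_solSeq_le (hρ : 4 ≤ ρ) {n : ℕ} (hn : 2 ≤ n) :
    binConv (binConv dataSeq (solSeq ρ)) (solSeq ρ) n ≤ ρ ^ (n - 2) * fallingHalf n := by
  have hρ0 : 0 < ρ := by linarith
  have h := binConv_mono_right (solSeq_nonneg hρ0.le) (binConv_dataSeq_solSeq_le' hρ) n
  rw [binConv_comm, binConv_smul_right, binConv_solSeq_solSeq hn] at h
  refine h.trans ?_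
  have hP : 0 ≤ ρ ^ (n - 2) * fallingHalf n :=
    mul_nonneg (pow_nonneg hρ0.le _) (fallingHalf_pos _).le
  have h2 : 2 / ρ * (2 * (ρ ^ (n - 2) * fallingHalf n)) =
      4 / ρ * (ρ ^ (n - 2) * fallingHalf n) := by ring
  rw [h2]
  exact mul_le_of_le_one_left hP ((div_le_one hρ0).2 hρ)

end sequences

/-! ### Saddle point problems in Hilbert spaces -/

section saddle

variable {H L : Type*} [NormedAddCommGroup H] [InnerProductSpace ℝ H]
  [NormedAddCommGroup L] [InnerProductSpace ℝ L]

/-- The Lax–Milgram theorem. -/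
theorem exists_of_coercive [CompleteSpace H] {k : H →L[ℝ] H →L[ℝ] ℝ} {α : ℝ} (hα : 0 < α)
    (hk : ∀ v, α * ‖v‖ ^ 2 ≤ k v v) (F : H →L[ℝ] ℝ) : ∃ u, ∀ v, k u v = F v := by
  have hc : IsCoercive k := ⟨α, hα, fun v => by rw [mul_assoc, ← pow_two]; exact hk v⟩
  refine ⟨hc.continuousLinearEquivOfBilin.symm ((InnerProductSpace.toDual ℝ H).symm F), fun v => ?_⟩
  rw [← hc.continuousLinearEquivOfBilin_apply, ContinuousLinearEquiv.apply_symm_apply,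
    InnerProductSpace.toDual_symm_apply]

variable {b : H →L[ℝ] L →L[ℝ] ℝ} {β : ℝ}

/-- The Riesz representation `q ↦ T q` of `b(·, q)`. -/
theorem exists_riesz_flip [CompleteSpace H] (b : H →L[ℝ] L →L[ℝ] ℝ) :
    ∃ T : L →L[ℝ] H, (∀ q v, inner ℝ (T q) v = b v q) ∧ ∀ q, ‖T q‖ = ‖b.flip q‖ := by
  let T₀ : L →ₗ[ℝ] H :=
    { toFun := fun q => (InnerProductSpace.toDual ℝ H).symm (b.flip q)
      map_add' := fun x y => by rw [map_add, map_add]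
      map_smul' := fun c x => by rw [map_smul, map_smulₛₗ]; rfl }
  have hn : ∀ q, ‖T₀ q‖ = ‖b.flip q‖ := fun q =>
    (InnerProductSpace.toDual ℝ H).symm.norm_map (b.flip q)
  refine ⟨T₀.mkContinuous ‖b.flip‖ fun q => ?_, fun q v => ?_, hn⟩
  · rw [hn]; exact b.flip.le_opNorm q
  · exact InnerProductSpace.toDual_symm_apply

/-- Under the inf-sup condition every functional on `L` has a lifting which is orthogonal to the
kernel of `b` and bounded by `1 / β`. -/
theorem exists_lift [CompleteSpace L] (hβ : 0 < β) (hb : ∀ q, β * ‖q‖ ≤ ‖b.flip q‖) (T : L →L[ℝ] H)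
    (hT : ∀ q v, inner ℝ (T q) v = b v q) (hTn : ∀ q, ‖T q‖ = ‖b.flip q‖) (G : L →L[ℝ] ℝ) :
    ∃ q, b (T q) = G ∧ β * ‖T q‖ ≤ ‖G‖ := by
  have hS : ∀ q, β ^ 2 * ‖q‖ ^ 2 ≤ (b.comp T) q q := fun q => by
    rw [ContinuousLinearMap.comp_apply, ← hT, real_inner_self_eq_norm_sq, ← mul_pow, hTn]
    exact pow_le_pow_left₀ (by positivity) (hb q) 2
  obtain ⟨q, hq⟩ := exists_of_coercive (pow_pos hβ 2) hS G
  refine ⟨q, ContinuousLinearMap.ext hq, ?_⟩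
  have h1 : ‖T q‖ ^ 2 = G q := by
    rw [← real_inner_self_eq_norm_sq, hT]; exact hq q
  have h2 : G q ≤ ‖G‖ * ‖q‖ := (le_abs_self _).trans (G.le_opNorm q)
  have h3 : β * ‖q‖ ≤ ‖T q‖ := by rw [hTn]; exact hb q
  rcases (norm_nonneg (T q)).eq_or_lt with h0 | h0
  · rw [← h0, mul_zero]; exact norm_nonneg _
  · refine le_of_mul_le_mul_right ?_ h0
    calc β * ‖T q‖ * ‖T q‖ = β * G q := by rw [← h1]; ring
      _ ≤ β * (‖G‖ * ‖q‖) := by gcongr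
      _ = ‖G‖ * (β * ‖q‖) := by ring
      _ ≤ ‖G‖ * ‖T q‖ := by gcongr

theorem exists_lift_of_infSup [CompleteSpace H] [CompleteSpace L]
    (hβ : 0 < β) (hb : ∀ q, β * ‖q‖ ≤ ‖b.flip q‖) (G : L →L[ℝ] ℝ) :
    ∃ h, b h = G ∧ β * ‖h‖ ≤ ‖G‖ := by
  obtain ⟨T, hT, hTn⟩ := exists_riesz_flip b
  obtain ⟨q, hq, hq'⟩ := exists_lift hβ hb T hT hTn G
  exact ⟨T q, hq, hq'⟩

/-- Under the inf-sup condition a functional that vanishes on the kernel of `b` is of the form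
`b(·, q)`. -/
theorem exists_pressure [CompleteSpace H] [CompleteSpace L]
    (hβ : 0 < β) (hb : ∀ q, β * ‖q‖ ≤ ‖b.flip q‖) (F : H →L[ℝ] ℝ)
    (hF : ∀ v, b v = 0 → F v = 0) : ∃ q, b.flip q = F := by
  obtain ⟨T, hT, hTn⟩ := exists_riesz_flip b
  set w := (InnerProductSpace.toDual ℝ H).symm F with hw
  have hwF : ∀ v, inner ℝ w v = F v := fun v => InnerProductSpace.toDual_symm_apply
  obtain ⟨q, hq, -⟩ := exists_lift hβ hb T hT hTn (b w)
  -- `w - T q` lies in the kernel of `b`, and both `w` and `T q` are orthogonal to that kernel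
  have hker : b (w - T q) = 0 := by rw [map_sub, hq, sub_self]
  have h0 : w - T q = 0 := by
    rw [← inner_self_eq_zero (𝕜 := ℝ), inner_sub_left, hwF, hF _ hker, hT, hker]
    simp
  refine ⟨q, ContinuousLinearMap.ext fun v => ?_⟩
  rw [ContinuousLinearMap.flip_apply, ← hT, ← sub_eq_zero.1 h0, hwF]

/-- Lax–Milgram on the kernel of `b`. -/
theorem exists_of_coercive_ker [CompleteSpace H] {k : H →L[ℝ] H →L[ℝ] ℝ} {α : ℝ} (hα : 0 < α)
    (hk : ∀ v, α * ‖v‖ ^ 2 ≤ k v v) (b : H →L[ℝ] L →L[ℝ] ℝ) (F : H →L[ℝ] ℝ) :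
    ∃ u, b u = 0 ∧ ∀ v, b v = 0 → k u v = F v := by
  let V : Submodule ℝ H := LinearMap.ker (b : H →ₗ[ℝ] L →L[ℝ] ℝ)
  have hV : IsClosed (V : Set H) := b.isClosed_ker
  have : CompleteSpace V := hV.completeSpace_coe
  obtain ⟨u, hu⟩ := exists_of_coercive (H := V) (k := k.bilinearComp V.subtypeL V.subtypeL) hα
    (fun v => hk v) (F.comp V.subtypeL)
  exact ⟨u, u.2, fun v hv => hu ⟨v, hv⟩⟩

/-- Solvability of the saddle point problem. -/
theorem exists_saddle [CompleteSpace H] [CompleteSpace L]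
    {k : H →L[ℝ] H →L[ℝ] ℝ} {α : ℝ} (hα : 0 < α)
    (hk : ∀ v, α * ‖v‖ ^ 2 ≤ k v v) (hβ : 0 < β) (hb : ∀ q, β * ‖q‖ ≤ ‖b.flip q‖)
    (F : H →L[ℝ] ℝ) (G : L →L[ℝ] ℝ) : ∃ h q, k h - b.flip q = F ∧ b h = G := by
  obtain ⟨g, hg, -⟩ := exists_lift_of_infSup hβ hb G
  obtain ⟨z, hz, hzF⟩ := exists_of_coercive_ker hα hk b (F - k g)
  obtain ⟨q, hq⟩ := exists_pressure hβ hb (k (g + z) - F) fun v hv => by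
    rw [map_add]
    simp [hzF v hv]
  exact ⟨g + z, q, by rw [hq]; abel, by rw [map_add, hz, hg, add_zero]⟩

/-- The a priori bound of the velocity, by splitting it into a bounded lifting of the divergence data
and a part in the kernel of `b`. -/
theorem norm_velocity_le [CompleteSpace H] [CompleteSpace L]
    {k : H →L[ℝ] H →L[ℝ] ℝ} {α K : ℝ} (hα : 0 < α)
    (hk : ∀ v, α * ‖v‖ ^ 2 ≤ k v v) (hK : ∀ v, ‖k v‖ ≤ K * ‖v‖) (hβ : 0 < β)
    (hb : ∀ q, β * ‖q‖ ≤ ‖b.flip q‖) {F : H →L[ℝ] ℝ} {G : L →L[ℝ] ℝ} {h : H} {q : L}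
    (h1 : k h - b.flip q = F) (h2 : b h = G) (hK0 : 0 ≤ K) :
    ‖h‖ ≤ ‖G‖ / β + (‖F‖ + K * (‖G‖ / β)) / α := by
  obtain ⟨g, hg, hgn⟩ := exists_lift_of_infSup hβ hb G
  have hgn' : ‖g‖ ≤ ‖G‖ / β := by rw [le_div_iff₀ hβ, mul_comm]; exact hgn
  set z := h - g with hz
  have hbz : b z = 0 := by rw [hz, map_sub, h2, hg, sub_self]
  have e : k z z = F z - k g z := by
    have : k h z - b z q = F z := by rw [← h1]; rfl
    rw [hbz] at this
    rw [← this, hz, map_sub]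
    simp only [sub_apply, zero_apply, map_sub]
    ring
  have hz1 : α * ‖z‖ ^ 2 ≤ (‖F‖ + K * ‖g‖) * ‖z‖ := by
    refine (hk z).trans ?_
    rw [e]
    have a1 : F z ≤ ‖F‖ * ‖z‖ := (le_abs_self _).trans (F.le_opNorm z)
    have a2 : -(k g z) ≤ K * ‖g‖ * ‖z‖ := (neg_le_abs _).trans
      (((k g).le_opNorm z).trans (mul_le_mul_of_nonneg_right (hK g) (norm_nonneg _)))
    linarith
  have hz2 : ‖z‖ ≤ (‖F‖ + K * ‖g‖) / α := by
    rw [le_div_iff₀ hα]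
    rcases (norm_nonneg z).eq_or_lt with h0 | h0
    · rw [← h0, zero_mul]; positivity
    · refine le_of_mul_le_mul_right ?_ h0
      linarith
  have hh : h = g + z := by rw [hz]; abel
  rw [hh]
  refine (norm_add_le _ _).trans (add_le_add hgn' (hz2.trans ?_))
  gcongr

/-- The a priori bound of the pressure in terms of the momentum residual. -/
theorem norm_pressure_le {F : H →L[ℝ] ℝ} {x : H →L[ℝ] ℝ} {q : L}
    (hb : ∀ q, β * ‖q‖ ≤ ‖b.flip q‖) (h1 : x - b.flip q = F) : β * ‖q‖ ≤ ‖F‖ + ‖x‖ := by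
  refine (hb q).trans ?_
  rw [show b.flip q = x - F by rw [← h1]; abel, add_comm]
  exact norm_sub_le _ _

end saddle

/-! ### The Navier–Stokes problem as an equation in Hilbert spaces -/

/-- The forms `a`, `b`, `m` of the problem on a velocity space `H`, a pressure space `L` and a
space `X` of coefficients, in operator form. The coefficient comes first; the last argument is the
test function. The constant `κ` bounds `m`; it is the square of the Sobolev constant in the
application. -/
structure SaddleForms (X H L : Type*) [NormedAddCommGroup X] [NormedSpace ℝ X]
    [NormedAddCommGroup H] [InnerProductSpace ℝ H] [NormedAddCommGroup L]
    [InnerProductSpace ℝ L] where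
  a : X →L[ℝ] H →L[ℝ] H →L[ℝ] ℝ
  b : X →L[ℝ] H →L[ℝ] L →L[ℝ] ℝ
  m : X →L[ℝ] H →L[ℝ] H →L[ℝ] H →L[ℝ] ℝ
  κ : ℝ
  κ_pos : 0 < κ
  norm_a_le : ∀ A u, ‖a A u‖ ≤ ‖A‖ * ‖u‖
  norm_b_le : ∀ B u, ‖b B u‖ ≤ ‖B‖ * ‖u‖
  norm_m_le : ∀ M u v, ‖m M u v‖ ≤ κ * ‖M‖ * (‖u‖ * ‖v‖)

namespace SaddleForms

variable {X H L : Type*} [NormedAddCommGroup X] [NormedSpace ℝ X]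
  [NormedAddCommGroup H] [InnerProductSpace ℝ H] [NormedAddCommGroup L] [InnerProductSpace ℝ L]
  (Φ : SaddleForms X H L)

/-- The form `b` with the pressure before the velocity. -/
def bT : X →L[ℝ] L →L[ℝ] H →L[ℝ] ℝ :=
  (ContinuousLinearMap.flipₗᵢ ℝ H L ℝ).toContinuousLinearEquiv.toContinuousLinearMap.comp Φ.b

theorem bT_eq (B : X) : Φ.bT B = (Φ.b B).flip := rfl

theorem norm_bT_le (B : X) (q : L) : ‖Φ.bT B q‖ ≤ ‖B‖ * ‖q‖ := by
  refine ContinuousLinearMap.opNorm_le_bound _ (by positivity) fun v => ?_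
  rw [bT_eq, ContinuousLinearMap.flip_apply]
  calc ‖Φ.b B v q‖ ≤ ‖Φ.b B v‖ * ‖q‖ := (Φ.b B v).le_opNorm q
    _ ≤ ‖B‖ * ‖v‖ * ‖q‖ := by gcongr; exact Φ.norm_b_le B v
    _ = ‖B‖ * ‖q‖ * ‖v‖ := by ring

/-- The solutions of the nonlinear problem with data `A, B, M, f, G`. -/
def IsSol (A B M : X) (f : H →L[ℝ] ℝ) (G : L →L[ℝ] ℝ) (u : H) (p : L) : Prop :=
  Φ.a A u + Φ.m M u u - Φ.bT B p = f ∧ Φ.b B u = G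

variable {Φ} {A B M : X} {f : H →L[ℝ] ℝ} {G : L →L[ℝ] ℝ} {α β m₀ γ : ℝ}

theorem norm_m_le' (hM : Φ.κ * ‖M‖ ≤ m₀ / 2) (u v : H) :
    ‖Φ.m M u v‖ ≤ m₀ / 2 * (‖u‖ * ‖v‖) :=
  (Φ.norm_m_le M u v).trans (mul_le_mul_of_nonneg_right hM (by positivity))

theorem abs_m_le (hM : Φ.κ * ‖M‖ ≤ m₀ / 2) (u v w : H) :
    |Φ.m M u v w| ≤ m₀ / 2 * (‖u‖ * ‖v‖) * ‖w‖ :=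
  ((Φ.m M u v).le_opNorm w).trans
    (mul_le_mul_of_nonneg_right (norm_m_le' hM u v) (norm_nonneg _))

/-- The linearization `a(h, ·) + m(u₁, h, ·) + m(h, u₂, ·)` is coercive if the velocities
`u₁`, `u₂` are small. -/
theorem coercive_linearization (hA : ∀ v, α * ‖v‖ ^ 2 ≤ Φ.a A v v) (hM : Φ.κ * ‖M‖ ≤ m₀ / 2)
    (u₁ u₂ v : H) :
    (α - m₀ / 2 * (‖u₁‖ + ‖u₂‖)) * ‖v‖ ^ 2 ≤
      (Φ.a A + Φ.m M u₁ + (Φ.m M).flip u₂) v v := by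
  have h1 := neg_le_of_abs_le (abs_m_le hM u₁ v v)
  have h2 := neg_le_of_abs_le (abs_m_le hM v u₂ v)
  simp only [add_apply, ContinuousLinearMap.flip_apply]
  nlinarith [hA v]

/-- Uniqueness of small solutions. -/
theorem IsSol.unique (hA : ∀ v, α * ‖v‖ ^ 2 ≤ Φ.a A v v) (hM : Φ.κ * ‖M‖ ≤ m₀ / 2) (hβ : 0 < β)
    (hB : ∀ q, β * ‖q‖ ≤ ‖Φ.bT B q‖) {u₁ u₂ : H} {p₁ p₂ : L}
    (h₁ : Φ.IsSol A B M f G u₁ p₁) (h₂ : Φ.IsSol A B M f G u₂ p₂)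
    (hs : m₀ / 2 * (‖u₁‖ + ‖u₂‖) < α) : u₁ = u₂ ∧ p₁ = p₂ := by
  set k := Φ.a A + Φ.m M u₁ + (Φ.m M).flip u₂ with hk
  have e1 : k (u₁ - u₂) - Φ.bT B (p₁ - p₂) = 0 := by
    have := h₁.1.trans h₂.1.symm
    have e : k (u₁ - u₂) - Φ.bT B (p₁ - p₂) = (Φ.a A u₁ + Φ.m M u₁ u₁ - Φ.bT B p₁) -
        (Φ.a A u₂ + Φ.m M u₂ u₂ - Φ.bT B p₂) := by
      simp only [hk, add_apply, ContinuousLinearMap.flip_apply, map_sub]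
      abel
    rw [e, this, sub_self]
  have e2 : Φ.b B (u₁ - u₂) = 0 := by rw [map_sub, h₁.2, h₂.2, sub_self]
  have e3 : k (u₁ - u₂) (u₁ - u₂) = 0 := by
    have := congrArg (fun F => F (u₁ - u₂)) e1
    simp only [sub_apply, bT_eq, ContinuousLinearMap.flip_apply, e2,
      zero_apply, sub_zero] at this
    exact this
  have hc := coercive_linearization hA hM u₁ u₂ (u₁ - u₂)
  rw [← hk, e3] at hc
  have h0 : u₁ - u₂ = 0 := by
    by_contra hne
    have : 0 < ‖u₁ - u₂‖ ^ 2 := by have := norm_pos_iff.2 hne; positivity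
    nlinarith
  refine ⟨sub_eq_zero.1 h0, ?_⟩
  rw [h0, map_zero, zero_sub, neg_eq_zero] at e1
  have h3 := hB (p₁ - p₂)
  rw [e1, norm_zero] at h3
  exact sub_eq_zero.1 (norm_le_zero_iff.1 (nonpos_of_mul_nonpos_right h3 hβ))

variable (Φ) in
/-- The residual of the problem as a function of the data and of the unknowns. -/
def residual (x : (X × X × X × (H →L[ℝ] ℝ) × (L →L[ℝ] ℝ)) × H × L) :
    (H →L[ℝ] ℝ) × (L →L[ℝ] ℝ) :=
  (Φ.a x.1.1 x.2.1 + Φ.m x.1.2.2.1 x.2.1 x.2.1 - Φ.bT x.1.2.1 x.2.2 - x.1.2.2.2.1,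
    Φ.b x.1.2.1 x.2.1 - x.1.2.2.2.2)

variable (Φ) in
theorem contDiff_residual : ContDiff ℝ ∞ Φ.residual := by
  unfold residual
  fun_prop

theorem residual_eq_zero_iff {u : H} {p : L} :
    Φ.residual ((A, B, M, f, G), u, p) = 0 ↔ Φ.IsSol A B M f G u p := by
  simp only [residual, IsSol, Prod.mk_eq_zero, sub_eq_zero]

theorem fderiv_residual_comp_inr (A B M : X) (f : H →L[ℝ] ℝ) (G : L →L[ℝ] ℝ) (u : H) (p : L) :
    (fderiv ℝ Φ.residual ((A, B, M, f, G), u, p)).comp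
      (ContinuousLinearMap.inr ℝ (X × X × X × (H →L[ℝ] ℝ) × (L →L[ℝ] ℝ)) (H × L)) =
      ((Φ.a A + Φ.m M u + (Φ.m M).flip u).comp (ContinuousLinearMap.fst ℝ H L) -
        (Φ.bT B).comp (ContinuousLinearMap.snd ℝ H L)).prod
        ((Φ.b B).comp (ContinuousLinearMap.fst ℝ H L)) := by
  have h1 := ((Φ.contDiff_residual.differentiable (by simp)
    ((A, B, M, f, G), u, p)).hasFDerivAt).comp (u, p)
    (hasFDerivAt_prodMk_right (𝕜 := ℝ) (A, B, M, f, G) (u, p))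
  refine h1.unique ?_
  have hfst : HasFDerivAt (fun x : H × L => x.1) (ContinuousLinearMap.fst ℝ H L) (u, p) :=
    hasFDerivAt_fst
  have hsnd : HasFDerivAt (fun x : H × L => x.2) (ContinuousLinearMap.snd ℝ H L) (u, p) :=
    hasFDerivAt_snd
  have ha := (Φ.a A).hasFDerivAt.comp (u, p) hfst
  have hb := (Φ.bT B).hasFDerivAt.comp (u, p) hsnd
  have hb' := (Φ.b B).hasFDerivAt.comp (u, p) hfst
  have hm := (Φ.m M).hasFDerivAt_of_bilinear hfst hfst
  refine ((((ha.add hm).sub hb).sub_const f).prodMk (hb'.sub_const G)).congr_fderiv ?_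
  refine ContinuousLinearMap.ext fun x => Prod.ext ?_ rfl
  change Φ.a A x.1 + (Φ.m M u x.1 + Φ.m M x.1 u) - Φ.bT B x.2 =
    (Φ.a A x.1 + Φ.m M u x.1 + Φ.m M x.1 u) - Φ.bT B x.2
  rw [add_assoc]

variable [CompleteSpace H] [CompleteSpace L]

/-- Existence of a small solution by Banach's fixed point theorem: the velocity is sought in the
form `w + z` with `z` in the kernel of `b`. -/
theorem exists_isSol (hα : 0 < α) (hA : ∀ v, α * ‖v‖ ^ 2 ≤ Φ.a A v v)
    (hM : Φ.κ * ‖M‖ ≤ m₀ / 2) (hm₀ : 0 < m₀) (hβ : 0 < β) (hB : ∀ q, β * ‖q‖ ≤ ‖Φ.bT B q‖)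
    (hγ : 0 < γ) (hγα : m₀ * γ < α) {w : H} (hwa : ∀ v, Φ.b B v = 0 → Φ.a A w v = 0)
    (hwb : Φ.b B w = G) (hr : ‖w‖ + (‖f‖ + m₀ / 2 * γ ^ 2) / α ≤ γ) :
    ∃ u p, Φ.IsSol A B M f G u p ∧ ‖u‖ ≤ γ := by
  have hex : ∀ u : H, ∃ z, Φ.b B z = 0 ∧ ∀ v, Φ.b B v = 0 → Φ.a A z v = (f - Φ.m M u u) v :=
    fun u => exists_of_coercive_ker hα hA (Φ.b B) _
  choose z hzb hza using hex
  have hstep : ∀ {x : H} {c : ℝ}, α * ‖x‖ ^ 2 ≤ c * ‖x‖ → 0 ≤ c → ‖x‖ ≤ c / α := by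
    intro x c h hc
    rw [le_div_iff₀ hα]
    rcases (norm_nonneg x).eq_or_lt with h0 | h0
    · rw [← h0, zero_mul]; exact hc
    · exact le_of_mul_le_mul_right (by linarith) h0
  have hz : ∀ u, ‖u‖ ≤ γ → ‖z u‖ ≤ (‖f‖ + m₀ / 2 * γ ^ 2) / α := fun u hu => by
    refine hstep ((hA _).trans ?_) (by positivity)
    rw [hza u _ (hzb u), sub_apply]
    have h1 : f (z u) ≤ ‖f‖ * ‖z u‖ := (le_abs_self _).trans (f.le_opNorm _)
    have h2 := neg_le_of_abs_le (abs_m_le hM u u (z u))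
    have h3 : m₀ / 2 * (‖u‖ * ‖u‖) * ‖z u‖ ≤ m₀ / 2 * γ ^ 2 * ‖z u‖ := by
      rw [← pow_two]; gcongr
    linarith
  have hzz : ∀ u u', ‖u‖ ≤ γ → ‖u'‖ ≤ γ → ‖z u - z u'‖ ≤ m₀ * γ * ‖u - u'‖ / α :=
      fun u u' hu hu' => by
    have hb0 : Φ.b B (z u - z u') = 0 := by rw [map_sub, hzb, hzb, sub_self]
    refine hstep ((hA _).trans ?_) (by positivity)
    have e₀ : Φ.a A (z u - z u') (z u - z u') =
        Φ.a A (z u) (z u - z u') - Φ.a A (z u') (z u - z u') := by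
      rw [map_sub (Φ.a A), sub_apply]
    rw [e₀, hza u _ hb0, hza u' _ hb0]
    have e : (f - Φ.m M u u) (z u - z u') - (f - Φ.m M u' u') (z u - z u') =
        -(Φ.m M u (u - u') (z u - z u')) - Φ.m M (u - u') u' (z u - z u') := by
      simp only [map_sub, sub_apply]
      ring
    rw [e]
    have h1 := neg_le_of_abs_le (abs_m_le hM u (u - u') (z u - z u'))
    have h2 := neg_le_of_abs_le (abs_m_le hM (u - u') u' (z u - z u'))
    have h3 : m₀ / 2 * (‖u‖ * ‖u - u'‖) * ‖z u - z u'‖ ≤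
      m₀ / 2 * (γ * ‖u - u'‖) * ‖z u - z u'‖ := by gcongr
    have h4 : m₀ / 2 * (‖u - u'‖ * ‖u'‖) * ‖z u - z u'‖ ≤
      m₀ / 2 * (‖u - u'‖ * γ) * ‖z u - z u'‖ := by gcongr
    linarith
  let S : Set H := Metric.closedBall 0 γ
  have hS : ∀ {u : H}, u ∈ S ↔ ‖u‖ ≤ γ := mem_closedBall_zero_iff
  let T : H → H := fun u => w + z u
  have hmaps : MapsTo T S S := fun u hu =>
    hS.2 ((norm_add_le _ _).trans ((add_le_add_right (hz u (hS.1 hu)) _).trans hr))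
  have hcontr : ContractingWith (m₀ * γ / α).toNNReal (hmaps.restrict T S S) := by
    refine ⟨?_, LipschitzWith.of_dist_le_mul fun x y => ?_⟩
    · rw [Real.toNNReal_lt_one, div_lt_one hα]; exact hγα
    · rw [Real.coe_toNNReal _ (by positivity), Subtype.dist_eq, Subtype.dist_eq, dist_eq_norm,
        dist_eq_norm]
      have := hzz x y (hS.1 x.2) (hS.1 y.2)
      simp only [MapsTo.val_restrict_apply, T, add_sub_add_left_eq_sub]
      exact this.trans (le_of_eq (by ring))
  obtain ⟨u, huS, hfix, -⟩ := hcontr.exists_fixedPoint' Metric.isClosed_closedBall.isComplete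
    hmaps (Metric.mem_closedBall_self hγ.le) (edist_ne_top _ _)
  have hu : w + z u = u := hfix
  obtain ⟨p, hp⟩ := exists_pressure (b := Φ.b B) hβ hB (Φ.a A u + Φ.m M u u - f) fun v hv => by
    have h1 := hza u v hv
    have h2 : Φ.a A u v = Φ.a A w v + Φ.a A (z u) v := by
      rw [← add_apply, ← map_add, hu]
    simp only [sub_apply, add_apply] at h1 ⊢
    rw [h2, hwa v hv, h1]
    ring
  refine ⟨u, p, ⟨?_, ?_⟩, hS.1 huS⟩
  · rw [bT_eq, hp]; abel
  · rw [← hu, map_add, hwb, hzb, add_zero]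

/-- The linearized problem defines an isomorphism. -/
theorem bijective_linearization (hβ : 0 < β) (hB : ∀ q, β * ‖q‖ ≤ ‖Φ.bT B q‖)
    {k : H →L[ℝ] H →L[ℝ] ℝ} (hα : 0 < α) (hk : ∀ v, α * ‖v‖ ^ 2 ≤ k v v) :
    Function.Bijective
      ((k.comp (ContinuousLinearMap.fst ℝ H L) -
        (Φ.bT B).comp (ContinuousLinearMap.snd ℝ H L)).prod
        ((Φ.b B).comp (ContinuousLinearMap.fst ℝ H L))) := by
  constructor
  · rw [injective_iff_map_eq_zero]
    rintro ⟨h, q⟩ h0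
    obtain ⟨h1, h2⟩ := Prod.ext_iff.1 h0
    have h1' : k h - Φ.bT B q = 0 := h1
    have h2' : Φ.b B h = 0 := h2
    have e : k h h = 0 := by
      have := congrArg (fun F => F h) h1'
      simpa [bT_eq, h2'] using this
    have hh : h = 0 := by
      have := hk h
      rw [e] at this
      have h3 : ‖h‖ ^ 2 ≤ 0 := nonpos_of_mul_nonpos_right this hα
      exact norm_eq_zero.1 (pow_eq_zero_iff two_ne_zero |>.1 (le_antisymm h3 (by positivity)))
    subst hh
    rw [map_zero, zero_sub, neg_eq_zero] at h1'
    have h3 := hB q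
    rw [h1', norm_zero] at h3
    rw [norm_le_zero_iff.1 (nonpos_of_mul_nonpos_right h3 hβ)]
    rfl
  · rintro ⟨F, G⟩
    obtain ⟨h, q, h1, h2⟩ := exists_saddle hα hk hβ hB F G
    exact ⟨(h, q), Prod.ext h1 h2⟩

/-- Small solutions depend smoothly on the parameter if the data do. By the implicit function
theorem there is a smooth local branch of solutions, and uniqueness of small solutions identifies
it with the given family. -/
theorem contDiffOn_of_isSol [CompleteSpace X] {E : Type*} [NormedAddCommGroup E]
    [NormedSpace ℝ E] {U : Set E} {A B M : E → X} {f : E → H →L[ℝ] ℝ} {G : E → L →L[ℝ] ℝ}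
    (hA : ∀ y ∈ U, ∀ v, α * ‖v‖ ^ 2 ≤ Φ.a (A y) v v) (hM : ∀ y ∈ U, Φ.κ * ‖M y‖ ≤ m₀ / 2)
    (hβ : 0 < β) (hB : ∀ y ∈ U, ∀ q, β * ‖q‖ ≤ ‖Φ.bT (B y) q‖)
    (hγα : m₀ * γ < α) (hm₀ : 0 < m₀)
    (hAs : ContDiffOn ℝ ∞ A U) (hBs : ContDiffOn ℝ ∞ B U) (hMs : ContDiffOn ℝ ∞ M U)
    (hfs : ContDiffOn ℝ ∞ f U) (hGs : ContDiffOn ℝ ∞ G U) {u : E → H} {p : E → L}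
    (hsol : ∀ y ∈ U, Φ.IsSol (A y) (B y) (M y) (f y) (G y) (u y) (p y) ∧ ‖u y‖ ≤ γ) :
    ContDiffOn ℝ ∞ (fun y => (u y, p y)) U := by
  intro y₀ hy₀
  set dat : E → X × X × X × (H →L[ℝ] ℝ) × (L →L[ℝ] ℝ) := fun y => (A y, B y, M y, f y, G y)
    with hdat
  have hdats : ContDiffWithinAt ℝ ∞ dat U y₀ :=
    (hAs y₀ hy₀).prodMk ((hBs y₀ hy₀).prodMk ((hMs y₀ hy₀).prodMk
      ((hfs y₀ hy₀).prodMk (hGs y₀ hy₀))))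
  have hc := Φ.contDiff_residual.contDiffAt (x := (dat y₀, u y₀, p y₀))
  have hγ0 := (hsol y₀ hy₀).2
  have hcoer : 0 < α - m₀ / 2 * (‖u y₀‖ + ‖u y₀‖) := by nlinarith
  have hinv : (fderiv ℝ Φ.residual (dat y₀, u y₀, p y₀) ∘L
      ContinuousLinearMap.inr ℝ (X × X × X × (H →L[ℝ] ℝ) × (L →L[ℝ] ℝ)) (H × L)).IsInvertible := by
    rw [hdat, fderiv_residual_comp_inr]
    have hbij := bijective_linearization (Φ := Φ) hβ (hB y₀ hy₀) hcoer
      (coercive_linearization (hA y₀ hy₀) (hM y₀ hy₀) (u y₀) (u y₀))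
    exact ⟨ContinuousLinearEquiv.ofBijective _ (LinearMap.ker_eq_bot.2 hbij.1)
      (LinearMap.range_eq_top.2 hbij.2), ContinuousLinearEquiv.coe_ofBijective _ _ _⟩
  have hn : (∞ : WithTop ℕ∞) ≠ 0 := by simp
  set ψ := hc.implicitFunction hn hinv with hψ
  have hψs : ContDiffAt ℝ ∞ ψ (dat y₀) := hc.contDiffAt_implicitFunction hn hinv
  have hψ0 : ψ (dat y₀) = (u y₀, p y₀) := hc.implicitFunction_apply_self hn hinv
  have hev : ∀ᶠ x in 𝓝 (dat y₀), Φ.residual (x, ψ x) = 0 := by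
    have := hc.eventually_apply_implicitFunction hn hinv
    rw [show Φ.residual (dat y₀, u y₀, p y₀) = 0 from residual_eq_zero_iff.2 (hsol y₀ hy₀).1]
      at this
    exact this
  have hsmall : ∀ᶠ x in 𝓝 (dat y₀), m₀ / 2 * (γ + ‖(ψ x).1‖) < α := by
    have hcont : ContinuousAt (fun x => m₀ / 2 * (γ + ‖(ψ x).1‖)) (dat y₀) := by
      have := hψs.continuousAt
      fun_prop
    refine hcont.eventually_lt continuousAt_const ?_
    rw [hψ0]
    nlinarith
  have heq : (fun y => (u y, p y)) =ᶠ[𝓝[U] y₀] ψ ∘ dat := by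
    filter_upwards [hdats.continuousWithinAt.eventually hev,
      hdats.continuousWithinAt.eventually hsmall, self_mem_nhdsWithin] with y h1 h2 hy
    have hs : Φ.IsSol (A y) (B y) (M y) (f y) (G y) (ψ (dat y)).1 (ψ (dat y)).2 :=
      residual_eq_zero_iff.1 h1
    obtain ⟨e1, e2⟩ := IsSol.unique (hA y hy) (hM y hy) hβ (hB y hy) (hsol y hy).1 hs
      (lt_of_le_of_lt (by gcongr; exact (hsol y hy).2) h2)
    exact Prod.ext e1 e2
  exact (hψs.comp_contDiffWithinAt y₀ hdats).congr_of_eventuallyEq heq hψ0.symm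

end SaddleForms

/-! ### Inequalities between the constants -/

namespace Consts

/-- Sign conditions and the elementary relations between the constants that the estimates use. The
relation `2 α ≤ ā` follows from coercivity and boundedness of `a` as soon as `H ≠ 0`. -/
structure Admissible (c : Consts) : Prop where
  a_pos : 0 < c.a
  b_pos : 0 < c.b
  m_pos : 0 < c.m
  α_pos : 0 < c.α
  β_pos : 0 < c.β
  γ_pos : 0 < c.γ
  f_nonneg : 0 ≤ c.f
  g_nonneg : 0 ≤ c.g
  mγ_lt : c.m * c.γ < c.α
  two_α_le : 2 * c.α ≤ c.a
  radius : c.f / (2 * c.α) + c.g / (2 * c.β) + c.m / (2 * c.α) * c.γ ^ 2 = c.γ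

/-- `f̄ + b̄ p̄ + γ (ā + m̄ γ)`. -/
def F₀ (c : Consts) : ℝ := c.f + c.b * c.pbar + c.γ * (c.a + c.m * c.γ)

/-- `(ḡ + b̄ γ) / β`. -/
def G₀ (c : Consts) : ℝ := (c.g + c.b * c.γ) / c.β

theorem ρu_le (c : Consts) : c.ρu ≤ c.ρ := le_max_of_le_right (le_max_left _ _)

variable {c : Consts}

namespace Admissible

variable (h : c.Admissible)
include h

theorem αt_pos : 0 < c.αt := sub_pos.2 h.mγ_lt

theorem β_mul_pbar : c.β * c.pbar = c.f / 2 + c.a * c.γ / 2 + c.m * c.γ ^ 2 / 2 := by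
  have := h.β_pos
  rw [pbar, ← mul_assoc, mul_one_div_cancel this.ne', one_mul]

theorem pbar_pos : 0 < c.pbar := by
  have := h.a_pos; have := h.m_pos; have := h.γ_pos; have := h.f_nonneg; have := h.β_pos
  unfold pbar
  positivity

theorem G₀_nonneg : 0 ≤ c.G₀ := by
  have := h.b_pos; have := h.γ_pos; have := h.g_nonneg; have := h.β_pos
  unfold G₀
  positivity

theorem F₀_pos : 0 < c.F₀ := by
  have := h.a_pos; have := h.m_pos; have := h.γ_pos; have := h.f_nonneg; have := h.b_pos
  have := h.pbar_pos
  unfold F₀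
  positivity

/-- The definition of `σ_u` without denominators. -/
theorem αt_mul_Cu : c.αt * c.Cu = c.F₀ + c.m * c.γ * c.G₀ + c.αt * c.G₀ := by
  have h1 := h.αt_pos.ne'
  have h2 := h.γ_pos.ne'
  have h3 := h.β_pos.ne'
  simp only [Cu, σu, F₀, G₀]
  field_simp
  ring

theorem Cu_pos : 0 < c.Cu := by
  have h1 := h.αt_mul_Cu
  have h2 : 0 < c.αt * c.Cu := by
    rw [h1]
    have := h.F₀_pos; have := h.G₀_nonneg; have := h.m_pos; have := h.γ_pos; have := h.αt_pos
    positivity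
  exact pos_of_mul_pos_right h2 h.αt_pos.le

/-- The definition of `σ_p` without denominators. -/
theorem β_mul_Cp : c.β * c.Cp = c.F₀ + (c.a / 2 + c.m * c.γ) * c.Cu := by
  have h3 := h.β_pos.ne'
  have h4 := h.pbar_pos.ne'
  simp only [Cp, σp, F₀, Cu]
  field_simp
  ring

theorem Cp_pos : 0 < c.Cp := by
  have h2 : 0 < c.β * c.Cp := by
    rw [h.β_mul_Cp]
    have := h.F₀_pos; have := h.Cu_pos; have := h.m_pos; have := h.γ_pos; have := h.a_pos
    positivity
  exact pos_of_mul_pos_right h2 h.β_pos.le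

/-- The definition of `ρ_u` without denominators. -/
theorem αt_mul_Cu_mul_ρu : c.αt * (c.Cu * c.ρu) =
    (c.αt + c.m * c.γ) * (c.G₀ + 2 * (c.b * c.Cu / c.β)) + (c.F₀ + 2 * c.Cp * c.b) +
      (2 * c.a + 4 * c.m * c.γ + 7 * c.m * c.Cu) * c.Cu := by
  have h1 := h.αt_pos.ne'
  have h3 := h.β_pos.ne'
  have h4 := h.Cu_pos.ne'
  simp only [ρu, G₀, F₀]
  generalize c.Cu = x at *
  generalize c.Cp = z at *
  field_simp

/-- Since `α̃ ≤ α ≤ ā / 2`, the term `2 ā / α̃` of `ρ_u` is at least `4`. -/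
theorem four_le_ρu : 4 ≤ c.ρu := by
  have h0 := h.αt_pos
  have := h.Cu_pos; have := h.Cp_pos; have := h.m_pos; have := h.γ_pos; have := h.a_pos
  have := h.F₀_pos; have := h.G₀_nonneg; have := h.b_pos; have := h.β_pos
  have h2 : 2 * c.a * c.Cu ≤ c.αt * (c.Cu * c.ρu) := by
    rw [h.αt_mul_Cu_mul_ρu]
    have e : 0 ≤ (c.αt + c.m * c.γ) * (c.G₀ + 2 * (c.b * c.Cu / c.β)) + (c.F₀ + 2 * c.Cp * c.b) +
      (4 * c.m * c.γ + 7 * c.m * c.Cu) * c.Cu := by positivity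
    linarith
  have h3 : 2 * c.a ≤ c.αt * c.ρu := by
    refine le_of_mul_le_mul_right ?_ h.Cu_pos
    linarith
  have h4 : 4 * c.αt ≤ 2 * c.a := by
    have := h.two_α_le
    have : c.αt ≤ c.α := by
      have : 0 < c.m * c.γ := by positivity
      unfold αt; linarith
    linarith
  refine le_of_mul_le_mul_left ?_ h0
  linarith

theorem four_le_ρ : 4 ≤ c.ρ := h.four_le_ρu.trans c.ρu_le

/-- This inequality makes up for the fact that the lifting of the divergence data is orthogonal to
the kernel of `b` in `H` and not with respect to `a`. -/
theorem half_a_mul_G₀_le : c.a / 2 * c.G₀ ≤ c.a * c.γ + c.b * c.pbar := by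
  have ha := h.a_pos; have hb := h.b_pos; have hm := h.m_pos; have hγ := h.γ_pos
  have hβ := h.β_pos; have hα := h.α_pos; have hf := h.f_nonneg
  have h1 : c.g / (2 * c.β) ≤ c.γ := by
    have h2 : 0 ≤ c.f / (2 * c.α) := by positivity
    have h3 : 0 ≤ c.m / (2 * c.α) * c.γ ^ 2 := by positivity
    linarith [h.radius]
  have h2 : c.a * c.γ / (2 * c.β) ≤ c.pbar := by
    rw [div_le_iff₀ (by positivity)]
    have := h.β_mul_pbar
    have : 0 ≤ c.m * c.γ ^ 2 := by positivity
    linarith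
  have e : c.a / 2 * c.G₀ = c.a * (c.g / (2 * c.β)) + c.b * (c.a * c.γ / (2 * c.β)) := by
    unfold G₀
    field_simp
  rw [e]
  gcongr

theorem F₀_ge : c.a * c.γ + c.b * c.pbar ≤ c.F₀ := by
  have := h.m_pos; have := h.γ_pos; have := h.f_nonneg
  have : 0 ≤ c.m * c.γ ^ 2 := by positivity
  unfold F₀
  nlinarith

/-- The velocity estimate for first derivatives. -/
theorem velocity_first :
    c.G₀ / 4 + (c.F₀ / 4 + (c.a / 2 + c.m * c.γ) * (c.G₀ / 4)) / c.αt ≤ c.Cu / 2 := by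
  have h0 := h.αt_pos
  have h1 := h.half_a_mul_G₀_le.trans h.F₀_ge
  have h2 := h.αt_mul_Cu
  have h3 := h.G₀_nonneg
  have h4 : 0 ≤ c.m * c.γ * c.G₀ := by
    have := h.m_pos; have := h.γ_pos; positivity
  have h5 : 0 ≤ c.αt * c.G₀ := by positivity
  rw [← le_sub_iff_add_le', div_le_iff₀ h0]
  linarith

/-- The pressure estimate for first derivatives. -/
theorem pressure_first :
    c.F₀ / 4 + (c.a / 2 + c.m * c.γ) * (c.Cu / 2) ≤ c.β * (c.Cp / 2) := by
  have := h.β_mul_Cp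
  have := h.F₀_pos
  linarith

/-- The velocity estimate for derivatives of higher order. -/
theorem velocity_higher :
    (c.G₀ + c.b * c.Cu / c.β) +
      ((c.F₀ + c.a * c.Cu + c.b * c.Cp + c.m * (2 * c.γ * c.Cu + 3 / 2 * c.Cu ^ 2)) +
        (c.a / 2 + c.m * c.γ) * (c.G₀ + c.b * c.Cu / c.β)) / c.αt ≤ c.Cu * c.ρu := by
  have h0 := h.αt_pos
  have ha := h.a_pos; have hb := h.b_pos; have hm := h.m_pos; have hγ := h.γ_pos
  have hCu := h.Cu_pos; have hCp := h.Cp_pos; have hβ := h.β_pos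
  have h1 := h.half_a_mul_G₀_le.trans h.F₀_ge
  have h2 := h.αt_mul_Cu
  have h3 := h.G₀_nonneg
  have h4 : 0 ≤ c.m * c.γ * c.G₀ := by positivity
  have h5 : 0 ≤ c.αt * c.G₀ := by positivity
  have h6 : c.αt * c.Cu ≤ c.a * c.Cu := by
    refine mul_le_mul_of_nonneg_right ?_ hCu.le
    have : 0 < c.m * c.γ := by positivity
    have := h.two_α_le
    have := h.α_pos
    unfold αt
    linarith
  have h7 : c.a / 2 * (c.b * c.Cu / c.β) ≤ c.b * c.Cp := by
    have : c.a / 2 * c.Cu / c.β ≤ c.Cp := by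
      rw [div_le_iff₀ hβ, mul_comm c.Cp, h.β_mul_Cp]
      have := h.F₀_pos
      have : 0 < c.m * c.γ * c.Cu := by positivity
      linarith
    calc c.a / 2 * (c.b * c.Cu / c.β) = c.b * (c.a / 2 * c.Cu / c.β) := by ring
      _ ≤ c.b * c.Cp := by gcongr
  have h8 := h.αt_mul_Cu_mul_ρu
  have h9 : 0 ≤ c.b * c.Cu / c.β := by positivity
  have h10 : 0 ≤ c.m * c.γ * (c.b * c.Cu / c.β) := by positivity
  have h11 : 0 ≤ c.αt * (c.b * c.Cu / c.β) := by positivity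
  have h12 : 0 ≤ c.m * c.γ * c.Cu := by positivity
  have h13 : 0 ≤ c.m * c.Cu ^ 2 := by positivity
  rw [← le_sub_iff_add_le', div_le_iff₀ h0]
  generalize c.b * c.Cu / c.β = Y at *
  nlinarith

/-- The pressure estimate for derivatives of higher order; already `ρ_u` is large enough for it. -/
theorem pressure_higher :
    (c.F₀ + c.a * c.Cu + c.b * c.Cp + c.m * (2 * c.γ * c.Cu + 3 / 2 * c.Cu ^ 2)) +
      (c.a / 2 + c.m * c.γ) * (c.Cu * c.ρu) ≤ c.β * (c.Cp * c.ρu) := by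
  have h0 := h.αt_pos
  have ha := h.a_pos; have hm := h.m_pos; have hγ := h.γ_pos; have hCu := h.Cu_pos
  have hb := h.b_pos; have hβ := h.β_pos; have hCp := h.Cp_pos; have hF := h.F₀_pos
  have hG := h.G₀_nonneg
  set R := c.a * c.Cu + c.b * c.Cp + c.m * (2 * c.γ * c.Cu + 3 / 2 * c.Cu ^ 2) with hR
  -- `α G₀ ≤ F₀`, hence `α̃ C_u ≤ 2 F₀`
  have h1 : c.αt * c.Cu ≤ 2 * c.F₀ := by
    have e1 := h.half_a_mul_G₀_le.trans h.F₀_ge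
    have e2 : c.α * c.G₀ ≤ c.a / 2 * c.G₀ :=
      mul_le_mul_of_nonneg_right (by linarith [h.two_α_le]) hG
    have e3 : c.m * c.γ * c.G₀ + c.αt * c.G₀ = c.α * c.G₀ := by unfold αt; ring
    linarith [h.αt_mul_Cu]
  have h2 : c.αt * c.Cu + 2 * R ≤ c.αt * (c.Cu * c.ρu) := by
    rw [h.αt_mul_Cu_mul_ρu, h.αt_mul_Cu]
    have e1 : 0 ≤ (c.αt + c.m * c.γ) * (c.b * c.Cu / c.β) := by positivity
    have e2 : 0 ≤ c.m * c.Cu ^ 2 := by positivity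
    rw [hR]
    nlinarith
  have hR0 : 0 ≤ R := by positivity
  have hW : 0 < c.αt * c.Cu := by positivity
  have h3 : c.F₀ + R ≤ c.F₀ * c.ρu := by
    refine le_of_mul_le_mul_left ?_ hW
    calc c.αt * c.Cu * (c.F₀ + R) = c.F₀ * (c.αt * c.Cu) + c.αt * c.Cu * R := by ring
      _ ≤ c.F₀ * (c.αt * c.Cu) + 2 * c.F₀ * R := by gcongr
      _ = c.F₀ * (c.αt * c.Cu + 2 * R) := by ring
      _ ≤ c.F₀ * (c.αt * (c.Cu * c.ρu)) := by gcongr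
      _ = c.αt * c.Cu * (c.F₀ * c.ρu) := by ring
  have h4 : c.β * (c.Cp * c.ρu) = c.F₀ * c.ρu + (c.a / 2 + c.m * c.γ) * (c.Cu * c.ρu) := by
    rw [← mul_assoc, h.β_mul_Cp]; ring
  rw [h4]
  linarith

end Admissible

end Consts

/-! ### Estimates for the derivatives of the solution -/

section estimates

variable {X H L E ι : Type*} [NormedAddCommGroup X] [NormedSpace ℝ X]
  [NormedAddCommGroup H] [InnerProductSpace ℝ H] [NormedAddCommGroup L] [InnerProductSpace ℝ L]
  [NormedAddCommGroup E] [NormedSpace ℝ E]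

/-- The majorant of a solution component with norm at most `x₀` and derivatives of relative size
`x₁`. -/
def fullSolSeq (x₀ x₁ ρ : ℝ) (k : ℕ) : ℝ := x₀ * unitSeq k + x₁ * solSeq ρ k

theorem fullSolSeq_nonneg {x₀ x₁ ρ : ℝ} (h₀ : 0 ≤ x₀) (h₁ : 0 ≤ x₁) (hρ : 0 ≤ ρ) (k : ℕ) :
    0 ≤ fullSolSeq x₀ x₁ ρ k := by
  have : 0 ≤ unitSeq k := by unfold unitSeq; split_ifs <;> norm_num
  have := solSeq_nonneg hρ k
  unfold fullSolSeq
  positivity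

theorem binConv_fullSolSeq (φ : ℕ → ℝ) (x₀ x₁ ρ : ℝ) (n : ℕ) :
    binConv φ (fullSolSeq x₀ x₁ ρ) n = x₀ * φ n + x₁ * binConv φ (solSeq ρ) n := by
  have h := binConv_add_right φ unitSeq (solSeq ρ) x₀ x₁ n
  rwa [binConv_unitSeq] at h

theorem Majorizes.data_sub {U : Set E} {e : ι → E} {y : E} {l : List ι} {N : ℕ} {t x : ℝ}
    {F : E → X} (hU : UniqueDiffOn ℝ U) (hy : y ∈ U) (hF : ContDiffOn ℝ ∞ F U)
    (h : Majorizes U e y l N t F fun k => x * ((k.factorial : ℝ) / 2 ^ k)) :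
    Majorizes U e y l N t (fun z => F z - F y) fun k => x * dataSeq k := by
  intro l' hl' hN
  refine (h.sub_self hU hy hF l' hl' hN).trans (le_of_eq ?_)
  simp only [dataSeq]
  split_ifs <;> simp

theorem Majorizes.sol_sub {U : Set E} {e : ι → E} {y : E} {l : List ι} {N : ℕ} {t x₀ x₁ ρ : ℝ}
    {F : E → X} (hU : UniqueDiffOn ℝ U) (hy : y ∈ U) (hF : ContDiffOn ℝ ∞ F U)
    (h : Majorizes U e y l N t F (fullSolSeq x₀ x₁ ρ)) :
    Majorizes U e y l N t (fun z => F z - F y) fun k => x₁ * solSeq ρ k := by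
  intro l' hl' hN
  refine (h.sub_self hU hy hF l' hl' hN).trans (le_of_eq ?_)
  simp only [fullSolSeq, unitSeq, solSeq]
  split_ifs <;> simp

/-- The data are smooth on `U`, and at the point `y` their derivatives along sublists of `l` have
the Gevrey bounds; the weight `(k!)^t` is split off. -/
structure DataBounds (Φ : SaddleForms X H L) (c : Consts) (U : Set E) (e : ι → E) (y : E)
    (l : List ι) (t : ℝ) (A B M : E → X) (f : E → H →L[ℝ] ℝ) (G : E → L →L[ℝ] ℝ) : Prop where
  A_smooth : ContDiffOn ℝ ∞ A U
  B_smooth : ContDiffOn ℝ ∞ B U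
  M_smooth : ContDiffOn ℝ ∞ M U
  f_smooth : ContDiffOn ℝ ∞ f U
  G_smooth : ContDiffOn ℝ ∞ G U
  A_maj : Majorizes U e y l (l.length + 1) t A fun k => c.a / 2 * ((k.factorial : ℝ) / 2 ^ k)
  B_maj : Majorizes U e y l (l.length + 1) t B fun k => c.b / 2 * ((k.factorial : ℝ) / 2 ^ k)
  M_maj : Majorizes U e y l (l.length + 1) t M fun k =>
    Φ.κ⁻¹ * (c.m / 2) * ((k.factorial : ℝ) / 2 ^ k)
  f_maj : Majorizes U e y l (l.length + 1) t f fun k => c.f / 2 * ((k.factorial : ℝ) / 2 ^ k)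
  G_maj : Majorizes U e y l (l.length + 1) t G fun k => c.g / 2 * ((k.factorial : ℝ) / 2 ^ k)

variable {Φ : SaddleForms X H L} {c : Consts} {U : Set E} {e : ι → E} {y : E} {l : List ι}
  {t : ℝ} {A B M : E → X} {f : E → H →L[ℝ] ℝ} {G : E → L →L[ℝ] ℝ} {u : E → H} {p : E → L}

/-- The operator of the problem linearized at `u`. -/
def SaddleForms.linearization (Φ : SaddleForms X H L) (A M : X) (u : H) : H →L[ℝ] H →L[ℝ] ℝ :=
  Φ.a A + Φ.m M u + (Φ.m M).flip u

theorem SaddleForms.linearization_apply (A M : X) (u v : H) :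
    Φ.linearization A M u v = Φ.a A v + Φ.m M u v + Φ.m M v u := rfl

/-- The second equation, differentiated: the derivative of `u` solves the divergence equation with a
right-hand side that contains only lower derivatives. -/
theorem norm_divergence_le (hc : c.Admissible) (ht : 0 ≤ t) (hU : UniqueDiffOn ℝ U) (hy : y ∈ U)
    (hd : DataBounds Φ c U e y l t A B M f G) (hl : l ≠ [])
    (hu : ContDiffOn ℝ ∞ u U) (hsol : ∀ z ∈ U, Φ.b (B z) (u z) = G z)
    (hum : Majorizes U e y l l.length t u (fullSolSeq c.γ c.Cu c.ρ)) :
    ‖Φ.b (B y) (iterDir U e l u y)‖ ≤ (l.length.factorial : ℝ) ^ t *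
      (c.g / 2 * dataSeq l.length + c.b / 2 * (c.γ * dataSeq l.length +
        c.Cu * binConv dataSeq (solSeq c.ρ) l.length)) := by
  have hρ : 0 ≤ c.ρ := by linarith [hc.four_le_ρ]
  have hn : l.length ≠ 0 := by simpa using hl
  have hBs : ContDiffOn ℝ ∞ (fun z => B z - B y) U := hd.B_smooth.sub contDiffOn_const
  have hN : ContDiffOn ℝ ∞ (fun z => Φ.b (B z - B y) (u z)) U := contDiffOn_bilin hBs hu Φ.b
  have hEq : EqOn (fun z => Φ.b (B y) (u z)) (fun z => G z - Φ.b (B z - B y) (u z)) U := by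
    intro z hz
    simp only [map_sub, sub_apply, hsol z hz]
    abel
  have h1 := (iterDir_clm (e := e) hU hu (Φ.b (B y)) l hy).symm.trans
    ((iterDir_congr hEq l hy).trans (iterDir_sub hU hd.G_smooth hN l hy))
  simp only at h1
  rw [h1, mul_add]
  refine (norm_sub_le _ _).trans (add_le_add ?_ ?_)
  · refine (hd.G_maj l (List.Sublist.refl l) (Nat.lt_succ_self _)).trans (le_of_eq ?_)
    simp only [dataSeq, hn, if_false]
  · refine (norm_iterDir_bilin_le_of_vanish hU hy Φ.b zero_le_one
      (fun x x' => by rw [one_mul]; exact Φ.norm_b_le x x') ht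
      (fun k => mul_nonneg (half_pos hc.b_pos).le (dataSeq_nonneg k))
      (fullSolSeq_nonneg hc.γ_pos.le hc.Cu_pos.le hρ) hBs hu (by simp [dataSeq])
      (hd.B_maj.data_sub hU hy hd.B_smooth) hum).trans (le_of_eq ?_)
    rw [one_mul, binConv_smul_left, binConv_fullSolSeq]

/-- The first equation, differentiated: the derivatives of `u` and `p` solve the linearized
equation with a right-hand side that contains only lower derivatives. -/
theorem norm_momentum_le (hc : c.Admissible) (ht : 0 ≤ t) (hU : UniqueDiffOn ℝ U) (hy : y ∈ U)
    (hd : DataBounds Φ c U e y l t A B M f G) (hl : l ≠ []) (hMy : Φ.κ * ‖M y‖ ≤ c.m / 2)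
    (hu : ContDiffOn ℝ ∞ u U) (hp : ContDiffOn ℝ ∞ p U)
    (hsol : ∀ z ∈ U, Φ.a (A z) (u z) + Φ.m (M z) (u z) (u z) - Φ.bT (B z) (p z) = f z)
    (hum : Majorizes U e y l l.length t u (fullSolSeq c.γ c.Cu c.ρ))
    (hpm : Majorizes U e y l l.length t p (fullSolSeq c.pbar c.Cp c.ρ)) :
    ‖Φ.linearization (A y) (M y) (u y) (iterDir U e l u y) - Φ.bT (B y) (iterDir U e l p y)‖ ≤
      (l.length.factorial : ℝ) ^ t *
      (c.f / 2 * dataSeq l.length +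
        (c.a / 2 * (c.γ * dataSeq l.length + c.Cu * binConv dataSeq (solSeq c.ρ) l.length) +
        c.m / 2 * (c.γ * (c.γ * dataSeq l.length +
            c.Cu * binConv dataSeq (solSeq c.ρ) l.length) +
          c.Cu * (c.γ * binConv dataSeq (solSeq c.ρ) l.length +
            c.Cu * binConv (binConv dataSeq (solSeq c.ρ)) (solSeq c.ρ) l.length)) +
        c.m / 2 * (c.Cu * (c.Cu * binConv (solSeq c.ρ) (solSeq c.ρ) l.length))) +
        c.b / 2 * (c.pbar * dataSeq l.length +
          c.Cp * binConv dataSeq (solSeq c.ρ) l.length)) := by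
  have hρ : 0 ≤ c.ρ := by linarith [hc.four_le_ρ]
  have hn : l.length ≠ 0 := by simpa using hl
  have hu0 := fullSolSeq_nonneg hc.γ_pos.le hc.Cu_pos.le hρ
  have hm0 := (half_pos hc.m_pos).le
  have hAs : ContDiffOn ℝ ∞ (fun z => A z - A y) U := hd.A_smooth.sub contDiffOn_const
  have hBs : ContDiffOn ℝ ∞ (fun z => B z - B y) U := hd.B_smooth.sub contDiffOn_const
  have hMs : ContDiffOn ℝ ∞ (fun z => M z - M y) U := hd.M_smooth.sub contDiffOn_const
  have hus : ContDiffOn ℝ ∞ (fun z => u z - u y) U := hu.sub contDiffOn_const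
  have hN1 : ContDiffOn ℝ ∞ (fun z => Φ.a (A z - A y) (u z)) U := contDiffOn_bilin hAs hu Φ.a
  have hN2' : ContDiffOn ℝ ∞ (fun z => Φ.m (M z - M y) (u z)) U := contDiffOn_bilin hMs hu Φ.m
  have hN2 : ContDiffOn ℝ ∞ (fun z => Φ.m (M z - M y) (u z) (u z)) U := hN2'.clm_apply hu
  have hN3 : ContDiffOn ℝ ∞ (fun z => Φ.m (M y) (u z - u y) (u z - u y)) U :=
    contDiffOn_bilin hus hus (Φ.m (M y))
  have hN4 : ContDiffOn ℝ ∞ (fun z => Φ.bT (B z - B y) (p z)) U := contDiffOn_bilin hBs hp Φ.bT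
  set k := Φ.linearization (A y) (M y) (u y) with hk
  -- the equation linearized at `y`: every remaining product has a factor that vanishes at `y`
  have hEq : EqOn (fun z => k (u z) - Φ.bT (B y) (p z))
      (fun z => f z + Φ.m (M y) (u y) (u y) -
        (Φ.a (A z - A y) (u z) + Φ.m (M z - M y) (u z) (u z) +
          Φ.m (M y) (u z - u y) (u z - u y)) + Φ.bT (B z - B y) (p z)) U := by
    intro z hz
    simp only [hk, SaddleForms.linearization_apply, ← hsol z hz, map_sub, sub_apply]
    abel
  have hfc : ContDiffOn ℝ ∞ (fun z => f z + Φ.m (M y) (u y) (u y)) U :=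
    hd.f_smooth.add contDiffOn_const
  have h0 : k (iterDir U e l u y) - Φ.bT (B y) (iterDir U e l p y) =
      iterDir U e l f y - (iterDir U e l (fun z => Φ.a (A z - A y) (u z)) y +
        iterDir U e l (fun z => Φ.m (M z - M y) (u z) (u z)) y +
        iterDir U e l (fun z => Φ.m (M y) (u z - u y) (u z - u y)) y) +
        iterDir U e l (fun z => Φ.bT (B z - B y) (p z)) y := by
    have e1 := iterDir_clm (e := e) hU hu k l hy
    have e2 := iterDir_clm (e := e) hU hp (Φ.bT (B y)) l hy
    have e3 := iterDir_sub (e := e) hU (contDiffOn_bilin contDiffOn_const hu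
      (ContinuousLinearMap.id ℝ (H →L[ℝ] H →L[ℝ] ℝ)) (F := fun _ => k))
      (contDiffOn_bilin contDiffOn_const hp
      (ContinuousLinearMap.id ℝ (L →L[ℝ] H →L[ℝ] ℝ)) (F := fun _ => Φ.bT (B y))) l hy
    have e4 := iterDir_congr (e := e) hEq l hy
    have e5 := iterDir_add (e := e) hU (hfc.sub ((hN1.add hN2).add hN3)) hN4 l hy
    have e6 := iterDir_sub (e := e) hU hfc ((hN1.add hN2).add hN3) l hy
    have e7 := iterDir_add (e := e) hU hd.f_smooth
      (contDiffOn_const (c := Φ.m (M y) (u y) (u y))) l hy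
    have e8 := iterDir_add (e := e) hU (hN1.add hN2) hN3 l hy
    have e9 := iterDir_add (e := e) hU hN1 hN2 l hy
    simp only [ContinuousLinearMap.id_apply, iterDir_const _ hl, add_zero]
      at e1 e2 e3 e4 e5 e6 e7 e8 e9
    rw [← e1, ← e2, ← e3, e4, e5, e6, e7, e8, e9]
  rw [h0]
  have b0 : ‖iterDir U e l f y‖ ≤ (l.length.factorial : ℝ) ^ t * (c.f / 2 * dataSeq l.length) := by
    refine (hd.f_maj l (List.Sublist.refl l) (Nat.lt_succ_self _)).trans (le_of_eq ?_)
    simp only [dataSeq, hn, if_false]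
  have b1 : ‖iterDir U e l (fun z => Φ.a (A z - A y) (u z)) y‖ ≤
      (l.length.factorial : ℝ) ^ t * (c.a / 2 * (c.γ * dataSeq l.length +
        c.Cu * binConv dataSeq (solSeq c.ρ) l.length)) := by
    refine (norm_iterDir_bilin_le_of_vanish hU hy Φ.a zero_le_one
      (fun x x' => by rw [one_mul]; exact Φ.norm_a_le x x') ht
      (fun k => mul_nonneg (half_pos hc.a_pos).le (dataSeq_nonneg k)) hu0 hAs hu
      (by simp [dataSeq]) (hd.A_maj.data_sub hU hy hd.A_smooth) hum).trans (le_of_eq ?_)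
    rw [one_mul, binConv_smul_left, binConv_fullSolSeq]
  have b4 : ‖iterDir U e l (fun z => Φ.bT (B z - B y) (p z)) y‖ ≤
      (l.length.factorial : ℝ) ^ t * (c.b / 2 * (c.pbar * dataSeq l.length +
        c.Cp * binConv dataSeq (solSeq c.ρ) l.length)) := by
    refine (norm_iterDir_bilin_le_of_vanish hU hy Φ.bT zero_le_one
      (fun x x' => by rw [one_mul]; exact Φ.norm_bT_le x x') ht
      (fun k => mul_nonneg (half_pos hc.b_pos).le (dataSeq_nonneg k))
      (fullSolSeq_nonneg hc.pbar_pos.le hc.Cp_pos.le hρ) hBs hp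
      (by simp [dataSeq]) (hd.B_maj.data_sub hU hy hd.B_smooth) hpm).trans (le_of_eq ?_)
    rw [one_mul, binConv_smul_left, binConv_fullSolSeq]
  have b3 : ‖iterDir U e l (fun z => Φ.m (M y) (u z - u y) (u z - u y)) y‖ ≤
      (l.length.factorial : ℝ) ^ t * (c.m / 2 * (c.Cu * (c.Cu *
        binConv (solSeq c.ρ) (solSeq c.ρ) l.length))) := by
    have hs0 : ∀ k, 0 ≤ c.Cu * solSeq c.ρ k := fun k =>
      mul_nonneg hc.Cu_pos.le (solSeq_nonneg hρ k)
    have hsm := hum.sol_sub hU hy hu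
    refine (norm_iterDir_bilin_le_of_vanish_both hU hy (Φ.m (M y)) hm0
      (fun x x' => SaddleForms.norm_m_le' hMy x x') hl ht hs0 hs0 hus hus (by simp [solSeq])
      (by simp [solSeq]) hsm hsm).trans (le_of_eq ?_)
    rw [binConv_smul_left, binConv_smul_right]
  have b2 : ‖iterDir U e l (fun z => Φ.m (M z - M y) (u z) (u z)) y‖ ≤
      (l.length.factorial : ℝ) ^ t * (c.m / 2 * (c.γ * (c.γ * dataSeq l.length +
            c.Cu * binConv dataSeq (solSeq c.ρ) l.length) +
          c.Cu * (c.γ * binConv dataSeq (solSeq c.ρ) l.length +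
            c.Cu * binConv (binConv dataSeq (solSeq c.ρ)) (solSeq c.ρ) l.length))) := by
    have hκ := Φ.κ_pos
    have hd0 : ∀ k, 0 ≤ Φ.κ⁻¹ * (c.m / 2) * dataSeq k := fun k =>
      mul_nonneg (mul_nonneg (inv_nonneg.2 hκ.le) hm0) (dataSeq_nonneg k)
    have hS : Majorizes U e y l (l.length + 1) t (fun z => Φ.m (M z - M y) (u z)) fun n =>
        Φ.κ * binConv (fun k => Φ.κ⁻¹ * (c.m / 2) * dataSeq k) (fullSolSeq c.γ c.Cu c.ρ) n := by
      refine Majorizes.bilin_of_vanish hU hy Φ.m hκ.le (fun x x' => ?_) ht hd0 hu0 hMs hu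
        (by simp [dataSeq]) (hd.M_maj.data_sub hU hy hd.M_smooth) hum
      refine ContinuousLinearMap.opNorm_le_bound _ (by positivity) fun v => ?_
      exact (Φ.norm_m_le x x' v).trans (le_of_eq (by ring))
    refine (norm_iterDir_bilin_le_of_vanish hU hy
      (ContinuousLinearMap.id ℝ (H →L[ℝ] H →L[ℝ] ℝ)) zero_le_one
      (fun x x' => by rw [one_mul]; exact x.le_opNorm x') ht
      (fun k => mul_nonneg hκ.le (binConv_nonneg hd0 hu0 k)) hu0 hN2' hu
      (by rw [binConv_zero]; simp [dataSeq]) hS hum).trans (le_of_eq ?_)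
    have e : (fun n => Φ.κ * binConv (fun k => Φ.κ⁻¹ * (c.m / 2) * dataSeq k)
        (fullSolSeq c.γ c.Cu c.ρ) n) = fun n => c.m / 2 * (c.γ * dataSeq n +
          c.Cu * binConv dataSeq (solSeq c.ρ) n) := by
      funext n
      rw [binConv_smul_left, binConv_fullSolSeq]
      field_simp
    rw [one_mul, e, binConv_smul_left, binConv_fullSolSeq, binConv_add_left]
  rw [mul_add, mul_add, mul_add, mul_add]
  exact (norm_add_le _ _).trans (add_le_add ((norm_sub_le _ _).trans (add_le_add b0
    ((norm_add_le _ _).trans (add_le_add ((norm_add_le _ _).trans (add_le_add b1 b2)) b3)))) b4)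

variable [CompleteSpace H] [CompleteSpace L]

/-- The induction step: bounds for the derivatives of the solution along `l` from bounds along
shorter lists. -/
theorem norm_derivative_le (hc : c.Admissible) (ht : 0 ≤ t) (hU : UniqueDiffOn ℝ U) (hy : y ∈ U)
    (hd : DataBounds Φ c U e y l t A B M f G) (hl : l ≠ []) (hAy : ‖A y‖ ≤ c.a / 2)
    (hMy : Φ.κ * ‖M y‖ ≤ c.m / 2) (hco : ∀ v, c.α * ‖v‖ ^ 2 ≤ Φ.a (A y) v v)
    (hB : ∀ q, c.β * ‖q‖ ≤ ‖Φ.bT (B y) q‖) (huy : ‖u y‖ ≤ c.γ)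
    (hu : ContDiffOn ℝ ∞ u U) (hp : ContDiffOn ℝ ∞ p U)
    (hsol : ∀ z ∈ U, Φ.IsSol (A z) (B z) (M z) (f z) (G z) (u z) (p z))
    (hum : Majorizes U e y l l.length t u (fullSolSeq c.γ c.Cu c.ρ))
    (hpm : Majorizes U e y l l.length t p (fullSolSeq c.pbar c.Cp c.ρ)) :
    ‖iterDir U e l u y‖ ≤ (l.length.factorial : ℝ) ^ t * (c.Cu * solSeq c.ρ l.length) ∧
    ‖iterDir U e l p y‖ ≤ (l.length.factorial : ℝ) ^ t * (c.Cp * solSeq c.ρ l.length) := by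
  have hdiv := norm_divergence_le hc ht hU hy hd hl hu (fun z hz => (hsol z hz).2) hum
  have hmom := norm_momentum_le hc ht hU hy hd hl hMy hu hp (fun z hz => (hsol z hz).1) hum hpm
  set n := l.length with hn
  have hn0 : 1 ≤ n := List.length_pos_iff.2 hl
  set w : ℝ := (n.factorial : ℝ) ^ t with hw
  have hw0 : 0 ≤ w := by positivity
  have ha := hc.a_pos; have hb := hc.b_pos; have hm := hc.m_pos; have hγ := hc.γ_pos
  have hβ := hc.β_pos; have hαt := hc.αt_pos; have hCu := hc.Cu_pos; have hCp := hc.Cp_pos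
  have hf := hc.f_nonneg; have hg := hc.g_nonneg; have hpb := hc.pbar_pos
  have hρ := hc.four_le_ρ
  set K := c.a / 2 + c.m * c.γ with hK
  have hK0 : 0 ≤ K := by positivity
  set k := Φ.linearization (A y) (M y) (u y) with hk
  have hkc : ∀ v, c.αt * ‖v‖ ^ 2 ≤ k v v := fun v => by
    refine le_trans ?_ (SaddleForms.coercive_linearization hco hMy (u y) (u y) v)
    have : c.m / 2 * (‖u y‖ + ‖u y‖) ≤ c.m * c.γ := by nlinarith
    have : c.αt ≤ c.α - c.m / 2 * (‖u y‖ + ‖u y‖) := by unfold Consts.αt; linarith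
    gcongr
  have hkn : ∀ v, ‖k v‖ ≤ K * ‖v‖ := fun v => by
    rw [hk, SaddleForms.linearization_apply]
    have h1 : ‖Φ.a (A y) v‖ ≤ c.a / 2 * ‖v‖ := (Φ.norm_a_le _ _).trans (by gcongr)
    have h2 : ‖Φ.m (M y) (u y) v‖ ≤ c.m / 2 * (c.γ * ‖v‖) :=
      (SaddleForms.norm_m_le' hMy _ _).trans (by gcongr)
    have h3 : ‖Φ.m (M y) v (u y)‖ ≤ c.m / 2 * (‖v‖ * c.γ) :=
      (SaddleForms.norm_m_le' hMy _ _).trans (by gcongr)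
    refine (norm_add₃_le).trans ?_
    rw [hK]
    linarith
  have hvel := norm_velocity_le (b := Φ.b (B y)) hαt hkc hkn hβ hB
    (F := k (iterDir U e l u y) - Φ.bT (B y) (iterDir U e l p y)) rfl rfl hK0
  have hpre := norm_pressure_le (b := Φ.b (B y)) (β := c.β) (q := iterDir U e l p y)
    (x := k (iterDir U e l u y)) hB rfl
  rw [← SaddleForms.bT_eq] at hpre
  have hpre' := hpre.trans (add_le_add_right (hkn _) _)
  -- it remains to insert bounds `w S₁`, `w S₂` of the right-hand sides
  have hfin : ∀ S₁ S₂ V Q : ℝ,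
      ‖k (iterDir U e l u y) - Φ.bT (B y) (iterDir U e l p y)‖ ≤ w * S₁ →
      ‖Φ.b (B y) (iterDir U e l u y)‖ ≤ w * (c.β * S₂) →
      S₂ + (S₁ + K * S₂) / c.αt ≤ V → S₁ + K * V ≤ c.β * Q →
      ‖iterDir U e l u y‖ ≤ w * V ∧ ‖iterDir U e l p y‖ ≤ w * Q := by
    intro S₁ S₂ V Q h1 h2 h3 h4
    have h2' : ‖Φ.b (B y) (iterDir U e l u y)‖ / c.β ≤ w * S₂ := by
      rw [div_le_iff₀ hβ]; linarith
    have hV : ‖iterDir U e l u y‖ ≤ w * V := by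
      refine hvel.trans ?_
      calc _ ≤ w * S₂ + (w * S₁ + K * (w * S₂)) / c.αt := by gcongr
        _ = w * (S₂ + (S₁ + K * S₂) / c.αt) := by ring
        _ ≤ w * V := by gcongr
    refine ⟨hV, le_of_mul_le_mul_left ?_ hβ⟩
    calc _ ≤ _ := hpre'
      _ ≤ w * S₁ + K * (w * V) := by gcongr
      _ = w * (S₁ + K * V) := by ring
      _ ≤ w * (c.β * Q) := by gcongr
      _ = c.β * (w * Q) := by ring
  have hG₀ : c.β * c.G₀ = c.g + c.b * c.γ := by unfold Consts.G₀; field_simp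
  have hF₀ : c.F₀ = c.f + c.b * c.pbar + c.γ * (c.a + c.m * c.γ) := rfl
  rcases hn0.eq_or_lt with h1 | h2
  -- order one: all convolutions vanish
  · have d1 : dataSeq n = 1 / 2 := by rw [← h1]; norm_num [dataSeq]
    have r1 : solSeq c.ρ n = 1 / 2 := by rw [← h1]; norm_num [solSeq, fallingHalf_one]
    have T0 : binConv dataSeq (solSeq c.ρ) 0 = 0 := by rw [binConv_zero]; simp [solSeq]
    have T1 : binConv dataSeq (solSeq c.ρ) n = 0 := by
      rw [← h1, binConv_dataSeq_solSeq_succ, T0]; simp [solSeq]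
    have R1 : binConv (solSeq c.ρ) (solSeq c.ρ) n = 0 := by
      rw [← h1, binConv_solSeq_solSeq_succ, binConv_zero]; simp [solSeq]
    have V1 : binConv (binConv dataSeq (solSeq c.ρ)) (solSeq c.ρ) n = 0 := by
      rw [← h1, binConv_succ]
      simp [binConv_zero, solSeq]
    rw [T1, d1] at hdiv
    rw [T1, d1, R1, V1] at hmom
    rw [r1]
    refine hfin (c.F₀ / 4) (c.G₀ / 4) _ _ (hmom.trans (mul_le_mul_of_nonneg_left ?_ hw0))
      (hdiv.trans (mul_le_mul_of_nonneg_left ?_ hw0))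
      (hc.velocity_first.trans (by linarith)) (le_trans ?_ (hc.pressure_first.trans ?_))
    · rw [hF₀]; apply le_of_eq; ring
    · apply le_of_eq; linear_combination (-1 / 4) * hG₀
    · apply le_of_eq; ring
    · apply le_of_eq; ring
  -- higher orders: all terms are multiples of `ρ ^ (n - 2) [1/2]_n`
  · have h2' : 2 ≤ n := h2
    set P := c.ρ ^ (n - 2) * fallingHalf n with hP
    have hP0 : 0 ≤ P := mul_nonneg (pow_nonneg (by linarith) _) (fallingHalf_pos _).le
    have d1 : dataSeq n ≤ 2 * P := dataSeq_le_pow (by linarith) h2'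
    have T1 : binConv dataSeq (solSeq c.ρ) n ≤ 2 * P := binConv_dataSeq_solSeq_le hρ h2'
    have R1 : binConv (solSeq c.ρ) (solSeq c.ρ) n = 2 * P := binConv_solSeq_solSeq h2'
    have V1 : binConv (binConv dataSeq (solSeq c.ρ)) (solSeq c.ρ) n ≤ P :=
      binConv_dataSeq_solSeq_solSeq_le hρ h2'
    have r1 : solSeq c.ρ n = c.ρ * P := by
      have hn2 : n ≠ 0 := by omega
      rw [solSeq, if_neg hn2, hP, ← mul_assoc, ← pow_succ']
      congr 2
      omega
    rw [R1] at hmom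
    have hρu : c.ρu * P ≤ c.ρ * P := mul_le_mul_of_nonneg_right c.ρu_le hP0
    have h := hfin
      (P * (c.F₀ + c.a * c.Cu + c.b * c.Cp + c.m * (2 * c.γ * c.Cu + 3 / 2 * c.Cu ^ 2)))
      (P * (c.G₀ + c.b * c.Cu / c.β)) (P * (c.Cu * c.ρu)) (P * (c.Cp * c.ρu))
      (hmom.trans (mul_le_mul_of_nonneg_left ?_ hw0))
      (hdiv.trans (mul_le_mul_of_nonneg_left ?_ hw0)) ?_ ?_
    · rw [r1]
      refine ⟨h.1.trans (mul_le_mul_of_nonneg_left ?_ hw0),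
        h.2.trans (mul_le_mul_of_nonneg_left ?_ hw0)⟩
      · calc P * (c.Cu * c.ρu) = c.Cu * (c.ρu * P) := by ring
          _ ≤ c.Cu * (c.ρ * P) := by gcongr
      · calc P * (c.Cp * c.ρu) = c.Cp * (c.ρu * P) := by ring
          _ ≤ c.Cp * (c.ρ * P) := by gcongr
    · calc _ ≤ c.f / 2 * (2 * P) + (c.a / 2 * (c.γ * (2 * P) + c.Cu * (2 * P)) +
            c.m / 2 * (c.γ * (c.γ * (2 * P) + c.Cu * (2 * P)) +
              c.Cu * (c.γ * (2 * P) + c.Cu * P)) +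
            c.m / 2 * (c.Cu * (c.Cu * (2 * P)))) +
            c.b / 2 * (c.pbar * (2 * P) + c.Cp * (2 * P)) := by gcongr
        _ = _ := by rw [hF₀]; ring
    · calc _ ≤ c.g / 2 * (2 * P) + c.b / 2 * (c.γ * (2 * P) + c.Cu * (2 * P)) := by gcongr
        _ = P * (c.g + c.b * c.γ + c.b * c.Cu) := by ring
        _ = _ := by rw [← hG₀]; field_simp
    · calc _ = P * ((c.G₀ + c.b * c.Cu / c.β) +
          ((c.F₀ + c.a * c.Cu + c.b * c.Cp + c.m * (2 * c.γ * c.Cu + 3 / 2 * c.Cu ^ 2)) +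
            K * (c.G₀ + c.b * c.Cu / c.β)) / c.αt) := by ring
        _ ≤ _ := mul_le_mul_of_nonneg_left hc.velocity_higher hP0
    · calc _ = P * ((c.F₀ + c.a * c.Cu + c.b * c.Cp +
            c.m * (2 * c.γ * c.Cu + 3 / 2 * c.Cu ^ 2)) + K * (c.Cu * c.ρu)) := by ring
        _ ≤ P * (c.β * (c.Cp * c.ρu)) := mul_le_mul_of_nonneg_left hc.pressure_higher hP0
        _ = _ := by ring

end estimates

/-! ### Gevrey bounds for multi-indices -/

section gevrey

variable {s : ℕ} {U : Set (Fin s → ℝ)} {R : Fin s → ℝ} {δ : ℝ}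

theorem multiPow_pos (hR : ∀ j, 0 < R j) (ν : Fin s → ℕ) : 0 < multiPow R ν :=
  Finset.prod_pos fun j _ => pow_pos (hR j) _

theorem multiPow_two_mul (R : Fin s → ℝ) (ν : Fin s → ℕ) :
    multiPow (fun j => 2 * R j) ν = 2 ^ order ν * multiPow R ν := by
  simp only [multiPow, order, mul_pow, Finset.prod_mul_distrib, Finset.prod_pow_eq_pow_sum]

/-- The Gevrey bounds for multi-indices as a majorization along lists of directions. -/
theorem majorizes_of_gevrey {X : Type*} [NormedAddCommGroup X] [NormedSpace ℝ X]
    (hU : UniqueDiffOn ℝ U) (hR : ∀ j, 0 < R j) {F : (Fin s → ℝ) → X} {x : ℝ} {y : Fin s → ℝ}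
    (hy : y ∈ U) (hF : ∀ ν, ‖multiDeriv U ν F y‖ ≤ x * gevreyFactor δ R ν)
    (ν : Fin s → ℕ) (N : ℕ) :
    Majorizes U (scaledDir R) y (indexList ν) N (δ - 1) F
      fun k => x / 2 * ((k.factorial : ℝ) / 2 ^ k) := by
  intro l' hl' _
  obtain ⟨μ, rfl⟩ := exists_indexList_of_sublist hl'
  have hP := multiPow_pos hR μ
  rw [norm_iterDir_indexList hU hR F μ hy, length_indexList]
  refine (mul_le_mul_of_nonneg_left (hF μ) hP.le).trans (le_of_eq ?_)
  have hfac : ((order μ).factorial : ℝ) ≠ 0 := by positivity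
  rw [gevreyFactor, multiPow_two_mul, Real.rpow_sub_one hfac]
  field_simp

variable {X H L : Type*} [NormedAddCommGroup X] [NormedSpace ℝ X]
  [NormedAddCommGroup H] [InnerProductSpace ℝ H] [NormedAddCommGroup L] [InnerProductSpace ℝ L]
  {Φ : SaddleForms X H L} {c : Consts}
  {A B M : (Fin s → ℝ) → X} {f : (Fin s → ℝ) → H →L[ℝ] ℝ} {G : (Fin s → ℝ) → L →L[ℝ] ℝ}
  {u : (Fin s → ℝ) → H} {p : (Fin s → ℝ) → L}

/-- `p̄` bounds the pressure of a solution with velocity in the ball of radius `γ`. -/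
theorem norm_pressure_le_pbar (hc : c.Admissible) {A B M : X} {f : H →L[ℝ] ℝ} {G : L →L[ℝ] ℝ}
    {u : H} {p : L} (hA : ‖A‖ ≤ c.a / 2) (hM : Φ.κ * ‖M‖ ≤ c.m / 2) (hf : ‖f‖ ≤ c.f / 2)
    (hB : ∀ q, c.β * ‖q‖ ≤ ‖Φ.bT B q‖) (hs : Φ.IsSol A B M f G u p) (hu : ‖u‖ ≤ c.γ) :
    ‖p‖ ≤ c.pbar := by
  have hγ := hc.γ_pos; have ha := hc.a_pos; have hm := hc.m_pos
  have h := norm_pressure_le (b := Φ.b B) hB hs.1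
  refine le_of_mul_le_mul_left ?_ hc.β_pos
  rw [hc.β_mul_pbar]
  have h1 : ‖Φ.a A u‖ ≤ c.a / 2 * c.γ := (Φ.norm_a_le _ _).trans (by gcongr)
  have h2 : ‖Φ.m M u u‖ ≤ c.m / 2 * (c.γ * c.γ) :=
    (SaddleForms.norm_m_le' hM _ _).trans (by gcongr)
  have h3 := norm_add_le (Φ.a A u) (Φ.m M u u)
  nlinarith

variable [CompleteSpace H] [CompleteSpace L]

/-- The Gevrey estimates, by induction on the order of the derivative. -/
theorem norm_multiDeriv_le (hc : c.Admissible) (hδ : 1 ≤ δ) (hU : UniqueDiffOn ℝ U)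
    (hR : ∀ j, 0 < R j)
    (hAs : ContDiffOn ℝ ∞ A U) (hBs : ContDiffOn ℝ ∞ B U) (hMs : ContDiffOn ℝ ∞ M U)
    (hfs : ContDiffOn ℝ ∞ f U) (hGs : ContDiffOn ℝ ∞ G U)
    (hu : ContDiffOn ℝ ∞ u U) (hp : ContDiffOn ℝ ∞ p U) {y : Fin s → ℝ} (hy : y ∈ U)
    (hA : ∀ ν, ‖multiDeriv U ν A y‖ ≤ c.a * gevreyFactor δ R ν)
    (hB : ∀ ν, ‖multiDeriv U ν B y‖ ≤ c.b * gevreyFactor δ R ν)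
    (hM : ∀ ν, ‖multiDeriv U ν M y‖ ≤ Φ.κ⁻¹ * c.m * gevreyFactor δ R ν)
    (hf : ∀ ν, ‖multiDeriv U ν f y‖ ≤ c.f * gevreyFactor δ R ν)
    (hG : ∀ ν, ‖multiDeriv U ν G y‖ ≤ c.g * gevreyFactor δ R ν)
    (hAy : ‖A y‖ ≤ c.a / 2) (hMy : Φ.κ * ‖M y‖ ≤ c.m / 2) (hfy : ‖f y‖ ≤ c.f / 2)
    (hco : ∀ v, c.α * ‖v‖ ^ 2 ≤ Φ.a (A y) v v) (hβ : ∀ q, c.β * ‖q‖ ≤ ‖Φ.bT (B y) q‖)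
    (huy : ‖u y‖ ≤ c.γ) (hsol : ∀ z ∈ U, Φ.IsSol (A z) (B z) (M z) (f z) (G z) (u z) (p z))
    {ν : Fin s → ℕ} (hν : ν ≠ 0) :
    ‖multiDeriv U ν u y‖ ≤
      c.Cu * c.ρ ^ (order ν - 1) * fallingHalf (order ν) / multiPow R ν *
        ((order ν).factorial : ℝ) ^ (δ - 1) ∧
    ‖multiDeriv U ν p y‖ ≤
      c.Cp * c.ρ ^ (order ν - 1) * fallingHalf (order ν) / multiPow R ν *
        ((order ν).factorial : ℝ) ^ (δ - 1) := by
  have ht : 0 ≤ δ - 1 := by linarith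
  have hd : ∀ ν, DataBounds Φ c U (scaledDir R) y (indexList ν) (δ - 1) A B M f G := fun ν =>
    { A_smooth := hAs
      B_smooth := hBs
      M_smooth := hMs
      f_smooth := hfs
      G_smooth := hGs
      A_maj := majorizes_of_gevrey hU hR hy hA ν _
      B_maj := majorizes_of_gevrey hU hR hy hB ν _
      M_maj := by
        have := majorizes_of_gevrey hU hR hy hM ν ((indexList ν).length + 1)
        simpa only [mul_div_assoc] using this
      f_maj := majorizes_of_gevrey hU hR hy hf ν _
      G_maj := majorizes_of_gevrey hU hR hy hG ν _ }
  have hpy := norm_pressure_le_pbar hc hAy hMy hfy hβ (hsol y hy) huy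
  have key : ∀ n, ∀ ν : Fin s → ℕ, order ν = n →
      ‖iterDir U (scaledDir R) (indexList ν) u y‖ ≤
        (n.factorial : ℝ) ^ (δ - 1) * fullSolSeq c.γ c.Cu c.ρ n ∧
      ‖iterDir U (scaledDir R) (indexList ν) p y‖ ≤
        (n.factorial : ℝ) ^ (δ - 1) * fullSolSeq c.pbar c.Cp c.ρ n := by
    intro n
    induction n using Nat.strong_induction_on with
    | _ n ih =>
      intro ν hν
      have hlen := length_indexList ν
      by_cases h0 : indexList ν = []
      · have hn : n = 0 := by rw [← hν, ← hlen, h0]; rfl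
        rw [h0, hn]
        simpa [fullSolSeq, unitSeq, solSeq] using ⟨huy, hpy⟩
      · have hmaj : ∀ l' : List (Fin s), l'.Sublist (indexList ν) →
            l'.length < (indexList ν).length →
            ‖iterDir U (scaledDir R) l' u y‖ ≤
              (l'.length.factorial : ℝ) ^ (δ - 1) * fullSolSeq c.γ c.Cu c.ρ l'.length ∧
            ‖iterDir U (scaledDir R) l' p y‖ ≤
              (l'.length.factorial : ℝ) ^ (δ - 1) * fullSolSeq c.pbar c.Cp c.ρ l'.length := by
          intro l' hl' hN
          obtain ⟨μ, rfl⟩ := exists_indexList_of_sublist hl'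
          have := ih (order μ) (by rwa [length_indexList, hlen, hν] at hN) μ rfl
          rw [← length_indexList] at this
          exact this
        have h := norm_derivative_le hc ht hU hy (hd ν) h0 hAy hMy hco hβ huy hu hp hsol
          (fun l' hl' hN => (hmaj l' hl' hN).1) (fun l' hl' hN => (hmaj l' hl' hN).2)
        rw [hlen, hν] at h
        have hn : n ≠ 0 := by
          rintro rfl
          exact h0 (List.length_eq_zero_iff.1 (hlen.trans hν))
        simpa [fullSolSeq, unitSeq, hn] using h
  have hn : order ν ≠ 0 := fun h => hν (funext fun j => (Finset.sum_eq_zero_iff.1 h) j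
    (Finset.mem_univ j))
  have h := key (order ν) ν rfl
  have hP := multiPow_pos hR ν
  simp only [norm_iterDir_indexList hU hR _ ν hy, fullSolSeq, unitSeq, solSeq, hn, if_false,
    mul_zero, zero_add] at h
  refine ⟨?_, ?_⟩
  · rw [div_mul_eq_mul_div, le_div_iff₀ hP]
    linarith [h.1]
  · rw [div_mul_eq_mul_div, le_div_iff₀ hP]
    linarith [h.2]

end gevrey

/-! ### Matrix algebra in the Frobenius norm -/

section matrices

variable {d : ℕ}

/-- The topology of the Frobenius norm. Making it a local instance lets measurability and the norm
refer to the same topology up to reducible unfolding. -/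
@[reducible] def frobeniusTopology : TopologicalSpace (Mat d) :=
  PseudoMetricSpace.toUniformSpace.toTopologicalSpace

attribute [local instance] frobeniusTopology

theorem frobenius_norm_sq (A : Mat d) : ‖A‖ ^ 2 = ∑ i, ∑ j, A i j ^ 2 := by
  have h0 : 0 ≤ ∑ i, ∑ j, A i j ^ 2 :=
    Finset.sum_nonneg fun _ _ => Finset.sum_nonneg fun _ _ => sq_nonneg _
  rw [Matrix.frobenius_norm_def, ← Real.sqrt_eq_rpow]
  simp only [Real.rpow_ofNat, Real.norm_eq_abs, sq_abs]
  exact Real.sq_sqrt h0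

theorem trace_transpose_mul (A B : Mat d) : (Aᵀ * B).trace = ∑ i, ∑ j, A i j * B i j := by
  simp only [Matrix.trace, Matrix.diag_apply, Matrix.mul_apply, Matrix.transpose_apply]
  exact Finset.sum_comm

theorem abs_trace_transpose_mul_le (A B : Mat d) : |(Aᵀ * B).trace| ≤ ‖A‖ * ‖B‖ := by
  rw [trace_transpose_mul]
  refine abs_le_of_sq_le_sq ?_ (mul_nonneg (norm_nonneg A) (norm_nonneg B))
  rw [mul_pow, frobenius_norm_sq, frobenius_norm_sq]
  simp only [← Finset.sum_product']
  exact Finset.sum_mul_sq_le_sq_mul_sq _ _ _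

theorem abs_trace_mul_le (A B : Mat d) : |(A * B).trace| ≤ ‖A‖ * ‖B‖ := by
  have := abs_trace_transpose_mul_le Aᵀ B
  rwa [Matrix.transpose_transpose, Matrix.frobenius_norm_transpose] at this

/-- Matrix multiplication. -/
def mulMat : Mat d →L[ℝ] Mat d →L[ℝ] Mat d :=
  LinearMap.mkContinuous₂ (LinearMap.mul ℝ (Mat d)) 1 fun A B => by
    rw [one_mul]; exact Matrix.frobenius_norm_mul A B

/-- The Frobenius inner product `tr(Aᵀ B)`. -/
def frobMat : Mat d →L[ℝ] Mat d →L[ℝ] ℝ :=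
  LinearMap.mkContinuous₂ (LinearMap.mk₂ ℝ (fun A B : Mat d => (Aᵀ * B).trace)
    (by intros; simp [Matrix.add_mul]) (by intros; simp)
    (by intros; simp [Matrix.mul_add]) (by intros; simp)) 1 fun A B => by
    rw [one_mul]; exact abs_trace_transpose_mul_le A B

/-- The form `tr(A B)`. -/
def trMat : Mat d →L[ℝ] Mat d →L[ℝ] ℝ :=
  LinearMap.mkContinuous₂ (LinearMap.mk₂ ℝ (fun A B : Mat d => (A * B).trace)
    (by intros; simp [Matrix.add_mul]) (by intros; simp)
    (by intros; simp [Matrix.mul_add]) (by intros; simp)) 1 fun A B => by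
    rw [one_mul]; exact abs_trace_mul_le A B

/-- The tensor product `w ⊗ u = w uᵀ` of vectors. -/
def outerMat : Space d →L[ℝ] Space d →L[ℝ] Mat d :=
  LinearMap.mkContinuous₂ (LinearMap.mk₂ ℝ (fun w u : Space d => Matrix.vecMulVec w.ofLp u.ofLp)
    (by intros; simp [Matrix.add_vecMulVec]) (by intros; simp [Matrix.smul_vecMulVec])
    (by intros; simp [Matrix.vecMulVec_add]) (by intros; simp [Matrix.vecMulVec_smul])) 1
    fun w u => by
      rw [one_mul]
      refine le_of_eq ((sq_eq_sq₀ (norm_nonneg _) (by positivity)).1 ?_)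
      rw [mul_pow, EuclideanSpace.norm_sq_eq, EuclideanSpace.norm_sq_eq, Finset.sum_mul_sum]
      change ‖Matrix.vecMulVec w.ofLp u.ofLp‖ ^ 2 = _
      rw [frobenius_norm_sq]
      simp only [Matrix.vecMulVec_apply, mul_pow, Real.norm_eq_abs, sq_abs]

theorem norm_mulMat_le : ‖(mulMat : Mat d →L[ℝ] Mat d →L[ℝ] Mat d)‖ ≤ 1 :=
  LinearMap.mkContinuous₂_norm_le _ zero_le_one _

theorem norm_frobMat_le : ‖(frobMat : Mat d →L[ℝ] Mat d →L[ℝ] ℝ)‖ ≤ 1 :=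
  LinearMap.mkContinuous₂_norm_le _ zero_le_one _

theorem norm_trMat_le : ‖(trMat : Mat d →L[ℝ] Mat d →L[ℝ] ℝ)‖ ≤ 1 :=
  LinearMap.mkContinuous₂_norm_le _ zero_le_one _

theorem norm_outerMat_le : ‖(outerMat : Space d →L[ℝ] Space d →L[ℝ] Mat d)‖ ≤ 1 :=
  LinearMap.mkContinuous₂_norm_le _ zero_le_one _

theorem mulMat_apply (A B : Mat d) : mulMat A B = A * B := rfl

theorem frobMat_apply (A B : Mat d) : frobMat A B = (Aᵀ * B).trace := rfl

theorem trMat_apply (A B : Mat d) : trMat A B = (A * B).trace := rfl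

theorem outerMat_apply (w u : Space d) : outerMat w u = Matrix.vecMulVec w.ofLp u.ofLp := rfl

/-- `(A u) · w` as a Frobenius inner product. -/
theorem frobMat_outerMat (A : Mat d) (w u : Space d) :
    frobMat A (outerMat w u) = (A *ᵥ u.ofLp) ⬝ᵥ w.ofLp := by
  rw [frobMat_apply, trace_transpose_mul, outerMat_apply]
  simp only [Matrix.vecMulVec_apply, dotProduct, Matrix.mulVec, Finset.sum_mul]
  exact Finset.sum_congr rfl fun _ _ => Finset.sum_congr rfl fun _ _ => by ring

/-- The matrix with `i`-th row `v` and all other rows zero. -/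
def rowMat (i : Fin d) : Space d →L[ℝ] Mat d :=
  LinearMap.toContinuousLinearMap
    { toFun := fun v => Matrix.vecMulVec (Pi.single i 1) v.ofLp
      map_add' := by intros; simp [Matrix.vecMulVec_add]
      map_smul' := by intros; simp [Matrix.vecMulVec_smul] }

theorem sum_rowMat (v : Fin d → Space d) :
    ∑ i, rowMat i (v i) = Matrix.of fun i j => v i j := by
  ext i j
  have : ∀ k, rowMat k (v k) i j = if i = k then v k j else 0 := fun k => by
    change Matrix.vecMulVec (Pi.single k 1) (v k).ofLp i j = _
    simp [Matrix.vecMulVec_apply, Pi.single_apply]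
  rw [Matrix.sum_apply]
  simp [this]

end matrices

/-! ### The spaces of the problem -/

section spaces

variable {d : ℕ} {D : BoundedDomain d}

attribute [local instance] frobeniusTopology

/-- By Friedrichs' inequality the norm of `H¹₀(D)` is equivalent to the graph norm, in which
`H¹₀(D)` is closed. -/
instance : CompleteSpace (H10 D) := by
  let V := (testGraph D).topologicalClosure
  have : CompleteSpace V := (testGraph D).isClosed_topologicalClosure.completeSpace_coe
  obtain ⟨K, hK⟩ := h10_friedrichs D
  let φ : V ≃ₗ[ℝ] H10 D := LinearEquiv.refl ℝ V
  have h1 : ∀ w : V, ‖φ w‖ ≤ 1 * ‖w‖ := fun w => by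
    rw [one_mul]
    exact norm_snd_le (w : Lp ℝ 2 D.vol × Lp (Space d) 2 D.vol)
  have h2 : ∀ w : H10 D, ‖φ.symm w‖ ≤ max K 1 * ‖w‖ := fun w => by
    refine max_le ((hK w.1 w.2).trans ?_) ?_
    · exact mul_le_mul_of_nonneg_right (le_max_left _ _) (norm_nonneg _)
    · exact le_mul_of_one_le_left (norm_nonneg _) (le_max_right _ _)
  let e : V ≃L[ℝ] H10 D := φ.toContinuousLinearEquivOfBounds 1 (max K 1) h1 h2
  exact (completeSpace_congr (e := e.toEquiv) e.isUniformEmbedding).1 inferInstance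

instance : CompleteSpace (Pres D) := by
  have h : IsClosed (meanZero D : Set (Lp ℝ 2 D.vol)) := by
    have : (meanZero D : Set (Lp ℝ 2 D.vol)) =
        {q | inner ℝ (indicatorConstLp 2 MeasurableSet.univ (measure_ne_top D.vol univ)
          (1 : ℝ)) q = 0} := by
      ext q
      change ∫ x, q x ∂D.vol = 0 ↔ _
      rw [Set.mem_ofPred_eq, L2.inner_indicatorConstLp_one, setIntegral_univ]
    rw [this]
    exact isClosed_eq (by fun_prop) continuous_const
  exact h.completeSpace_coe

instance : CompleteSpace (Mat d) := FiniteDimensional.complete ℝ (Mat d)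

theorem vel_norm_sq (u : Vel D) : ‖u‖ ^ 2 = ∑ i, ‖H10.grad (u i)‖ ^ 2 :=
  PiLp.norm_sq_eq_of_L2 _ u

theorem jac_eq_sum (u : Vel D) (x : Space d) :
    u.jac x = ∑ i, rowMat i (H10.grad (u i) x) :=
  (sum_rowMat fun i => H10.grad (u i) x).symm

theorem memLp_jac (u : Vel D) : MemLp u.jac 2 D.vol := by
  have : u.jac = fun x => ∑ i, rowMat i (H10.grad (u i) x) := funext (jac_eq_sum u)
  rw [this]
  exact memLp_finsetSum _ fun i _ => (rowMat i).comp_memLp (H10.grad (u i))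

theorem norm_toLp_jac (u : Vel D) : ‖(memLp_jac u).toLp u.jac‖ = ‖u‖ := by
  refine (sq_eq_sq₀ (norm_nonneg _) (norm_nonneg _)).1 ?_
  have h1 : ∀ᵐ x ∂D.vol, ‖(memLp_jac u).toLp u.jac x‖ ^ 2 = ∑ i, ‖H10.grad (u i) x‖ ^ 2 := by
    filter_upwards [(memLp_jac u).coeFn_toLp] with x hx
    rw [hx, frobenius_norm_sq]
    refine Finset.sum_congr rfl fun i _ => ?_
    rw [EuclideanSpace.norm_sq_eq]
    exact Finset.sum_congr rfl fun j _ => (sq_abs _).symm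
  rw [Lp_two_norm_sq, integral_congr_ae h1, vel_norm_sq, integral_finsetSum]
  · exact Finset.sum_congr rfl fun i _ => (Lp_two_norm_sq _).symm
  · exact fun i _ => (Lp.memLp (H10.grad (u i))).integrable_norm_pow two_ne_zero

/-- The Jacobian as an isometry `H → L²(D)^{d×d}`. -/
def jacL : Vel D →L[ℝ] Lp (Mat d) 2 D.vol :=
  LinearMap.mkContinuous
    { toFun := fun u => (memLp_jac u).toLp u.jac
      map_add' := fun u v => by
        rw [← MemLp.toLp_add]
        refine MemLp.toLp_congr _ _ ?_
        have h : ∀ᵐ x ∂D.vol, ∀ i, H10.grad ((u + v) i) x =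
            H10.grad (u i) x + H10.grad (v i) x := ae_all_iff.2 fun i => by
          rw [PiLp.add_apply, map_add]
          exact Lp.coeFn_add _ _
        filter_upwards [h] with x hx
        ext i j
        exact congrArg (fun v : Space d => v j) (hx i)
      map_smul' := fun r u => by
        rw [RingHom.id_apply, ← MemLp.toLp_const_smul]
        refine MemLp.toLp_congr _ _ ?_
        have h : ∀ᵐ x ∂D.vol, ∀ i, H10.grad ((r • u) i) x = r • H10.grad (u i) x :=
          ae_all_iff.2 fun i => by
            rw [PiLp.smul_apply, map_smul]
            exact Lp.coeFn_smul _ _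
        filter_upwards [h] with x hx
        ext i j
        exact congrArg (fun v : Space d => v j) (hx i) } 1
    fun u => by rw [one_mul]; exact (norm_toLp_jac u).le

theorem norm_jacL (u : Vel D) : ‖jacL u‖ = ‖u‖ := norm_toLp_jac u

theorem coeFn_jacL (u : Vel D) : jacL u =ᵐ[D.vol] u.jac := (memLp_jac u).coeFn_toLp

/-- The Sobolev inequality for vector fields, with the constant of the scalar inequality. -/
theorem eLpNorm_value_le {C₄ : ℝ} (hC : IsSobolevConst D C₄) (u : Vel D) :
    eLpNorm (fun x => (WithLp.toLp 2 (u.value x) : Space d)) 4 D.vol ≤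
      ENNReal.ofReal (C₄ * ‖u‖) := by
  have h0 := hC.1
  have e4 : (2 : ℝ≥0∞) * ENNReal.ofReal 2 = 4 := by
    rw [ENNReal.ofReal_ofNat]; norm_num
  have hm : ∀ i, AEStronglyMeasurable (fun x => H10.val (u i) x) D.vol := fun i =>
    (Lp.memLp (H10.val (u i))).1
  have h1 : eLpNorm (fun x => (WithLp.toLp 2 (u.value x) : Space d)) 4 D.vol ^ (2 : ℝ) ≤
      ENNReal.ofReal (C₄ * ‖u‖) ^ (2 : ℝ) := by
    rw [← e4, ← eLpNorm_norm_rpow _ two_pos]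
    have e : (fun x => ‖(WithLp.toLp 2 (u.value x) : Space d)‖ ^ (2 : ℝ)) =
        ∑ i, fun x => ‖H10.val (u i) x‖ ^ (2 : ℝ) := by
      funext x
      rw [Real.rpow_two, EuclideanSpace.norm_sq_eq, Finset.sum_apply]
      simp [Vel.value]
    rw [e]
    refine (eLpNorm_sum_le (fun i _ => ((hm i).norm.aemeasurable.pow_const 2).aestronglyMeasurable)
      one_le_two).trans ?_
    have hi : ∀ i, eLpNorm (fun x => ‖H10.val (u i) x‖ ^ (2 : ℝ)) 2 D.vol ≤
        ENNReal.ofReal ((C₄ * ‖u i‖) ^ 2) := fun i => by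
      rw [eLpNorm_norm_rpow _ two_pos, e4]
      refine (ENNReal.rpow_le_rpow (hC.2 (u i)) zero_le_two).trans (le_of_eq ?_)
      rw [ENNReal.ofReal_rpow_of_nonneg (by positivity) zero_le_two, Real.rpow_two]
    refine (Finset.sum_le_sum fun i _ => hi i).trans (le_of_eq ?_)
    rw [← ENNReal.ofReal_sum_of_nonneg fun _ _ => sq_nonneg _,
      ENNReal.ofReal_rpow_of_nonneg (by positivity) zero_le_two, Real.rpow_two, mul_pow,
      PiLp.norm_sq_eq_of_L2, Finset.mul_sum]
    simp only [mul_pow]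
  exact (ENNReal.rpow_le_rpow_iff two_pos).1 h1

theorem memLp_value {C₄ : ℝ} (hC : IsSobolevConst D C₄) (u : Vel D) :
    MemLp (fun x => (WithLp.toLp 2 (u.value x) : Space d)) 4 D.vol := by
  refine ⟨?_, (eLpNorm_value_le hC u).trans_lt ENNReal.ofReal_lt_top⟩
  have h : AEMeasurable (fun x => u.value x) D.vol := aemeasurable_pi_iff.2 fun i =>
    (Lp.memLp (H10.val (u i))).1.aemeasurable
  exact ((PiLp.continuous_toLp 2 _).measurable.comp_aemeasurable h).aestronglyMeasurable

instance : Fact ((1 : ℝ≥0∞) ≤ 4) := ⟨by norm_num⟩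

/-- The velocity field as an element of `L⁴(D)^d`. -/
def valL {C₄ : ℝ} (hC : IsSobolevConst D C₄) : Vel D →L[ℝ] Lp (Space d) 4 D.vol :=
  LinearMap.mkContinuous
    { toFun := fun u => (memLp_value hC u).toLp _
      map_add' := fun u v => by
        rw [← MemLp.toLp_add]
        refine MemLp.toLp_congr _ _ ?_
        have h : ∀ᵐ x ∂D.vol, ∀ i, H10.val ((u + v) i) x =
            H10.val (u i) x + H10.val (v i) x := ae_all_iff.2 fun i => by
          rw [PiLp.add_apply, map_add]
          exact Lp.coeFn_add _ _
        filter_upwards [h] with x hx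
        ext i
        exact hx i
      map_smul' := fun r u => by
        rw [RingHom.id_apply, ← MemLp.toLp_const_smul]
        refine MemLp.toLp_congr _ _ ?_
        have h : ∀ᵐ x ∂D.vol, ∀ i, H10.val ((r • u) i) x = r • H10.val (u i) x :=
          ae_all_iff.2 fun i => by
            rw [PiLp.smul_apply, map_smul]
            exact Lp.coeFn_smul _ _
        filter_upwards [h] with x hx
        ext i
        exact hx i } C₄
    fun u => by
      have h0 := hC.1
      change ‖(memLp_value hC u).toLp _‖ ≤ _
      rw [Lp.norm_toLp]
      exact ENNReal.toReal_le_of_le_ofReal (by positivity) (eLpNorm_value_le hC u)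

theorem norm_valL_le {C₄ : ℝ} (hC : IsSobolevConst D C₄) (u : Vel D) :
    ‖valL hC u‖ ≤ C₄ * ‖u‖ :=
  ((valL hC).le_opNorm u).trans
    (mul_le_mul_of_nonneg_right (LinearMap.mkContinuous_norm_le _ hC.1.le _) (norm_nonneg u))

theorem coeFn_valL {C₄ : ℝ} (hC : IsSobolevConst D C₄) (u : Vel D) :
    valL hC u =ᵐ[D.vol] fun x => (WithLp.toLp 2 (u.value x) : Space d) :=
  (memLp_value hC u).coeFn_toLp

end spaces

/-! ### The forms as bounded multilinear maps -/

section forms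

variable {d : ℕ} {D : BoundedDomain d} {C₄ : ℝ}

attribute [local instance] frobeniusTopology

instance : ENNReal.HolderTriple 4 4 2 where
  inv_add_inv_eq_inv := by
    rw [← two_mul, show (4 : ℝ≥0∞) = 2 * 2 by norm_num,
      ENNReal.mul_inv (Or.inl two_ne_zero) (Or.inl ENNReal.ofNat_ne_top), ← mul_assoc,
      ENNReal.mul_inv_cancel two_ne_zero ENNReal.ofNat_ne_top, one_mul]

/-- The inner product of `L²(D)^{d×d}`. It is not available as an instance, because matrices carry
the Frobenius norm without the corresponding inner product structure. -/
def pairMat : Lp (Mat d) 2 D.vol →L[ℝ] Lp (Mat d) 2 D.vol →L[ℝ] ℝ :=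
  frobMat.lpPairing D.vol 2 2

theorem pairMat_apply (F G : Lp (Mat d) 2 D.vol) :
    pairMat F G = ∫ x, ((F x)ᵀ * G x).trace ∂D.vol :=
  ContinuousLinearMap.lpPairing_eq_integral _ _ _

theorem norm_pairMat_le (F G : Lp (Mat d) 2 D.vol) : ‖pairMat F G‖ ≤ ‖F‖ * ‖G‖ := by
  have h1 : pairMat F G = ∫ x, frobMat.holder 1 F G x ∂D.vol := by
    rw [pairMat, ContinuousLinearMap.lpPairing_eq_integral]
    exact (integral_congr_ae (frobMat.coeFn_holder F G)).symm
  rw [h1, ← L1.integral_eq_integral]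
  refine (L1.norm_integral_le _).trans
    ((ContinuousLinearMap.norm_holder_apply_apply_le _ _ _).trans ?_)
  gcongr
  exact mul_le_of_le_one_left (norm_nonneg _) norm_frobMat_le

theorem norm_mulMat_holder_le (A : Coeff D) (F : Lp (Mat d) 2 D.vol) :
    ‖mulMat.holder 2 A F‖ ≤ ‖A‖ * ‖F‖ := by
  refine (ContinuousLinearMap.norm_holder_apply_apply_le _ _ _).trans ?_
  gcongr
  exact mul_le_of_le_one_left (norm_nonneg _) norm_mulMat_le

theorem norm_mulMat_holder_le' (F : Lp (Mat d) 2 D.vol) (A : Coeff D) :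
    ‖mulMat.holder 2 F A‖ ≤ ‖F‖ * ‖A‖ := by
  refine (ContinuousLinearMap.norm_holder_apply_apply_le _ _ _).trans ?_
  gcongr
  exact mul_le_of_le_one_left (norm_nonneg _) norm_mulMat_le

/-- The form `a` as `(A ∇u, ∇v)`. -/
def opA : Coeff D →L[ℝ] Vel D →L[ℝ] Vel D →L[ℝ] ℝ :=
  LinearMap.mkContinuous₂ (LinearMap.mk₂ ℝ
    (fun A u => (pairMat (mulMat.holder 2 A (jacL u))).comp jacL)
    (fun A A' u => by
      rw [ContinuousLinearMap.holder_add_left, map_add, ContinuousLinearMap.add_comp])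
    (fun r A u => by
      rw [ContinuousLinearMap.holder_smul_left, map_smul, ContinuousLinearMap.smul_comp])
    (fun A u v => by
      rw [map_add, ContinuousLinearMap.holder_add_right, map_add, ContinuousLinearMap.add_comp])
    (fun r A u => by
      rw [map_smul, ContinuousLinearMap.holder_smul_right, map_smul,
        ContinuousLinearMap.smul_comp])) 1
    fun A u => by
      refine ContinuousLinearMap.opNorm_le_bound _ (by positivity) fun v => ?_
      refine (norm_pairMat_le _ _).trans ?_
      rw [one_mul, ← norm_jacL u, ← norm_jacL v]
      exact mul_le_mul_of_nonneg_right (norm_mulMat_holder_le A _) (norm_nonneg _)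

theorem opA_apply (A : Coeff D) (u v : Vel D) : opA A u v = formA u v A := by
  refine (pairMat_apply _ _).trans (integral_congr_ae ?_)
  filter_upwards [ContinuousLinearMap.coeFn_holder (r := 2) mulMat A (jacL u), coeFn_jacL u,
    coeFn_jacL v] with x h1 h2 h3
  change (_ᵀ * jacL v x).trace = _
  rw [h1, h2, h3, mulMat_apply, Matrix.transpose_mul]

theorem norm_opA_le (A : Coeff D) (u : Vel D) : ‖opA A u‖ ≤ ‖A‖ * ‖u‖ := by
  refine (opA.le_opNorm₂ A u).trans ?_
  gcongr
  exact mul_le_of_le_one_left (norm_nonneg _) (LinearMap.mkContinuous₂_norm_le _ zero_le_one _)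

/-- The form `b` as `-(tr(∇v B), q)`. -/
def opB : Coeff D →L[ℝ] Vel D →L[ℝ] Pres D →L[ℝ] ℝ :=
  LinearMap.mkContinuous₂ (LinearMap.mk₂ ℝ
    (fun B v => -(innerSL ℝ (trMat.holder 2 (jacL v) B)).comp (meanZero D).subtypeL)
    (fun B B' v => by
      rw [ContinuousLinearMap.holder_add_right, map_add, ContinuousLinearMap.add_comp, neg_add])
    (fun r B v => by
      rw [ContinuousLinearMap.holder_smul_right]
      ext q
      simp)
    (fun B u v => by
      rw [map_add, ContinuousLinearMap.holder_add_left, map_add, ContinuousLinearMap.add_comp,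
        neg_add])
    (fun r B v => by
      rw [map_smul, ContinuousLinearMap.holder_smul_left]
      ext q
      simp)) 1
    fun B v => by
      change ‖-(innerSL ℝ (trMat.holder 2 (jacL v) B)).comp (meanZero D).subtypeL‖ ≤ _
      rw [norm_neg, one_mul, mul_comm, ← norm_jacL v]
      refine ContinuousLinearMap.opNorm_le_bound _ (by positivity) fun q => ?_
      refine (norm_inner_le_norm (𝕜 := ℝ) _ (q : Lp ℝ 2 D.vol)).trans ?_
      refine mul_le_mul_of_nonneg_right ?_ (norm_nonneg _)
      refine (ContinuousLinearMap.norm_holder_apply_apply_le _ _ _).trans ?_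
      gcongr
      exact mul_le_of_le_one_left (norm_nonneg _) norm_trMat_le

theorem opB_apply (B : Coeff D) (v : Vel D) (q : Pres D) : opB B v q = formB v q B := by
  change -inner ℝ (trMat.holder 2 (jacL v) B) (q : Lp ℝ 2 D.vol) = _
  rw [L2.inner_def, formB]
  refine congrArg Neg.neg (integral_congr_ae ?_)
  filter_upwards [ContinuousLinearMap.coeFn_holder (r := 2) trMat (jacL v) B, coeFn_jacL v]
    with x h1 h2
  rw [h1, h2, trMat_apply, Matrix.trace_smul, smul_eq_mul]
  rfl

theorem norm_opB_le (B : Coeff D) (v : Vel D) : ‖opB B v‖ ≤ ‖B‖ * ‖v‖ := by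
  refine (opB.le_opNorm₂ B v).trans ?_
  gcongr
  exact mul_le_of_le_one_left (norm_nonneg _) (LinearMap.mkContinuous₂_norm_le _ zero_le_one _)

/-- The tensor product `w ⊗ u` in `L²(D)^{d×d}`. The Sobolev inequality makes it a bounded
bilinear map. -/
def tensorL (hC : IsSobolevConst D C₄) : Vel D →L[ℝ] Vel D →L[ℝ] Lp (Mat d) 2 D.vol :=
  (((outerMat.holderL D.vol 4 4 2).flip.comp (valL hC)).flip.comp (valL hC)).flip

theorem coeFn_tensorL (hC : IsSobolevConst D C₄) (u w : Vel D) :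
    tensorL hC u w =ᵐ[D.vol] fun x =>
      outerMat (WithLp.toLp 2 (w.value x)) (WithLp.toLp 2 (u.value x)) := by
  have h : tensorL hC u w =ᵐ[D.vol] fun x => outerMat (valL hC w x) (valL hC u x) :=
    ContinuousLinearMap.coeFn_holder (r := 2) outerMat (valL hC w) (valL hC u)
  filter_upwards [h, coeFn_valL hC w, coeFn_valL hC u] with x h1 h2 h3
  rw [h1, h2, h3]

theorem norm_tensorL_le (hC : IsSobolevConst D C₄) (u w : Vel D) :
    ‖tensorL hC u w‖ ≤ C₄ ^ 2 * (‖u‖ * ‖w‖) := by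
  have h0 := hC.1
  have h : ‖tensorL hC u w‖ ≤ ‖outerMat (d := d)‖ * ‖valL hC w‖ * ‖valL hC u‖ :=
    ContinuousLinearMap.norm_holder_apply_apply_le (r := 2) outerMat (valL hC w) (valL hC u)
  refine h.trans ?_
  calc ‖outerMat (d := d)‖ * ‖valL hC w‖ * ‖valL hC u‖ ≤ 1 * (C₄ * ‖w‖) * (C₄ * ‖u‖) := by
        gcongr
        · exact norm_outerMat_le
        · exact norm_valL_le hC w
        · exact norm_valL_le hC u
    _ = C₄ ^ 2 * (‖u‖ * ‖w‖) := by ring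

theorem norm_pairMat_tensorL_le (hC : IsSobolevConst D C₄) (M : Coeff D) (u v : Vel D) :
    ‖(pairMat (mulMat.holder 2 (jacL v) M)).comp (tensorL hC u)‖ ≤
      C₄ ^ 2 * ‖M‖ * (‖u‖ * ‖v‖) := by
  refine ContinuousLinearMap.opNorm_le_bound _ (by positivity) fun w => ?_
  refine (norm_pairMat_le _ _).trans ?_
  have h1 := norm_mulMat_holder_le' (jacL v) M
  rw [norm_jacL] at h1
  calc _ ≤ (‖v‖ * ‖M‖) * (C₄ ^ 2 * (‖u‖ * ‖w‖)) := by
        gcongr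
        exact norm_tensorL_le hC u w
    _ = _ := by ring

/-- The form `m` with a fixed coefficient, as `(∇v M, w ⊗ u)`. -/
def opMAt (hC : IsSobolevConst D C₄) (M : Coeff D) : Vel D →L[ℝ] Vel D →L[ℝ] Vel D →L[ℝ] ℝ :=
  LinearMap.mkContinuous₂ (LinearMap.mk₂ ℝ
    (fun u v => (pairMat (mulMat.holder 2 (jacL v) M)).comp (tensorL hC u))
    (fun u u' v => by rw [map_add, ContinuousLinearMap.comp_add])
    (fun r u v => by rw [map_smul, ContinuousLinearMap.comp_smul])
    (fun u v v' => by
      rw [map_add, ContinuousLinearMap.holder_add_left, map_add, ContinuousLinearMap.add_comp])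
    (fun r u v => by
      rw [map_smul, ContinuousLinearMap.holder_smul_left, map_smul,
        ContinuousLinearMap.smul_comp])) (C₄ ^ 2 * ‖M‖)
    fun u v => (norm_pairMat_tensorL_le hC M u v).trans_eq (mul_assoc _ _ _).symm

theorem opMAt_apply (hC : IsSobolevConst D C₄) (M : Coeff D) (u v w : Vel D) :
    opMAt hC M u v w = pairMat (mulMat.holder 2 (jacL v) M) (tensorL hC u w) := rfl

theorem norm_opMAt_le (hC : IsSobolevConst D C₄) (M : Coeff D) :
    ‖opMAt hC M‖ ≤ C₄ ^ 2 * ‖M‖ :=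
  LinearMap.mkContinuous₂_norm_le _ (by positivity) _

/-- The form `m`. -/
def opM (hC : IsSobolevConst D C₄) : Coeff D →L[ℝ] Vel D →L[ℝ] Vel D →L[ℝ] Vel D →L[ℝ] ℝ :=
  LinearMap.mkContinuous
    { toFun := opMAt hC
      map_add' := fun M M' => by
        refine ContinuousLinearMap.ext fun u => ContinuousLinearMap.ext fun v =>
          ContinuousLinearMap.ext fun w => ?_
        simp only [add_apply, opMAt_apply, ContinuousLinearMap.holder_add_right, map_add]
      map_smul' := fun r M => by
        refine ContinuousLinearMap.ext fun u => ContinuousLinearMap.ext fun v =>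
          ContinuousLinearMap.ext fun w => ?_
        simp only [RingHom.id_apply, smul_apply, opMAt_apply,
          ContinuousLinearMap.holder_smul_right, map_smul] } (C₄ ^ 2)
    (norm_opMAt_le hC)

theorem opM_eq (hC : IsSobolevConst D C₄) (M : Coeff D) : opM hC M = opMAt hC M := rfl

theorem opM_apply (hC : IsSobolevConst D C₄) (M : Coeff D) (u v w : Vel D) :
    opM hC M u v w = formM u v w M := by
  rw [opM_eq, opMAt_apply]
  refine (pairMat_apply _ _).trans (integral_congr_ae ?_)
  filter_upwards [ContinuousLinearMap.coeFn_holder (r := 2) mulMat (jacL v) M, coeFn_jacL v,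
    coeFn_tensorL hC u w] with x h1 h2 h3
  rw [h1, h2]
  change (_ᵀ * tensorL hC u w x).trace = _
  rw [h3, ← frobMat_apply, frobMat_outerMat, mulMat_apply]

/-- The forms of the stationary Navier–Stokes problem. -/
def nsForms (hC : IsSobolevConst D C₄) : SaddleForms (Coeff D) (Vel D) (Pres D) where
  a := opA
  b := opB
  m := opM hC
  κ := C₄ ^ 2
  κ_pos := pow_pos hC.1 2
  norm_a_le := norm_opA_le
  norm_b_le := norm_opB_le
  norm_m_le := norm_pairMat_tensorL_le hC

/-- The functional `⟨⟨g, ·⟩⟩` of a pressure. -/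
def pairingL : Pres D →L[ℝ] Pres D →L[ℝ] ℝ := innerSL ℝ

theorem pairingL_apply (g q : Pres D) : pairingL g q = pairing g q := by
  change inner ℝ (g : Lp ℝ 2 D.vol) (q : Lp ℝ 2 D.vol) = _
  rw [L2.inner_def, pairing]
  exact integral_congr_ae (Filter.Eventually.of_forall fun x => mul_comm _ _)

theorem norm_pairingL (g : Pres D) : ‖pairingL g‖ = ‖g‖ := innerSL_apply_norm ℝ g

theorem contDiffOn_pairingL {E : Type*} [NormedAddCommGroup E] [NormedSpace ℝ E] {U : Set E}
    {g : E → Pres D} (hg : ContDiffOn ℝ ∞ g U) : ContDiffOn ℝ ∞ (fun y => pairingL (g y)) U :=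
  pairingL.contDiff.comp_contDiffOn hg

theorem norm_multiDeriv_pairingL {s : ℕ} {U : Set (Fin s → ℝ)} (hU : UniqueDiffOn ℝ U)
    {g : (Fin s → ℝ) → Pres D} (hg : ContDiffOn ℝ ∞ g U) (ν : Fin s → ℕ) {y : Fin s → ℝ}
    (hy : y ∈ U) : ‖multiDeriv U ν (fun y => pairingL (g y)) y‖ = ‖multiDeriv U ν g y‖ := by
  rw [multiDeriv_eq_iterDir, multiDeriv_eq_iterDir]
  exact (congrArg norm (iterDir_clm hU hg pairingL (indexList ν) hy)).trans (norm_pairingL _)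

theorem isSol_iff (hC : IsSobolevConst D C₄) {A B M : Coeff D} {f : VelDual D} {g : Pres D}
    {u : Vel D} {p : Pres D} :
    (nsForms hC).IsSol A B M f (pairingL g) u p ↔ IsSolution A B M f g u p := by
  refine and_congr ?_ ?_
  · rw [ContinuousLinearMap.ext_iff]
    refine forall_congr' fun v => ?_
    change opA A u v + opM hC M u u v - opB B v p = f v ↔ _
    rw [opA_apply, opM_apply, opB_apply]
  · rw [ContinuousLinearMap.ext_iff]
    refine forall_congr' fun q => ?_
    change opB B u q = pairingL g q ↔ _
    rw [opB_apply, pairingL_apply]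

theorem opB_eq_zero_iff {B : Coeff D} {v : Vel D} : opB B v = 0 ↔ v ∈ kerSpace B := by
  rw [ContinuousLinearMap.ext_iff]
  exact forall_congr' fun q => by rw [opB_apply]; rfl

/-- The inf-sup condition as a lower bound of the transposed operator. -/
theorem le_norm_bT_of_infSup (hC : IsSobolevConst D C₄) {β : ℝ} {B : Coeff D}
    (h : ∀ p : Pres D, p ≠ 0 →
      β ≤ ⨆ u : {u : Vel D // u ≠ 0}, formB u.1 p B / (‖u.1‖ * ‖p‖)) (q : Pres D) :
    β * ‖q‖ ≤ ‖(nsForms hC).bT B q‖ := by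
  rcases eq_or_ne q 0 with rfl | hq
  · rw [norm_zero, mul_zero]
    exact norm_nonneg _
  have hq0 := norm_pos_iff.2 hq
  rw [← le_div_iff₀ hq0]
  refine (h q hq).trans (Real.iSup_le (fun u => ?_) (by positivity))
  have hu := norm_pos_iff.2 u.2
  rw [← div_div]
  refine div_le_div_of_nonneg_right ?_ hq0.le
  rw [div_le_iff₀ hu, ← opB_apply]
  exact (le_abs_self _).trans (((nsForms hC).bT B q).le_opNorm u)

end forms

/-! ### Nontriviality of the velocity space -/

section nontrivial

variable {d : ℕ} (D : BoundedDomain d)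

/-- A smooth bump supported in `D` is a nonzero element of `H¹₀(D)`. -/
instance : Nontrivial (H10 D) := by
  obtain ⟨x₀, hx₀⟩ := D.nonempty
  obtain ⟨r, hr, hrD⟩ := Metric.nhds_basis_closedBall.mem_iff.1 (D.isOpen.mem_nhds hx₀)
  let φ : ContDiffBump x₀ := ⟨r / 2, r, by positivity, by linarith⟩
  have hs : ContDiff ℝ ∞ φ := φ.contDiff
  have hφ : IsTest D φ := ⟨hs, φ.hasCompactSupport, by rw [φ.tsupport_eq]; exact hrD⟩
  have hgc : Continuous (∇ (φ : Space d → ℝ)) :=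
    (InnerProductSpace.toDual ℝ (Space d)).symm.continuous.comp
      (hs.continuous_fderiv (by simp))
  have hgs : HasCompactSupport (∇ (φ : Space d → ℝ)) :=
    (φ.hasCompactSupport.fderiv ℝ).comp_left
      (g := (InnerProductSpace.toDual ℝ (Space d)).symm) (by simp)
  have m1 : MemLp φ 2 D.vol :=
    (hs.continuous.memLp_of_hasCompactSupport φ.hasCompactSupport).restrict _
  have m2 : MemLp (∇ (φ : Space d → ℝ)) 2 D.vol :=
    (hgc.memLp_of_hasCompactSupport hgs).restrict _
  let w : Lp ℝ 2 D.vol × Lp (Space d) 2 D.vol := (m1.toLp φ, m2.toLp (∇ (φ : Space d → ℝ)))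
  have hw : w ∈ (testGraph D).topologicalClosure :=
    (testGraph D).le_topologicalClosure ⟨φ, hφ, m1.coeFn_toLp, m2.coeFn_toLp⟩
  refine ⟨⟨⟨w, hw⟩, 0, fun h => ?_⟩⟩
  have h0 : w = 0 := congrArg Subtype.val h
  have h1 : m1.toLp φ = 0 := congrArg Prod.fst h0
  have h2 : ∀ᵐ x ∂volume.restrict D.carrier, φ x = 0 :=
    m1.coeFn_toLp.symm.trans (h1 ▸ Lp.coeFn_zero ℝ 2 D.vol)
  rw [ae_restrict_iff' D.isOpen.measurableSet] at h2
  have hb : Metric.ball x₀ (r / 2) ⊆ {x | ¬(x ∈ D.carrier → φ x = 0)} := fun x hx => by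
    have hx' := Metric.ball_subset_closedBall hx
    have h3 : φ x = 1 := φ.one_of_mem_closedBall hx'
    have h4 : x ∈ D.carrier := hrD (Metric.closedBall_subset_closedBall (by linarith) hx')
    simp [h3, h4]
  exact (Metric.measure_ball_pos volume x₀ (half_pos hr)).ne' (measure_mono_null hb h2)

instance : Nontrivial (Vel D) := by
  obtain ⟨u, hu⟩ := exists_ne (0 : H10 D)
  refine ⟨⟨WithLp.toLp 2 fun _ => u, 0, fun h => hu ?_⟩⟩
  exact congrArg (fun v : Vel D => v ⟨0, D.dim_pos⟩) h

/-- Coercivity and boundedness of `a` are compatible only if the constants are ordered. -/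
theorem two_mul_le_of_coercive {α a : ℝ} {A : Coeff D} (hA : ‖A‖ ≤ a / 2)
    (h : ∀ u : Vel D, α * ‖u‖ ^ 2 ≤ formA u u A) : 2 * α ≤ a := by
  obtain ⟨u, hu⟩ := exists_ne (0 : Vel D)
  have hu0 := norm_pos_iff.2 hu
  have h1 : formA u u A ≤ a / 2 * ‖u‖ ^ 2 := by
    rw [← opA_apply]
    calc opA A u u ≤ ‖opA A u‖ * ‖u‖ := (le_abs_self _).trans ((opA A u).le_opNorm u)
      _ ≤ a / 2 * ‖u‖ * ‖u‖ := by
        gcongr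
        exact (norm_opA_le A u).trans (by gcongr)
      _ = a / 2 * ‖u‖ ^ 2 := by ring
  have h2 := le_of_mul_le_mul_right ((h u).trans h1) (by positivity)
  linarith

end nontrivial

end ParamNS

end

open ParamNS in
theorem mainTheorem2 {d s : ℕ} (hd : d ≤ 3) (D : BoundedDomain d)
    (C₄ : ℝ) (hC₄ : IsSobolevConst D C₄)
    (U : Set (Fin s → ℝ)) (hU : UniqueDiffOn ℝ U)
    (A B M : (Fin s → ℝ) → Coeff D) (f : (Fin s → ℝ) → VelDual D) (g : (Fin s → ℝ) → Pres D)
    (c : Consts) (δ : ℝ) (hδ : 1 ≤ δ) (R : Fin s → ℝ)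
    (hcoeff : CoeffAssumption U C₄ c A B M)
    (hstab : StabilityAssumption U c A B)
    (hsmall : SmallDataAssumption U c f g)
    (hgev : GevreyAssumption U C₄ c δ R A B M f g)
    (hγ : c.IsRadius) :
    -- the solution in the ball of radius `γ` is unique
    (∀ y ∈ U, ∀ u₁ p₁ u₂ p₂,
      IsSolution (A y) (B y) (M y) (f y) (g y) u₁ p₁ → ‖u₁‖ ≤ c.γ →
      IsSolution (A y) (B y) (M y) (f y) (g y) u₂ p₂ → ‖u₂‖ ≤ c.γ →
      u₁ = u₂ ∧ p₁ = p₂) ∧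
    -- it exists if `g(y)` has a lifting in `V^⊥` of norm at most `ḡ / (2β)`, e.g. if `g(y) = 0`
    (∀ y ∈ U,
      (∃ w ∈ perpSpace (A y) (B y),
        (∀ q, formB w q (B y) = pairing (g y) q) ∧ ‖w‖ ≤ c.g / (2 * c.β)) →
      ∃ u p, IsSolution (A y) (B y) (M y) (f y) (g y) u p ∧ ‖u‖ ≤ c.γ) ∧
    -- it is smooth in the parameter and its derivatives obey the explicit bounds
    (∀ (u : (Fin s → ℝ) → Vel D) (p : (Fin s → ℝ) → Pres D),
      (∀ y ∈ U, IsSolution (A y) (B y) (M y) (f y) (g y) (u y) (p y) ∧ ‖u y‖ ≤ c.γ) →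
      ContDiffOn ℝ ∞ u U ∧ ContDiffOn ℝ ∞ p U ∧
      ∀ ν : Fin s → ℕ, ν ≠ 0 → ∀ y ∈ U,
        ‖multiDeriv U ν u y‖ ≤
          c.Cu * c.ρ ^ (order ν - 1) * fallingHalf (order ν) / multiPow R ν *
            ((order ν).factorial : ℝ) ^ (δ - 1) ∧
        ‖multiDeriv U ν p y‖ ≤
          c.Cp * c.ρ ^ (order ν - 1) * fallingHalf (order ν) / multiPow R ν *
            ((order ν).factorial : ℝ) ^ (δ - 1)) := by
  have hmγ : c.m * c.γ < c.α := by
    have := (lt_div_iff₀ hcoeff.m_pos).1 hγ.2.1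
    rwa [mul_comm] at this
  have hm := hcoeff.m_pos
  have hα := hstab.α_pos
  have hβ := hstab.β_pos
  have hγ0 := hγ.1
  have hκ : 0 < C₄ ^ 2 := pow_pos hC₄.1 2
  have hA : ∀ y ∈ U, ∀ v, c.α * ‖v‖ ^ 2 ≤ (nsForms hC₄).a (A y) v v := fun y hy v =>
    (hstab.coercive y hy v).trans (opA_apply _ _ _).ge
  have hM : ∀ y ∈ U, (nsForms hC₄).κ * ‖M y‖ ≤ c.m / 2 := fun y hy =>
    (le_inv_mul_iff₀ hκ).1 (hcoeff.M_le y hy)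
  have hB : ∀ y ∈ U, ∀ q, c.β * ‖q‖ ≤ ‖(nsForms hC₄).bT (B y) q‖ := fun y hy =>
    le_norm_bT_of_infSup hC₄ (hstab.inf_sup y hy)
  refine ⟨fun y hy u₁ p₁ u₂ p₂ h₁ hu₁ h₂ hu₂ => ?_, ?_, fun u p hsol => ?_⟩
  · refine SaddleForms.IsSol.unique (hA y hy) (hM y hy) hβ (hB y hy)
      ((isSol_iff hC₄).2 h₁) ((isSol_iff hC₄).2 h₂) ?_
    nlinarith
  · rintro y hy ⟨w, hw, hwb, hwγ⟩
    have hr : ‖w‖ + (‖f y‖ + c.m / 2 * c.γ ^ 2) / c.α ≤ c.γ := by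
      have h1 : (‖f y‖ + c.m / 2 * c.γ ^ 2) / c.α ≤ (c.f / 2 + c.m / 2 * c.γ ^ 2) / c.α := by
        gcongr
        exact hsmall.f_le y hy
      have h2 : c.g / (2 * c.β) + (c.f / 2 + c.m / 2 * c.γ ^ 2) / c.α = c.γ := by
        refine Eq.trans ?_ hγ.2.2
        field_simp
        ring
      linarith
    obtain ⟨u, p, hs, hu⟩ := SaddleForms.exists_isSol (f := f y) (G := pairingL (g y)) hα
      (hA y hy) (hM y hy) hm hβ (hB y hy) hγ0 hmγ
      (fun v hv => (opA_apply _ _ _).trans (hw v (opB_eq_zero_iff.1 hv)))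
      (ContinuousLinearMap.ext fun q =>
        (opB_apply _ _ _).trans ((hwb q).trans (pairingL_apply _ _).symm)) hr
    exact ⟨u, p, (isSol_iff hC₄).1 hs, hu⟩
  · have hsol' : ∀ y ∈ U, (nsForms hC₄).IsSol (A y) (B y) (M y) (f y) (pairingL (g y))
        (u y) (p y) := fun y hy => (isSol_iff hC₄).2 (hsol y hy).1
    have hGs : ContDiffOn ℝ ∞ (fun y => pairingL (g y)) U :=
      contDiffOn_pairingL hgev.g_smooth
    have hs := SaddleForms.contDiffOn_of_isSol hA hM hβ hB hmγ hm hgev.A_smooth hgev.B_smooth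
      hgev.M_smooth hgev.f_smooth hGs fun y hy => ⟨hsol' y hy, (hsol y hy).2⟩
    refine ⟨hs.fst, hs.snd, fun ν hν y hy => ?_⟩
    have hc : c.Admissible :=
      { a_pos := hcoeff.a_pos
        b_pos := hcoeff.b_pos
        m_pos := hm
        α_pos := hα
        β_pos := hβ
        γ_pos := hγ0
        f_nonneg := by linarith [(norm_nonneg (f y)).trans (hsmall.f_le y hy)]
        g_nonneg := by linarith [(norm_nonneg (g y)).trans (hsmall.g_le y hy)]
        mγ_lt := hmγ
        two_α_le := two_mul_le_of_coercive D (hcoeff.A_le y hy) (hstab.coercive y hy)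
        radius := hγ.2.2 }
    have hG : ∀ ν, ‖multiDeriv U ν (fun y => pairingL (g y)) y‖ ≤ c.g * gevreyFactor δ R ν :=
      fun ν => (norm_multiDeriv_pairingL hU hgev.g_smooth ν hy).trans_le (hgev.g_le ν y hy)
    exact norm_multiDeriv_le hc hδ hU hgev.R_pos hgev.A_smooth hgev.B_smooth hgev.M_smooth
      hgev.f_smooth hGs hs.fst hs.snd hy (fun ν => hgev.A_le ν y hy) (fun ν => hgev.B_le ν y hy)
      (fun ν => hgev.M_le ν y hy) (fun ν => hgev.f_le ν y hy) hG (hcoeff.A_le y hy) (hM y hy)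
      (hsmall.f_le y hy) (hA y hy) (hB y hy) (hsol y hy).2 hsol' hν
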